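/- **Theorem (Uniqueness of Serrin-type solutions).** Let $n\ge 2$, $T>0$, $\mathbb T=\mathbb R^n/\mathbb Z^n$; all fields are real-valued and repeated indices are summed. For $s\in\mathbb R$ let $\|g\|_{H^s_\#}^2=\sum_{\xi\in\mathbb Z^n}\varrho(\xi)^{2s}|\hat g(\xi)|^2$ with $\varrho(\xi)=2\pi(1+|\xi|^2)^{1/2}$; let $\dot{\mathbf H}^s_\#$ be the space of $n$-component torus distributions with zero mean and finite $H^s_\#$ norm, $\dot{\mathbf H}^s_{\#\sigma}$ its divergence-free subspace, $\mathbb P_\sigma$ the Leray projector, and $\langle g,h\rangle_{\mathbb T}=\sum_\xi\hat g(\xi)\cdot\hat h(-\xi)$ the dual product. Let the viscosity coefficients $a_{kj}^{\alpha\beta}\in L_\infty(\mathbb T\times(0,T))$ satisfy $a_{kj}^{\alpha\beta}=a_{\alpha j}^{k\beta}=a_{k\beta}^{\alpha j}$ a.e. and the relaxed ellipticity condition: there is a constant $C_{\mathbb A}>0$ such that, for a.e. $(x,t)$, $C_{\mathbb A}\,a_{kj}^{\alpha\beta}(x,t)\zeta_{k\alpha}\zeta_{j\beta}\ge|\zeta|^2$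 for all symmetric $\zeta\in\mathbb R^{n\times n}$ with zero trace. Put $E_{j\beta}(\mathbf u)=\frac12(\partial_ju_\beta+\partial_\beta u_j)$ and $a_{\mathbb T}(t;\mathbf u,\mathbf w)=\int_{\mathbb T}a_{ij}^{\alpha\beta}(x,t)E_{j\beta}(\mathbf u)E_{i\alpha}(\mathbf w)\,dx$. Let $\mathbf f\in L_2(0,T;\dot{\mathbf H}^{-1}_\#)$ and $\mathbf u^0\in\dot{\mathbf H}^0_{\#\sigma}$. A *weak solution* on $[0,T]$ is a function $\mathbf u\in L_\infty(0,T;\dot{\mathbf H}^0_{\#\sigma})\cap L_2(0,T;\dot{\mathbf H}^1_{\#\sigma})$ such that, for a.e. $t\in(0,T)$ and all $\mathbf w\in\dot{\mathbf H}^1_{\#\sigma}$, $$\langle\mathbf u'(t)+\mathbb P_\sigma[(\mathbf u(t)\cdot\nabla)\mathbf u(t)],\mathbf w\rangle_{\mathbb T}+a_{\mathbb T}(t;\mathbf u(t),\mathbf w)=\langle\mathbf f(t),\mathbf w\rangle_{\mathbb T},$$ where $\mathbf u'$ is the distributional time derivative, and $\langle\mathbf u(0),\mathbf w\rangle_{\mathbb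 T}=\langle\mathbf u^0,\mathbf w\rangle_{\mathbb T}$ for all $\mathbf w\in\dot{\mathbf H}^0_{\#\sigma}$; pointwise values in time, such as $\mathbf u(0)$, are those of the version of $\mathbf u$ (equal to it for a.e. $t$) that is $\dot{\mathbf H}^0_{\#\sigma}$-weakly continuous on $[0,T]$. A *Serrin-type solution* is a weak solution that belongs to $L_2(0,T;\dot{\mathbf H}^{n/2}_{\#\sigma})$. Let $\mathbf u$ be a Serrin-type solution, and let $\mathbf v$ be any weak solution with the same data that satisfies the energy inequality $$\tfrac12\|\mathbf v(t)\|^2_{\mathbf L_2}+\int_0^ta_{\mathbb T}(\tau;\mathbf v(\tau),\mathbf v(\tau))\,d\tau\le\tfrac12\|\mathbf u^0\|^2_{\mathbf L_2}+\int_0^t\langle\mathbf f(\tau),\mathbf v(\tau)\rangle_{\mathbb T}\,d\tau\qquad\forall\,t\in[0,T].$$ Then $\mathbf u=\mathbf v$ on $[0,T]$: $\mathbf u(t)=\mathbf v(t)$ for a.e. $t\in(0,T)$, and the weakly continuous versions agree for every $t\in[0,T]$. -/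

import Mathlib

open MeasureTheory Set
open scoped ContDiff

noncomputable section

namespace PeriodicNS

/-! ### The flat torus, smooth functions, distributions -/

/-- The flat torus `ℝⁿ / ℤⁿ`. -/
abbrev Torus (n : ℕ) : Type := UnitAddTorus (Fin n)

/-- Lebesgue measure on the torus (total mass one). -/
abbrev torusMeasure (n : ℕ) : Measure (Torus n) :=
  Measure.pi fun _ => AddCircle.haarAddCircle

/-- The projection `ℝⁿ → ℝⁿ / ℤⁿ`. -/
def proj {n : ℕ} (x : Fin n → ℝ) : Torus n := fun i => (x i : UnitAddCircle)

/-- `C^∞(𝕋)`: complex functions on the torus whose periodic lift to `ℝⁿ` is smooth. -/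
def SmoothFun (n : ℕ) : Submodule ℂ (Torus n → ℂ) where
  carrier := {φ | ContDiff ℝ ∞ fun x : Fin n → ℝ => φ (proj x)}
  add_mem' := by
    intro φ ψ hφ hψ
    rw [mem_ofPred_eq] at hφ hψ
    exact hφ.add hψ
  zero_mem' := by
    rw [mem_ofPred_eq]
    exact contDiff_const (c := (0 : ℂ))
  smul_mem' := by
    intro c φ hφ
    rw [mem_ofPred_eq] at hφ
    exact hφ.const_smul c

/-- The character `x ↦ exp (2 π i x · ξ)` as a smooth function. -/
def character {n : ℕ} (ξ : Fin n → ℤ) : SmoothFun n :=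
  ⟨fun x => UnitAddTorus.mFourier ξ x, by
    change ContDiff ℝ ∞ fun x : Fin n → ℝ => UnitAddTorus.mFourier ξ (proj x)
    have h : (fun x : Fin n → ℝ => UnitAddTorus.mFourier ξ (proj x)) =
        fun x => ∏ i, Complex.exp (2 * Real.pi * Complex.I * ξ i * ((x i : ℝ) : ℂ)) := by
      funext x
      simp [UnitAddTorus.mFourier, proj]
    rw [h]
    refine contDiff_prod fun i _ => ContDiff.cexp (contDiff_const.mul ?_)
    exact Complex.ofRealCLM.contDiff.comp (contDiff_apply ℝ ℝ i)⟩

/-- Torus distributions: linear functionals on `C^∞(𝕋)` that are bounded by finitely many of the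
seminorms `sup |D^j φ|`. -/
structure TorusDistribution (n : ℕ) where
  toFun : SmoothFun n →ₗ[ℂ] ℂ
  bounded' : ∃ (N : ℕ) (C : ℝ), ∀ (φ : SmoothFun n) (B : ℝ),
    (∀ j ≤ N, ∀ x : Fin n → ℝ,
      ‖iteratedFDeriv ℝ j (fun y : Fin n → ℝ => φ.1 (proj y)) x‖ ≤ B) → ‖toFun φ‖ ≤ C * B

/-- The Fourier coefficient `ĝ(ξ) = ⟨g, exp (-2 π i x · ξ)⟩` of a distribution. -/
def TorusDistribution.coeff {n : ℕ} (g : TorusDistribution n) (ξ : Fin n → ℤ) : ℂ :=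
  g.toFun (character (-ξ))

/-- A distribution is real-valued if it is real on real test functions. -/
def TorusDistribution.IsReal {n : ℕ} (g : TorusDistribution n) : Prop :=
  ∀ φ : SmoothFun n, (∀ x, (φ.1 x).im = 0) → (g.toFun φ).im = 0

/-- `n`-component vector distributions. -/
abbrev VecDistribution (n : ℕ) : Type := Fin n → TorusDistribution n

/-- Real `n`-component vector fields on the torus. -/
abbrev VelocityField (n : ℕ) : Type := Torus n → Fin n → ℝ

/-- Families `ξ ↦ ĉ(ξ) ∈ ℂⁿ`, `ξ ∈ ℤⁿ`, of vector Fourier coefficients. -/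
abbrev Coeffs (n : ℕ) : Type := (Fin n → ℤ) → Fin n → ℂ

/-- Fourier coefficients of a vector distribution. -/
def distCoeffs {n : ℕ} (g : VecDistribution n) : Coeffs n := fun ξ k => (g k).coeff ξ

/-- Fourier coefficients `ŵ(ξ) = ∫ exp (-2 π i x · ξ) w(x) dx` of a vector field. -/
def fieldCoeffs {n : ℕ} (w : VelocityField n) : Coeffs n :=
  fun ξ k => UnitAddTorus.mFourierCoeff (fun x => (w x k : ℂ)) ξ

/-! ### Periodic Sobolev spaces -/

/-- `ϱ(ξ) = 2 π (1 + |ξ|²)^{1/2}`. -/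
def rho {n : ℕ} (ξ : Fin n → ℤ) : ℝ := 2 * Real.pi * Real.sqrt (1 + ∑ j, (ξ j : ℝ) ^ 2)

/-- The square of the `H^s` norm, `∑_ξ ϱ(ξ)^{2s} |ĉ(ξ)|²`, with values in `[0, ∞]`. -/
def sobolevNormSq {n : ℕ} (s : ℝ) (c : Coeffs n) : ENNReal :=
  ∑' ξ, ENNReal.ofReal (rho ξ ^ (2 * s)) * ∑ k, ‖c ξ k‖ₑ ^ 2

/-- Vector fields with components in `L₂(𝕋)`. -/
def IsL2 {n : ℕ} (w : VelocityField n) : Prop :=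
  ∀ k, MemLp (fun x => w x k) 2 (torusMeasure n)

/-- The space `Ḣ^s_σ`, `s ≥ 0`, of real vector fields with finite `H^s` norm, zero mean and zero
divergence. -/
structure MemHsigma {n : ℕ} (s : ℝ) (w : VelocityField n) : Prop where
  isL2 : IsL2 w
  finite_norm : sobolevNormSq s (fieldCoeffs w) < ⊤
  mean_zero : fieldCoeffs w 0 = 0
  div_zero : ∀ ξ, ∑ j, 2 * Real.pi * Complex.I * (ξ j : ℂ) * fieldCoeffs w ξ j = 0

/-- The dual product `⟨c, d⟩ = ∑_ξ ĉ(ξ) · d̂(-ξ)`. -/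
def dualPair {n : ℕ} (c d : Coeffs n) : ℂ := ∑' ξ, ∑ k, c ξ k * d (-ξ) k

/-- The Leray projector onto zero-mean divergence-free distributions, in Fourier coefficients. -/
def leray {n : ℕ} (c : Coeffs n) : Coeffs n := fun ξ k =>
  if ξ = 0 then 0
  else c ξ k - (ξ k : ℂ) * (∑ j, (ξ j : ℂ) * c ξ j) / ∑ j, (ξ j : ℂ) ^ 2

/-- `h ∈ L₂(𝕋)` is the distributional derivative `∂_j g`, that is, `ĥ(ξ) = 2 π i ξ_j ĝ(ξ)`. -/
def IsWeakPartial {n : ℕ} (j : Fin n) (g h : Torus n → ℝ) : Prop :=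
  MemLp h 2 (torusMeasure n) ∧
    ∀ ξ, UnitAddTorus.mFourierCoeff (fun x => (h x : ℂ)) ξ =
      2 * Real.pi * Complex.I * (ξ j : ℂ) * UnitAddTorus.mFourierCoeff (fun x => (g x : ℂ)) ξ

open Classical in
/-- The distributional derivative `∂_j g` of `g ∈ H^1` (unique up to null sets). -/
def pderiv {n : ℕ} (j : Fin n) (g : Torus n → ℝ) : Torus n → ℝ :=
  if h : ∃ h, IsWeakPartial j g h then h.choose else 0

/-- The strain `E_{jβ}(u) = (∂_j u_β + ∂_β u_j) / 2`. -/
def strain {n : ℕ} (u : VelocityField n) (j b : Fin n) (x : Torus n) : ℝ :=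
  (pderiv j (fun y => u y b) x + pderiv b (fun y => u y j) x) / 2

/-- The advection term `(u · ∇) u`, an `L₁` field for `u ∈ H^1`. -/
def advection {n : ℕ} (u : VelocityField n) : VelocityField n :=
  fun x k => ∑ j, u x j * pderiv j (fun y => u y k) x

/-- `∫_𝕋 v · w dx`. -/
def innerL2 {n : ℕ} (v w : VelocityField n) : ℝ := ∫ x, ∑ k, v x k * w x k ∂torusMeasure n

/-! ### Functions of time -/

/-- Lebesgue measure on the time interval `(0, T)`. -/
abbrev timeMeasure (T : ℝ) : Measure ℝ := volume.restrict (Ioo 0 T)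

/-- Measurability in time on `(0, T)`, coefficient by coefficient; in the separable Hilbert spaces
`H^s` this is strong measurability. -/
def TimeMeasurable {n : ℕ} (T : ℝ) (c : ℝ → Coeffs n) : Prop :=
  ∀ ξ k, AEMeasurable (fun t => c t ξ k) (timeMeasure T)

/-- `u ∈ L₂(0, T; Ḣ^s_σ)`, `s ≥ 0`. -/
structure MemL2Hsigma {n : ℕ} (T s : ℝ) (u : ℝ → VelocityField n) : Prop where
  measurable : TimeMeasurable T fun t => fieldCoeffs (u t)
  mem : ∀ᵐ t ∂timeMeasure T, MemHsigma s (u t)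
  finite_norm : ∫⁻ t, sobolevNormSq s (fieldCoeffs (u t)) ∂timeMeasure T < ⊤

/-- `u ∈ L_∞(0, T; Ḣ^s_σ)`, `s ≥ 0`. -/
structure MemLinftyHsigma {n : ℕ} (T s : ℝ) (u : ℝ → VelocityField n) : Prop where
  measurable : TimeMeasurable T fun t => fieldCoeffs (u t)
  mem : ∀ᵐ t ∂timeMeasure T, MemHsigma s (u t)
  finite_norm : essSup (fun t => sobolevNormSq s (fieldCoeffs (u t))) (timeMeasure T) < ⊤

/-- `f ∈ L₂(0, T; Ḣ^s)`, `s ∈ ℝ`, for real vector distributions of zero mean. -/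
structure MemL2Hdot {n : ℕ} (T s : ℝ) (f : ℝ → VecDistribution n) : Prop where
  real : ∀ᵐ t ∂timeMeasure T, ∀ k, (f t k).IsReal
  measurable : TimeMeasurable T fun t => distCoeffs (f t)
  mean_zero : ∀ᵐ t ∂timeMeasure T, distCoeffs (f t) 0 = 0
  finite_norm : ∫⁻ t, sobolevNormSq s (distCoeffs (f t)) ∂timeMeasure T < ⊤

/-- `u'` is the distributional time derivative of `u` on `(0, T)`: for every smooth `φ` on the torus
the function `t ↦ ⟨u'(t), φ⟩` is the weak derivative of `t ↦ ⟨u(t), φ⟩`. -/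
def IsTimeDeriv {n : ℕ} (T : ℝ) (u : ℝ → VelocityField n) (u' : ℝ → VecDistribution n) : Prop :=
  ∀ (k : Fin n) (φ : SmoothFun n),
    LocallyIntegrableOn (fun t => (u' t k).toFun φ) (Ioo 0 T) ∧
    ∀ ψ : ℝ → ℝ, ContDiff ℝ ∞ ψ → HasCompactSupport ψ → tsupport ψ ⊆ Ioo 0 T →
      ∫ t in Ioo 0 T, ((deriv ψ t : ℝ) : ℂ) * ∫ x, (u t x k : ℂ) * φ.1 x ∂torusMeasure n =
        - ∫ t in Ioo 0 T, ((ψ t : ℝ) : ℂ) * (u' t k).toFun φ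

/-- `ũ` equals `u` for almost every time and is weakly continuous on `[0, T]` with values in
`Ḣ^0_σ`. -/
structure IsWeaklyContinuousVersion {n : ℕ} (T : ℝ) (u ũ : ℝ → VelocityField n) : Prop where
  ae_eq : ∀ᵐ t ∂timeMeasure T, ũ t =ᵐ[torusMeasure n] u t
  mem : ∀ t ∈ Icc 0 T, MemHsigma 0 (ũ t)
  continuous : ∀ w : VelocityField n, IsL2 w → ContinuousOn (fun t => innerL2 (ũ t) w) (Icc 0 T)

/-! ### The anisotropic Navier-Stokes problem -/

/-- A fourth-order viscosity tensor: `a k j α β t x` is `a_{kj}^{αβ}(x, t)`. -/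
abbrev Viscosity (n : ℕ) : Type := Fin n → Fin n → Fin n → Fin n → ℝ → Torus n → ℝ

/-- `a_{kj}^{αβ} ∈ L_∞(𝕋 × (0, T))`. -/
def Viscosity.Bounded {n : ℕ} (T : ℝ) (a : Viscosity n) : Prop :=
  ∀ k j α β, MemLp (fun p : ℝ × Torus n => a k j α β p.1 p.2) ⊤
    ((timeMeasure T).prod (torusMeasure n))

/-- `a_{kj}^{αβ} = a_{αj}^{kβ} = a_{kβ}^{αj}` almost everywhere. -/
def Viscosity.Symmetric {n : ℕ} (T : ℝ) (a : Viscosity n) : Prop :=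
  ∀ᵐ p ∂(timeMeasure T).prod (torusMeasure n), ∀ k j α β,
    a k j α β p.1 p.2 = a α j k β p.1 p.2 ∧ a k j α β p.1 p.2 = a k β α j p.1 p.2

/-- Relaxed ellipticity: coercivity, almost everywhere, on symmetric matrices of zero trace. -/
def Viscosity.RelaxedElliptic {n : ℕ} (T : ℝ) (a : Viscosity n) : Prop :=
  ∃ C : ℝ, 0 < C ∧ ∀ᵐ p ∂(timeMeasure T).prod (torusMeasure n),
    ∀ ζ : Matrix (Fin n) (Fin n) ℝ, ζ.transpose = ζ → ζ.trace = 0 →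
      ∑ k, ∑ α, ζ k α ^ 2 ≤
        C * ∑ k, ∑ j, ∑ α, ∑ β, a k j α β p.1 p.2 * ζ k α * ζ j β

/-- The form `a_𝕋(t; u, w) = ∫ a_{ij}^{αβ}(x, t) E_{jβ}(u) E_{iα}(w) dx`. -/
def viscousForm {n : ℕ} (a : Viscosity n) (t : ℝ) (u w : VelocityField n) : ℝ :=
  ∫ x, ∑ i, ∑ j, ∑ α, ∑ β, a i j α β t x * strain u j β x * strain w i α x ∂torusMeasure n

/-- Weak solutions on `[0, T]` of the anisotropic Navier-Stokes initial value problem with viscosity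
`a`, force `f` and initial velocity `u₀`. The initial value is that of the weakly continuous
version of `u`. -/
structure IsWeakSolution {n : ℕ} (T : ℝ) (a : Viscosity n) (f : ℝ → VecDistribution n)
    (u₀ : VelocityField n) (u : ℝ → VelocityField n) : Prop where
  mem_Linfty : MemLinftyHsigma T 0 u
  mem_L2 : MemL2Hsigma T 1 u
  equation : ∃ u' : ℝ → VecDistribution n, IsTimeDeriv T u u' ∧
    ∀ᵐ t ∂timeMeasure T, ∀ w : VelocityField n, MemHsigma 1 w →
      dualPair (distCoeffs (u' t) + leray (fieldCoeffs (advection (u t)))) (fieldCoeffs w)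
          + (viscousForm a t (u t) w : ℂ) =
        dualPair (distCoeffs (f t)) (fieldCoeffs w)
  initial : ∃ ũ, IsWeaklyContinuousVersion T u ũ ∧
    ∀ w : VelocityField n, MemHsigma 0 w → innerL2 (ũ 0) w = innerL2 u₀ w

/-- Serrin-type solutions: weak solutions in `L₂(0, T; Ḣ^{n/2}_σ)`. -/
structure IsSerrinSolution {n : ℕ} (T : ℝ) (a : Viscosity n) (f : ℝ → VecDistribution n)
    (u₀ : VelocityField n) (u : ℝ → VelocityField n) : Prop where
  isWeakSolution : IsWeakSolution T a f u₀ u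
  mem_L2 : MemL2Hsigma T ((n : ℝ) / 2) u

/-- The standard energy inequality, for all `t ∈ [0, T]`, for the weakly continuous version. -/
def EnergyInequality {n : ℕ} (T : ℝ) (a : Viscosity n) (f : ℝ → VecDistribution n)
    (u₀ : VelocityField n) (v : ℝ → VelocityField n) : Prop :=
  ∃ w, IsWeaklyContinuousVersion T v w ∧ ∀ t ∈ Icc 0 T,
    1 / 2 * innerL2 (w t) (w t) + ∫ τ in (0 : ℝ)..t, viscousForm a τ (w τ) (w τ) ≤
      1 / 2 * innerL2 u₀ u₀
        + ∫ τ in (0 : ℝ)..t, (dualPair (distCoeffs (f τ)) (fieldCoeffs (w τ))).re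

end PeriodicNS

end

open PeriodicNS

noncomputable section

namespace PeriodicNS

open Filter Topology UnitAddTorus
open scoped ComplexConjugate

variable {n : ℕ}

/-! ### Fourier series on the torus -/

theorem mFourierCoeff_def (F : Torus n → ℂ) (ξ : Fin n → ℤ) :
    mFourierCoeff F ξ = ∫ x, mFourier (-ξ) x * F x ∂torusMeasure n := rfl

theorem mFourierCoeff_congr_ae {F G : Torus n → ℂ} (h : F =ᵐ[torusMeasure n] G) :
    mFourierCoeff F = mFourierCoeff G := by
  funext ξ
  rw [mFourierCoeff_def, mFourierCoeff_def]
  refine integral_congr_ae ?_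
  filter_upwards [h] with x hx
  rw [hx]

theorem mFourierCoeff_conj (F : Torus n → ℂ) (ξ : Fin n → ℤ) :
    mFourierCoeff (fun x => conj (F x)) ξ = conj (mFourierCoeff F (-ξ)) := by
  rw [mFourierCoeff_def, mFourierCoeff_def, ← integral_conj]
  congr 1
  funext x
  rw [map_mul, ← mFourier_neg, neg_neg]

theorem norm_mFourier_apply (ξ : Fin n → ℤ) (x : Torus n) : ‖mFourier ξ x‖ = 1 := by
  simp [mFourier, fourier_apply, norm_prod, Circle.norm_coe]

/-- Parseval's identity for the integral of a product. -/
theorem hasSum_mFourierCoeff_mul {F G : Torus n → ℂ} (hF : MemLp F 2 (torusMeasure n))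
    (hG : MemLp G 2 (torusMeasure n)) :
    HasSum (fun η => mFourierCoeff F (-η) * mFourierCoeff G η)
      (∫ x, F x * G x ∂torusMeasure n) := by
  have hF' : MemLp (fun x => conj (F x)) 2 (torusMeasure n) := hF.star
  have key := hasSum_prod_mFourierCoeff (d := Fin n) (hF'.toLp _) (hG.toLp _)
  have e1 : mFourierCoeff (hF'.toLp _ : Torus n → ℂ) = mFourierCoeff (fun x => conj (F x)) :=
    mFourierCoeff_congr_ae hF'.coeFn_toLp
  have e2 : mFourierCoeff (hG.toLp _ : Torus n → ℂ) = mFourierCoeff G :=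
    mFourierCoeff_congr_ae hG.coeFn_toLp
  rw [e1, e2] at key
  have e3 : (∫ x, conj ((hF'.toLp _ : Torus n → ℂ) x) * (hG.toLp _ : Torus n → ℂ) x
      ∂torusMeasure n) = ∫ x, F x * G x ∂torusMeasure n := by
    refine integral_congr_ae ?_
    filter_upwards [hF'.coeFn_toLp, hG.coeFn_toLp] with x h1 h2
    rw [h1, h2, Complex.conj_conj]
  have key' := key
  simp only [mFourierCoeff_conj, Complex.conj_conj] at key'
  rw [← e3]
  exact key'

theorem memLp_mFourier_mul {F : Torus n → ℂ} (hF : MemLp F 2 (torusMeasure n))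
    (ξ : Fin n → ℤ) : MemLp (fun x => mFourier ξ x * F x) 2 (torusMeasure n) := by
  refine hF.of_le ((mFourier ξ).continuous.aestronglyMeasurable.mul hF.1) (ae_of_all _ fun x => ?_)
  rw [norm_mul, norm_mFourier_apply, one_mul]

theorem mFourierCoeff_mFourier_mul (F : Torus n → ℂ) (ξ η : Fin n → ℤ) :
    mFourierCoeff (fun x => mFourier ξ x * F x) η = mFourierCoeff F (η - ξ) := by
  rw [mFourierCoeff_def, mFourierCoeff_def]
  congr 1
  funext x
  rw [← mul_assoc, ← mFourier_add]
  congr 3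
  abel

/-- The Fourier coefficients of a product are the convolution of the Fourier coefficients. -/
theorem hasSum_mFourierCoeff_convolution {F G : Torus n → ℂ} (hF : MemLp F 2 (torusMeasure n))
    (hG : MemLp G 2 (torusMeasure n)) (ξ : Fin n → ℤ) :
    HasSum (fun η => mFourierCoeff F (ξ - η) * mFourierCoeff G η)
      (mFourierCoeff (fun x => F x * G x) ξ) := by
  have := hasSum_mFourierCoeff_mul (memLp_mFourier_mul hF (-ξ)) hG
  simp only [mFourierCoeff_mFourier_mul] at this
  rw [mFourierCoeff_def]
  simp only [mul_assoc] at this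
  refine this.congr_fun fun η => ?_
  congr 2
  abel

theorem hasSum_norm_sq_mFourierCoeff {F : Torus n → ℂ} (hF : MemLp F 2 (torusMeasure n)) :
    HasSum (fun η => ‖mFourierCoeff F η‖ ^ 2) (∫ x, ‖F x‖ ^ 2 ∂torusMeasure n) := by
  have key := hasSum_sq_mFourierCoeff (d := Fin n) (hF.toLp _)
  rw [show mFourierCoeff (hF.toLp _ : Torus n → ℂ) = mFourierCoeff F from
    mFourierCoeff_congr_ae hF.coeFn_toLp] at key
  have e3 : (∫ x, ‖(hF.toLp _ : Torus n → ℂ) x‖ ^ 2 ∂torusMeasure n)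
      = ∫ x, ‖F x‖ ^ 2 ∂torusMeasure n := by
    refine integral_congr_ae ?_
    filter_upwards [hF.coeFn_toLp] with x h1
    rw [h1]
  rw [← e3]
  exact key

theorem ae_eq_of_mFourierCoeff_eq {F G : Torus n → ℂ} (hF : MemLp F 2 (torusMeasure n))
    (hG : MemLp G 2 (torusMeasure n)) (h : mFourierCoeff F = mFourierCoeff G) :
    F =ᵐ[torusMeasure n] G := by
  have : hF.toLp F = hG.toLp G := by
    apply (mFourierBasis (d := Fin n)).repr.injective
    ext i
    rw [mFourierBasis_repr, mFourierBasis_repr]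
    have e1 : mFourierCoeff (hF.toLp _ : Torus n → ℂ) = mFourierCoeff F :=
      mFourierCoeff_congr_ae hF.coeFn_toLp
    have e2 : mFourierCoeff (hG.toLp _ : Torus n → ℂ) = mFourierCoeff G :=
      mFourierCoeff_congr_ae hG.coeFn_toLp
    rw [e1, e2, h]
  exact (MemLp.toLp_eq_toLp_iff hF hG).1 this

theorem exists_mFourierCoeff_eq {c : (Fin n → ℤ) → ℂ} (hc : Summable fun ξ => ‖c ξ‖ ^ 2) :
    ∃ F : Torus n → ℂ, MemLp F 2 (torusMeasure n) ∧ mFourierCoeff F = c := by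
  have hc' : Memℓp c 2 := by
    rw [memℓp_gen_iff (by norm_num)]
    simpa using hc
  refine ⟨((mFourierBasis (d := Fin n)).repr.symm ⟨c, hc'⟩ : _), Lp.memLp _, ?_⟩
  funext ξ
  refine (mFourierBasis_repr _ ξ).symm.trans ?_
  rw [LinearIsometryEquiv.apply_symm_apply]

/-- A complex field with conjugation-symmetric coefficients is real: Riesz-Fischer for real
functions. -/
theorem exists_real_mFourierCoeff_eq {c : (Fin n → ℤ) → ℂ} (hc : Summable fun ξ => ‖c ξ‖ ^ 2)
    (hconj : ∀ ξ, c (-ξ) = conj (c ξ)) :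
    ∃ g : Torus n → ℝ, MemLp g 2 (torusMeasure n) ∧
      mFourierCoeff (fun x => (g x : ℂ)) = c := by
  obtain ⟨F, hF, hFc⟩ := exists_mFourierCoeff_eq hc
  have hF' : MemLp (fun x => conj (F x)) 2 (torusMeasure n) := hF.star
  have hae : (fun x => conj (F x)) =ᵐ[torusMeasure n] F := by
    refine ae_eq_of_mFourierCoeff_eq hF' hF ?_
    funext ξ
    rw [mFourierCoeff_conj, hFc, hconj, Complex.conj_conj]
  refine ⟨fun x => (F x).re, hF.re, ?_⟩
  rw [← hFc]
  refine mFourierCoeff_congr_ae ?_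
  filter_upwards [hae] with x hx
  exact Complex.conj_eq_iff_re.1 hx

theorem memLp_ofReal {g : Torus n → ℝ} (hg : MemLp g 2 (torusMeasure n)) :
    MemLp (fun x => (g x : ℂ)) 2 (torusMeasure n) := hg.ofReal

theorem mFourierCoeff_ofReal_neg (g : Torus n → ℝ) (ξ : Fin n → ℤ) :
    mFourierCoeff (fun x => (g x : ℂ)) (-ξ) = conj (mFourierCoeff (fun x => (g x : ℂ)) ξ) := by
  have h := mFourierCoeff_conj (fun x => (g x : ℂ)) (-ξ)
  rw [neg_neg] at h
  rw [← h]
  simp only [Complex.conj_ofReal]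

theorem ae_eq_of_mFourierCoeff_ofReal_eq {g h : Torus n → ℝ} (hg : MemLp g 2 (torusMeasure n))
    (hh : MemLp h 2 (torusMeasure n))
    (e : mFourierCoeff (fun x => (g x : ℂ)) = mFourierCoeff (fun x => (h x : ℂ))) :
    g =ᵐ[torusMeasure n] h := by
  filter_upwards [ae_eq_of_mFourierCoeff_eq hg.ofReal hh.ofReal e] with x hx
  exact_mod_cast hx

theorem mFourierCoeff_mFourier (ζ ξ : Fin n → ℤ) :
    mFourierCoeff (fun x => mFourier ζ x) ξ = if ξ = ζ then 1 else 0 := by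
  have h := orthonormal_iff_ite.1 (orthonormal_mFourier (d := Fin n)) ξ ζ
  rw [← h, ContinuousMap.inner_toLp]
  rw [mFourierCoeff_def]
  refine integral_congr_ae (ae_of_all _ fun x => ?_)
  simp only [mFourier_neg, mul_comm]

/-! ### The weight and the lattice -/

theorem one_le_sqrt_one_add_sum (ξ : Fin n → ℤ) : 1 ≤ Real.sqrt (1 + ∑ j, (ξ j : ℝ) ^ 2) := by
  rw [Real.one_le_sqrt]
  have : 0 ≤ ∑ j, (ξ j : ℝ) ^ 2 := Finset.sum_nonneg fun _ _ => sq_nonneg _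
  linarith

theorem abs_le_sqrt_one_add_sum (ξ : Fin n → ℤ) (i : Fin n) :
    |(ξ i : ℝ)| ≤ Real.sqrt (1 + ∑ j, (ξ j : ℝ) ^ 2) := by
  refine Real.abs_le_sqrt ?_
  have : (ξ i : ℝ) ^ 2 ≤ ∑ j, (ξ j : ℝ) ^ 2 :=
    Finset.single_le_sum (f := fun j => (ξ j : ℝ) ^ 2) (fun _ _ => sq_nonneg _)
      (Finset.mem_univ i)
  linarith

theorem two_pi_abs_le_rho (ξ : Fin n → ℤ) (i : Fin n) : 2 * Real.pi * |(ξ i : ℝ)| ≤ rho ξ := by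
  have := abs_le_sqrt_one_add_sum ξ i
  unfold rho
  have := Real.pi_pos
  gcongr

theorem one_add_abs_le_rho (ξ : Fin n → ℤ) (i : Fin n) : 1 + |(ξ i : ℝ)| ≤ rho ξ := by
  have h1 := abs_le_sqrt_one_add_sum ξ i
  have h2 := one_le_sqrt_one_add_sum ξ
  have h3 := Real.pi_gt_three
  unfold rho
  nlinarith

theorem one_le_rho (ξ : Fin n → ℤ) : 1 ≤ rho ξ := by
  have h2 := one_le_sqrt_one_add_sum ξ
  have h3 := Real.pi_gt_three
  unfold rho
  nlinarith

theorem rho_pos (ξ : Fin n → ℤ) : 0 < rho ξ := one_pos.trans_le (one_le_rho ξ)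

theorem rho_sq (ξ : Fin n → ℤ) : rho ξ ^ 2 = 4 * Real.pi ^ 2 * (1 + ∑ j, (ξ j : ℝ) ^ 2) := by
  have : 0 ≤ ∑ j, (ξ j : ℝ) ^ 2 := Finset.sum_nonneg fun _ _ => sq_nonneg _
  rw [rho, mul_pow, Real.sq_sqrt (by linarith)]
  ring

theorem rho_neg (ξ : Fin n → ℤ) : rho (-ξ) = rho ξ := by
  simp [rho]

theorem rho_add_le (ξ ζ : Fin n → ℤ) : rho (ξ + ζ) ≤ rho ξ + rho ζ := by
  have hs : ∀ ξ : Fin n → ℤ, 0 ≤ ∑ j, (ξ j : ℝ) ^ 2 :=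
    fun ξ => Finset.sum_nonneg fun _ _ => sq_nonneg _
  rw [rho, rho, rho, ← mul_add]
  have := Real.pi_pos
  refine mul_le_mul_of_nonneg_left ?_ (by positivity)
  refine Real.sqrt_le_iff.2 ⟨by positivity, ?_⟩
  have h1 := hs ξ
  have h2 := hs ζ
  rw [add_sq, Real.sq_sqrt (by linarith), Real.sq_sqrt (by linarith)]
  have h3 : ∑ j, (ξ j : ℝ) * (ζ j : ℝ) ≤
      Real.sqrt (1 + ∑ j, (ξ j : ℝ) ^ 2) * Real.sqrt (1 + ∑ j, (ζ j : ℝ) ^ 2) := by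
    refine (Real.sum_mul_le_sqrt_mul_sqrt _ _ _).trans ?_
    gcongr <;> linarith
  have h4 : ∑ j, ((ξ + ζ) j : ℝ) ^ 2 =
      ∑ j, (ξ j : ℝ) ^ 2 + 2 * ∑ j, (ξ j : ℝ) * (ζ j : ℝ) + ∑ j, (ζ j : ℝ) ^ 2 := by
    rw [Finset.mul_sum, ← Finset.sum_add_distrib, ← Finset.sum_add_distrib]
    refine Finset.sum_congr rfl fun j _ => ?_
    push_cast [Pi.add_apply]
    ring
  rw [h4]
  linarith

/-- The cube of frequencies `|ξ_i| ≤ N`. -/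
def cube (n N : ℕ) : Finset (Fin n → ℤ) :=
  Fintype.piFinset fun _ => Finset.Icc (-(N : ℤ)) N

theorem mem_cube {N : ℕ} {ξ : Fin n → ℤ} : ξ ∈ cube n N ↔ ∀ i, |ξ i| ≤ N := by
  simp [cube, Fintype.mem_piFinset, abs_le]

theorem neg_mem_cube {N : ℕ} {ξ : Fin n → ℤ} : -ξ ∈ cube n N ↔ ξ ∈ cube n N := by
  simp [mem_cube]

theorem cube_mono : Monotone (cube n) := fun N M h ξ hξ => by
  rw [mem_cube] at *
  exact fun i => (hξ i).trans (by exact_mod_cast h)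

theorem tendsto_cube_atTop : Tendsto (cube n) atTop atTop := by
  refine tendsto_atTop_finset_of_monotone cube_mono fun ξ => ?_
  refine ⟨∑ i, (ξ i).natAbs, mem_cube.2 fun i => ?_⟩
  rw [Int.abs_eq_natAbs]
  exact_mod_cast Finset.single_le_sum (f := fun i => (ξ i).natAbs) (fun _ _ => Nat.zero_le _)
    (Finset.mem_univ i)

theorem card_cube (N : ℕ) : (cube n N).card = (2 * N + 1) ^ n := by
  rw [cube, Fintype.card_piFinset_const, Int.card_Icc]
  congr 1
  omega

theorem pow_sub_pow_le_mul {x y : ℝ} (hy : 0 ≤ y) (hxy : y ≤ x) (m : ℕ) :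
    x ^ (m + 1) - y ^ (m + 1) ≤ (m + 1) * (x - y) * x ^ m := by
  induction m with
  | zero => simp
  | succ m ih =>
    have h1 : x ^ (m + 1 + 1) - y ^ (m + 1 + 1) =
        x * (x ^ (m + 1) - y ^ (m + 1)) + (x - y) * y ^ (m + 1) := by ring
    have h2 : y ^ (m + 1) ≤ x ^ (m + 1) := pow_le_pow_left₀ hy hxy _
    have hx : 0 ≤ x := hy.trans hxy
    rw [h1]
    calc x * (x ^ (m + 1) - y ^ (m + 1)) + (x - y) * y ^ (m + 1)
        ≤ x * ((m + 1) * (x - y) * x ^ m) + (x - y) * x ^ (m + 1) := by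
          gcongr
      _ = _ := by push_cast; ring

/-- The lattice sum of `ϱ^{1-n}` over a cube grows at most linearly. -/
theorem sum_cube_inv_rho_pow_le (m N : ℕ) :
    ∑ ξ ∈ cube (m + 1) N, (rho ξ)⁻¹ ^ m ≤ (m + 1) * 2 ^ (m + 1) * (N + 1) := by
  induction N with
  | zero =>
    have : cube (m + 1) 0 = {0} := by
      ext ξ
      simp [mem_cube, funext_iff]
    rw [this, Finset.sum_singleton]
    have h1 : (rho (0 : Fin (m + 1) → ℤ))⁻¹ ^ m ≤ 1 :=
      pow_le_one₀ (inv_nonneg.2 (rho_pos _).le) (inv_le_one_of_one_le₀ (one_le_rho _))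
    have h2 : (1 : ℝ) ≤ 2 ^ (m + 1) := one_le_pow₀ (by norm_num)
    have h3 : (1 : ℝ) ≤ m + 1 := by
      have : (0 : ℝ) ≤ m := Nat.cast_nonneg m
      linarith
    push_cast
    nlinarith
  | succ N ih =>
    rw [← Finset.sum_sdiff (cube_mono (Nat.le_succ N))]
    have hb : ∀ ξ ∈ cube (m + 1) (N + 1) \ cube (m + 1) N,
        (rho ξ)⁻¹ ^ m ≤ ((N : ℝ) + 2)⁻¹ ^ m := by
      intro ξ hξ
      rw [Finset.mem_sdiff, mem_cube, mem_cube] at hξ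
      push Not at hξ
      obtain ⟨i, hi⟩ := hξ.2
      have h1 : (N : ℝ) + 1 ≤ |(ξ i : ℝ)| := by
        exact_mod_cast hi
      have h2 := one_add_abs_le_rho ξ i
      have := rho_pos ξ
      gcongr
      linarith
    have hc : ((cube (m + 1) (N + 1) \ cube (m + 1) N).card : ℝ) ≤
        (m + 1) * 2 * (2 ^ m * ((N : ℝ) + 2) ^ m) := by
      rw [Finset.card_sdiff_of_subset (cube_mono (Nat.le_succ N)), card_cube, card_cube,
        Nat.cast_sub (Nat.pow_le_pow_left (by omega) _)]
      have := pow_sub_pow_le_mul (x := 2 * ((N : ℝ) + 1) + 1) (y := 2 * (N : ℝ) + 1)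
        (by positivity) (by linarith) m
      push_cast
      refine this.trans ?_
      rw [← mul_pow]
      have e : 2 * ((N : ℝ) + 1) + 1 - (2 * N + 1) = 2 := by ring
      rw [e]
      gcongr
      linarith
    calc _ ≤ (cube (m + 1) (N + 1) \ cube (m + 1) N).card • ((N : ℝ) + 2)⁻¹ ^ m
          + (m + 1) * 2 ^ (m + 1) * (N + 1) := add_le_add (Finset.sum_le_card_nsmul _ _ _ hb) ih
      _ ≤ (m + 1) * 2 * (2 ^ m * ((N : ℝ) + 2) ^ m) * ((N : ℝ) + 2)⁻¹ ^ m
          + (m + 1) * 2 ^ (m + 1) * (N + 1) := by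
          rw [nsmul_eq_mul]
          gcongr
      _ = _ := by
          have : ((N : ℝ) + 2) ^ m * ((N : ℝ) + 2)⁻¹ ^ m = 1 := by
            rw [← mul_pow, mul_inv_cancel₀ (by positivity), one_pow]
          calc _ = (m + 1) * 2 * 2 ^ m * (((N : ℝ) + 2) ^ m * ((N : ℝ) + 2)⁻¹ ^ m)
                + (m + 1) * 2 ^ (m + 1) * (N + 1) := by ring
            _ = _ := by
              rw [this]
              push_cast
              ring

/-- The weight `ϱ(ξ)` with values in `[0, ∞]`. -/
def erho (ξ : Fin n → ℤ) : ENNReal := ENNReal.ofReal (rho ξ)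

theorem erho_ne_zero (ξ : Fin n → ℤ) : erho ξ ≠ 0 := by
  simp [erho, rho_pos]

theorem erho_ne_top (ξ : Fin n → ℤ) : erho ξ ≠ ⊤ := ENNReal.ofReal_ne_top

theorem erho_neg (ξ : Fin n → ℤ) : erho (-ξ) = erho ξ := by rw [erho, rho_neg, erho]

theorem erho_add_le (ξ ζ : Fin n → ℤ) : erho (ξ + ζ) ≤ erho ξ + erho ζ := by
  rw [erho, erho, erho, ← ENNReal.ofReal_add (rho_pos _).le (rho_pos _).le]
  exact ENNReal.ofReal_le_ofReal (rho_add_le _ _)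

theorem tsum_inv_erho_pow_le (m : ℕ) : ∃ C : ENNReal, C ≠ ⊤ ∧ ∀ ζ : Fin (m + 1) → ℤ,
    ∑' ξ : Fin (m + 1) → ℤ, (if erho ξ ≤ 2 * erho ζ then (erho ξ)⁻¹ ^ m else 0) ≤
      C * erho ζ := by
  refine ⟨ENNReal.ofReal ((m + 1) * 2 ^ (m + 1) * 3), ENNReal.ofReal_ne_top, fun ζ => ?_⟩
  have h1 : 0 ≤ 2 * rho ζ := by have := rho_pos ζ; positivity
  set N := ⌊2 * rho ζ⌋₊
  have hN : (N : ℝ) ≤ 2 * rho ζ := Nat.floor_le h1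
  rw [tsum_eq_sum (s := cube (m + 1) N)]
  · calc _ ≤ ∑ ξ ∈ cube (m + 1) N, (erho ξ)⁻¹ ^ m :=
          Finset.sum_le_sum fun ξ _ => by split_ifs <;> simp
      _ = ENNReal.ofReal (∑ ξ ∈ cube (m + 1) N, (rho ξ)⁻¹ ^ m) := by
          rw [ENNReal.ofReal_sum_of_nonneg fun ξ _ =>
            pow_nonneg (inv_nonneg.2 (rho_pos ξ).le) m]
          refine Finset.sum_congr rfl fun ξ _ => ?_
          rw [ENNReal.ofReal_pow (inv_nonneg.2 (rho_pos ξ).le),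
            ENNReal.ofReal_inv_of_pos (rho_pos ξ), erho]
      _ ≤ _ := by
          rw [erho, ← ENNReal.ofReal_mul (by positivity)]
          refine ENNReal.ofReal_le_ofReal ((sum_cube_inv_rho_pow_le m N).trans ?_)
          rw [mul_assoc _ (3 : ℝ)]
          have := one_le_rho ζ
          gcongr
          linarith
  · intro ξ hξ
    rw [if_neg]
    intro h
    refine hξ (mem_cube.2 fun i => ?_)
    have h2 : rho ξ ≤ 2 * rho ζ := by
      rw [erho, erho, ← ENNReal.ofReal_ofNat 2, ← ENNReal.ofReal_mul (by norm_num),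
        ENNReal.ofReal_le_ofReal_iff h1] at h
      exact h
    have h3 := one_add_abs_le_rho ξ i
    have h4 : (|ξ i|.toNat : ℝ) ≤ 2 * rho ζ := by
      have : ((|ξ i|.toNat : ℤ) : ℝ) = |(ξ i : ℝ)| := by
        rw [Int.toNat_of_nonneg (abs_nonneg _)]
        push_cast
        rfl
      have h5 : (|ξ i|.toNat : ℝ) = |(ξ i : ℝ)| := by exact_mod_cast this
      linarith
    have := Nat.le_floor h4
    have h6 := abs_nonneg (ξ i)
    omega

/-! ### The trilinear estimate -/

theorem tsum_sq_le_of_sq_le_mul {ι : Type*} {F p q : ι → ENNReal}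
    (h : ∀ i, F i ^ 2 ≤ p i * q i) : (∑' i, F i) ^ 2 ≤ (∑' i, p i) * ∑' i, q i := by
  have hF : ∀ i, F i ≤ p i ^ (1 / 2 : ℝ) * q i ^ (1 / 2 : ℝ) := by
    intro i
    rw [← ENNReal.mul_rpow_of_nonneg _ _ (by norm_num : (0 : ℝ) ≤ 1 / 2)]
    calc F i = (F i ^ 2) ^ (1 / 2 : ℝ) := by
          rw [← ENNReal.rpow_natCast, ← ENNReal.rpow_mul]; norm_num
      _ ≤ _ := ENNReal.rpow_le_rpow (h i) (by norm_num)
  have hs : ∀ x : ENNReal, (x ^ (1 / 2 : ℝ)) ^ (2 : ℝ) = x := fun x => by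
    rw [← ENNReal.rpow_mul]; norm_num
  have key : ∑' i, F i ≤ ((∑' i, p i) * ∑' i, q i) ^ (1 / 2 : ℝ) := by
    refine ENNReal.summable.tsum_le_of_sum_le fun s => ?_
    refine (Finset.sum_le_sum fun i _ => hF i).trans ?_
    refine (ENNReal.inner_le_Lp_mul_Lq s _ _ Real.HolderConjugate.two_two).trans ?_
    simp only [hs]
    rw [← ENNReal.mul_rpow_of_nonneg _ _ (by norm_num : (0 : ℝ) ≤ 1 / 2)]
    refine ENNReal.rpow_le_rpow ?_ (by norm_num)
    gcongr <;> exact ENNReal.sum_le_tsum s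
  calc (∑' i, F i) ^ 2 ≤ (((∑' i, p i) * ∑' i, q i) ^ (1 / 2 : ℝ)) ^ 2 := by gcongr
    _ = _ := by rw [← ENNReal.rpow_natCast]; exact hs _

theorem mul_pow_le_add_pow {x y : ENNReal} (m : ℕ) : x * y ^ m ≤ x ^ (m + 1) + y ^ (m + 1) := by
  rcases le_total x y with h | h
  · refine le_add_left ?_
    rw [pow_succ']
    gcongr
  · refine le_add_right ?_
    rw [pow_succ']
    gcongr

theorem tsum_inv_erho_mul_le (m : ℕ) : ∃ C : ENNReal, C ≠ ⊤ ∧ ∀ ζ : Fin (m + 2) → ℤ,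
    ∑' η : Fin (m + 2) → ℤ, (if erho (-ζ - η) ≤ erho ζ then
      (erho (-ζ - η))⁻¹ * (erho η)⁻¹ ^ m else 0) ≤ C * erho ζ := by
  obtain ⟨C, hC, h⟩ := tsum_inv_erho_pow_le (m + 1)
  refine ⟨2 * C, ENNReal.mul_ne_top (by simp) hC, fun ζ => ?_⟩
  set G : (Fin (m + 2) → ℤ) → ENNReal :=
    fun ξ => if erho ξ ≤ 2 * erho ζ then (erho ξ)⁻¹ ^ (m + 1) else 0 with hG
  calc _ ≤ ∑' η, (G (-ζ - η) + G η) := by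
        refine ENNReal.tsum_le_tsum fun η => ?_
        split_ifs with hle
        · have h1 : erho (-ζ - η) ≤ 2 * erho ζ :=
            hle.trans (by rw [two_mul]; exact le_add_right le_rfl)
          have h2 : erho η ≤ 2 * erho ζ := by
            have e : η = (ζ + η) + -ζ := by abel
            have e2 : erho (ζ + η) = erho (-ζ - η) := by
              rw [← erho_neg]; congr 1; abel
            calc erho η = erho ((ζ + η) + -ζ) := by rw [← e]
              _ ≤ erho (ζ + η) + erho (-ζ) := erho_add_le _ _
              _ ≤ erho ζ + erho ζ := by rw [e2, erho_neg]; gcongr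
              _ = _ := (two_mul _).symm
          simp only [hG]
          rw [if_pos h1, if_pos h2]
          exact mul_pow_le_add_pow m
        · exact zero_le
    _ = ∑' η, G η + ∑' η, G η := by
        rw [ENNReal.tsum_add]
        congr 1
        exact (Equiv.subLeft (-ζ)).tsum_eq G
    _ ≤ _ := by
        rw [← two_mul, mul_assoc]
        gcongr
        exact h ζ

/-- The half of the trilinear sum in which the first frequency is at most the third. -/
theorem tsum_trilinear_half_le (m : ℕ) : ∃ C : ENNReal, C ≠ ⊤ ∧
    ∀ A U D : (Fin (m + 2) → ℤ) → ENNReal,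
      (∑' η, ∑' ζ, if erho (-ζ - η) ≤ erho ζ then A (-ζ - η) * (erho η * U η) * D ζ else 0) ^ 2 ≤
        C * (∑' ξ, erho ξ * A ξ ^ 2) * (∑' ξ, erho ξ * D ξ ^ 2) *
          ∑' ξ, erho ξ ^ (m + 2) * U ξ ^ 2 := by
  obtain ⟨C, hC, h⟩ := tsum_inv_erho_mul_le m
  refine ⟨C, hC, fun A U D => ?_⟩
  set F : (Fin (m + 2) → ℤ) × (Fin (m + 2) → ℤ) → ENNReal := fun p =>
    if erho (-p.2 - p.1) ≤ erho p.2 then A (-p.2 - p.1) * (erho p.1 * U p.1) * D p.2 else 0 with hF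
  set P : (Fin (m + 2) → ℤ) × (Fin (m + 2) → ℤ) → ENNReal := fun p =>
    (erho (-p.2 - p.1) * A (-p.2 - p.1) ^ 2) * (erho p.1 ^ (m + 2) * U p.1 ^ 2) with hP
  set Q : (Fin (m + 2) → ℤ) × (Fin (m + 2) → ℤ) → ENNReal := fun p =>
    D p.2 ^ 2 * (if erho (-p.2 - p.1) ≤ erho p.2 then
      (erho (-p.2 - p.1))⁻¹ * (erho p.1)⁻¹ ^ m else 0) with hQ
  have hle : ∀ p, F p ^ 2 ≤ P p * Q p := by
    intro p
    simp only [hF, hP, hQ]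
    split_ifs
    · have e1 : erho (-p.2 - p.1) * (erho (-p.2 - p.1))⁻¹ = 1 :=
        ENNReal.mul_inv_cancel (erho_ne_zero _) (erho_ne_top _)
      have e2 : erho p.1 ^ m * (erho p.1)⁻¹ ^ m = 1 := by
        rw [← mul_pow, ENNReal.mul_inv_cancel (erho_ne_zero _) (erho_ne_top _), one_pow]
      refine le_of_eq ?_
      calc _ = A (-p.2 - p.1) ^ 2 * (erho p.1 ^ 2 * U p.1 ^ 2) * D p.2 ^ 2 * 1 * 1 := by ring
        _ = _ := by
          nth_rewrite 1 [← e1]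
          rw [← e2]
          ring
    · simp
  have hPs : ∑' p, P p = (∑' ξ, erho ξ * A ξ ^ 2) * ∑' ξ, erho ξ ^ (m + 2) * U ξ ^ 2 := by
    rw [ENNReal.tsum_prod', ← ENNReal.tsum_mul_left]
    refine tsum_congr fun η => ?_
    simp only [hP]
    rw [ENNReal.tsum_mul_right]
    congr 1
    have := ((Equiv.neg _).trans (Equiv.subRight η)).tsum_eq
      (fun ξ : Fin (m + 2) → ℤ => erho ξ * A ξ ^ 2)
    exact this
  have hQs : ∑' p, Q p ≤ C * ∑' ξ, erho ξ * D ξ ^ 2 := by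
    rw [ENNReal.tsum_prod', ENNReal.tsum_comm, ← ENNReal.tsum_mul_left]
    refine ENNReal.tsum_le_tsum fun ζ => ?_
    simp only [hQ]
    rw [ENNReal.tsum_mul_left, ← mul_assoc, mul_comm _ (D ζ ^ 2)]
    gcongr
    exact h ζ
  calc _ = (∑' p, F p) ^ 2 := by rw [ENNReal.tsum_prod']
    _ ≤ (∑' p, P p) * ∑' p, Q p := tsum_sq_le_of_sq_le_mul hle
    _ ≤ ((∑' ξ, erho ξ * A ξ ^ 2) * ∑' ξ, erho ξ ^ (m + 2) * U ξ ^ 2) *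
        (C * ∑' ξ, erho ξ * D ξ ^ 2) := by rw [hPs]; gcongr
    _ = _ := by ring

/-- The trilinear estimate `H^{1/2} × H^{n/2} × H^{1/2}`, with one derivative on the middle
factor. -/
theorem tsum_trilinear_le (hn : 2 ≤ n) : ∃ C : ENNReal, C ≠ ⊤ ∧
    ∀ A U D : (Fin n → ℤ) → ENNReal,
      (∑' η, ∑' ζ, A (-ζ - η) * (erho η * U η) * D ζ) ^ 2 ≤
        C * (∑' ξ, erho ξ * A ξ ^ 2) * (∑' ξ, erho ξ * D ξ ^ 2) *
          ∑' ξ, erho ξ ^ n * U ξ ^ 2 := by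
  obtain ⟨m, rfl⟩ : ∃ m, n = m + 2 := ⟨n - 2, by omega⟩
  obtain ⟨C, hC, h⟩ := tsum_trilinear_half_le m
  refine ⟨4 * C, ENNReal.mul_ne_top (by simp) hC, fun A U D => ?_⟩
  set T : ((Fin (m + 2) → ℤ) → ENNReal) → ((Fin (m + 2) → ℤ) → ENNReal) → ENNReal := fun A D =>
    ∑' η, ∑' ζ, if erho (-ζ - η) ≤ erho ζ then A (-ζ - η) * (erho η * U η) * D ζ else 0 with hT
  have hle : ∑' η, ∑' ζ, A (-ζ - η) * (erho η * U η) * D ζ ≤ T A D + T D A := by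
    simp only [hT]
    rw [← ENNReal.tsum_add]
    refine ENNReal.tsum_le_tsum fun η => ?_
    have e := ((Equiv.neg _).trans (Equiv.subRight η)).tsum_eq (fun ζ : Fin (m + 2) → ℤ =>
      if erho (-ζ - η) ≤ erho ζ then D (-ζ - η) * (erho η * U η) * A ζ else 0)
    rw [← e, ← ENNReal.tsum_add]
    refine ENNReal.tsum_le_tsum fun ζ => ?_
    have e2 : -(-ζ - η) - η = ζ := by abel
    simp only [Equiv.trans_apply, Equiv.neg_apply, Equiv.subRight_apply, e2]
    rcases le_total (erho (-ζ - η)) (erho ζ) with h1 | h1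
    · rw [if_pos h1]
      exact le_add_right le_rfl
    · rw [if_pos h1]
      refine le_add_left (le_of_eq ?_)
      ring
  have hmax : ∀ x y z : ENNReal, x ^ 2 ≤ z → y ^ 2 ≤ z → (x + y) ^ 2 ≤ 4 * z := by
    intro x y z hx hy
    rcases le_total x y with hxy | hxy
    · calc (x + y) ^ 2 ≤ (y + y) ^ 2 := by gcongr
        _ = 4 * y ^ 2 := by ring
        _ ≤ _ := by gcongr
    · calc (x + y) ^ 2 ≤ (x + x) ^ 2 := by gcongr
        _ = 4 * x ^ 2 := by ring
        _ ≤ _ := by gcongr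
  calc _ ≤ (T A D + T D A) ^ 2 := by gcongr
    _ ≤ 4 * (C * (∑' ξ, erho ξ * A ξ ^ 2) * (∑' ξ, erho ξ * D ξ ^ 2) *
          ∑' ξ, erho ξ ^ (m + 2) * U ξ ^ 2) := by
        refine hmax _ _ _ (h A U D) ((h D U A).trans (le_of_eq ?_))
        ring
    _ = _ := by ring

/-! ### Functions of one real variable -/

theorem integral_mul_primitive_real {f g : ℝ → ℝ} {a b F₀ G₀ : ℝ}
    (hf : IntervalIntegrable f volume a b) (hg : IntervalIntegrable g volume a b) :
    ∫ x in a..b, f x * (G₀ + ∫ y in a..x, g y) + (F₀ + ∫ y in a..x, f y) * g x =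
      (F₀ + ∫ y in a..b, f y) * (G₀ + ∫ y in a..b, g y) - F₀ * G₀ := by
  have hc : ∀ c : ℝ, AbsolutelyContinuousOnInterval (fun _ : ℝ => c) a b := fun c =>
    (contDiffOn_const (𝕜 := ℝ) (n := 1)).absolutelyContinuousOnInterval
  have hF := (hc F₀).add (hf.absolutelyContinuousOnInterval_intervalIntegral (c := a) (by simp))
  have hG := (hc G₀).add (hg.absolutelyContinuousOnInterval_intervalIntegral (c := a) (by simp))
  have key := hF.integral_deriv_mul_eq_sub hG
  simp only [Pi.add_apply, intervalIntegral.integral_same, add_zero] at key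
  rw [← key]
  refine intervalIntegral.integral_congr_ae ?_
  filter_upwards [hf.ae_hasDerivAt_integral, hg.ae_hasDerivAt_integral] with x h1 h2 hx
  have hx' := uIoc_subset_uIcc hx
  have e1 := ((hasDerivAt_const x F₀).add (h1 hx' a (by simp))).deriv
  have e2 := ((hasDerivAt_const x G₀).add (h2 hx' a (by simp))).deriv
  simp only [zero_add] at e1 e2
  rw [show deriv ((fun _ => F₀) + fun x => ∫ y in a..x, f y) x = f x from e1,
    show deriv ((fun _ => G₀) + fun x => ∫ y in a..x, g y) x = g x from e2]

theorem intervalIntegral_re {f : ℝ → ℂ} {a b : ℝ} (hf : IntervalIntegrable f volume a b) :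
    ∫ x in a..b, (f x).re = (∫ x in a..b, f x).re :=
  Complex.reCLM.intervalIntegral_comp_comm hf

theorem intervalIntegral_im {f : ℝ → ℂ} {a b : ℝ} (hf : IntervalIntegrable f volume a b) :
    ∫ x in a..b, (f x).im = (∫ x in a..b, f x).im :=
  Complex.imCLM.intervalIntegral_comp_comm hf

theorem intervalIntegrable_re {f : ℝ → ℂ} {a b : ℝ} (hf : IntervalIntegrable f volume a b) :
    IntervalIntegrable (fun x => (f x).re) volume a b := ⟨hf.1.re, hf.2.re⟩

theorem intervalIntegrable_im {f : ℝ → ℂ} {a b : ℝ} (hf : IntervalIntegrable f volume a b) :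
    IntervalIntegrable (fun x => (f x).im) volume a b := ⟨hf.1.im, hf.2.im⟩

/-- The product rule for two primitives of integrable functions. -/
theorem integral_mul_primitive {f g F G : ℝ → ℂ} {a b : ℝ} (hab : a ≤ b)
    (hf : IntervalIntegrable f volume a b) (hg : IntervalIntegrable g volume a b)
    (hF : ∀ x ∈ Icc a b, F x - F a = ∫ y in a..x, f y)
    (hG : ∀ x ∈ Icc a b, G x - G a = ∫ y in a..x, g y) :
    IntervalIntegrable (fun x => f x * G x + F x * g x) volume a b ∧
    ∫ x in a..b, (f x * G x + F x * g x) = F b * G b - F a * G a := by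
  have sub : ∀ x ∈ Icc a b, uIcc a x ⊆ uIcc a b := fun x hx => by
    rw [uIcc_of_le hab, uIcc_of_le hx.1]
    exact Icc_subset_Icc_right hx.2
  have cont : ∀ {f F : ℝ → ℂ}, IntervalIntegrable f volume a b →
      (∀ x ∈ Icc a b, F x - F a = ∫ y in a..x, f y) → ContinuousOn F (uIcc a b) := by
    intro f F hf hF
    have h1 := intervalIntegral.continuousOn_primitive_interval' hf (a := a) (by simp)
    refine (h1.add (continuousOn_const (c := F a))).congr fun x hx => ?_
    rw [uIcc_of_le hab] at hx
    rw [Pi.add_apply, ← hF x hx]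
    ring
  have hFc := cont hf hF
  have hGc := cont hg hG
  have hi : IntervalIntegrable (fun x => f x * G x + F x * g x) volume a b :=
    (hf.mul_continuousOn hGc).add (hg.continuousOn_mul hFc)
  refine ⟨hi, ?_⟩
  have hre : ∀ {f F : ℝ → ℂ}, IntervalIntegrable f volume a b →
      (∀ x ∈ Icc a b, F x - F a = ∫ y in a..x, f y) → ∀ x ∈ Icc a b,
      (F x).re = (F a).re + ∫ y in a..x, (f y).re := by
    intro f F hf hF x hx
    rw [intervalIntegral_re (hf.mono_set (sub x hx)), ← hF x hx, Complex.sub_re]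
    ring
  have him : ∀ {f F : ℝ → ℂ}, IntervalIntegrable f volume a b →
      (∀ x ∈ Icc a b, F x - F a = ∫ y in a..x, f y) → ∀ x ∈ Icc a b,
      (F x).im = (F a).im + ∫ y in a..x, (f y).im := by
    intro f F hf hF x hx
    rw [intervalIntegral_im (hf.mono_set (sub x hx)), ← hF x hx, Complex.sub_im]
    ring
  have hb : b ∈ Icc a b := right_mem_Icc.2 hab
  have real : ∀ {f g F G : ℝ → ℝ}, IntervalIntegrable f volume a b →
      IntervalIntegrable g volume a b →
      (∀ x ∈ Icc a b, F x = F a + ∫ y in a..x, f y) →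
      (∀ x ∈ Icc a b, G x = G a + ∫ y in a..x, g y) →
      IntervalIntegrable (fun x => f x * G x + F x * g x) volume a b ∧
      ∫ x in a..b, (f x * G x + F x * g x) = F b * G b - F a * G a := by
    intro f g F G hf hg hF hG
    have hFc : ContinuousOn F (uIcc a b) := by
      refine ((continuousOn_const (c := F a)).add
        (intervalIntegral.continuousOn_primitive_interval' hf (a := a) (by simp))).congr ?_
      rw [uIcc_of_le hab]
      exact hF
    have hGc : ContinuousOn G (uIcc a b) := by
      refine ((continuousOn_const (c := G a)).add
        (intervalIntegral.continuousOn_primitive_interval' hg (a := a) (by simp))).congr ?_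
      rw [uIcc_of_le hab]
      exact hG
    refine ⟨(hf.mul_continuousOn hGc).add (hg.continuousOn_mul hFc), ?_⟩
    rw [hF b hb, hG b hb, ← integral_mul_primitive_real hf hg]
    refine intervalIntegral.integral_congr fun x hx => ?_
    rw [uIcc_of_le hab] at hx
    rw [hF x hx, hG x hx]
  obtain ⟨i1, r1⟩ := real (intervalIntegrable_re hf) (intervalIntegrable_re hg) (hre hf hF)
    (hre hg hG)
  obtain ⟨i2, r2⟩ := real (intervalIntegrable_im hf) (intervalIntegrable_im hg) (him hf hF)
    (him hg hG)
  obtain ⟨i3, r3⟩ := real (intervalIntegrable_re hf) (intervalIntegrable_im hg) (hre hf hF)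
    (him hg hG)
  obtain ⟨i4, r4⟩ := real (intervalIntegrable_im hf) (intervalIntegrable_re hg) (him hf hF)
    (hre hg hG)
  apply Complex.ext
  · rw [← intervalIntegral_re hi]
    have : ∫ x in a..b, (f x * G x + F x * g x).re =
        (∫ x in a..b, ((f x).re * (G x).re + (F x).re * (g x).re)) -
          ∫ x in a..b, ((f x).im * (G x).im + (F x).im * (g x).im) := by
      rw [← intervalIntegral.integral_sub i1 i2]
      congr 1
      funext x
      simp only [Complex.add_re, Complex.mul_re]
      ring
    rw [this, r1, r2]
    simp only [Complex.sub_re, Complex.mul_re]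
    ring
  · rw [← intervalIntegral_im hi]
    have : ∫ x in a..b, (f x * G x + F x * g x).im =
        (∫ x in a..b, ((f x).re * (G x).im + (F x).re * (g x).im)) +
          ∫ x in a..b, ((f x).im * (G x).re + (F x).im * (g x).re) := by
      rw [← intervalIntegral.integral_add i3 i4]
      congr 1
      funext x
      simp only [Complex.add_im, Complex.mul_im]
      ring
    rw [this, r3, r4]
    simp only [Complex.sub_im, Complex.mul_im]
    ring

theorem exists_subset_Ioo_of_isCompact {T : ℝ} (hT : 0 < T) {K : Set ℝ} (hK : IsCompact K)
    (hKs : K ⊆ Ioo 0 T) : ∃ p q : ℝ, 0 < p ∧ p ≤ q ∧ q < T ∧ K ⊆ Ioo p q := by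
  rcases K.eq_empty_or_nonempty with he | hne
  · exact ⟨T / 2, T / 2, by linarith, le_rfl, by linarith, by simp [he]⟩
  · have h1 := hKs (hK.sInf_mem hne)
    have h2 := hKs (hK.sSup_mem hne)
    have h3 : sInf K ≤ sSup K := csInf_le hK.bddBelow (hK.sSup_mem hne)
    refine ⟨sInf K / 2, (sSup K + T) / 2, by linarith [h1.1], by linarith [h1.1, h2.2],
      by linarith [h2.2], fun x hx => ⟨?_, ?_⟩⟩
    · linarith [csInf_le hK.bddBelow hx, h1.1]
    · linarith [le_csSup hK.bddAbove hx, h2.2]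

/-- A locally integrable function on `(0, T)` with vanishing weak derivative is constant. -/
theorem ae_eq_const_of_weakDeriv_eq_zero {T : ℝ} (hT : 0 < T) {h : ℝ → ℂ}
    (hh : LocallyIntegrableOn h (Ioo 0 T))
    (hw : ∀ ψ : ℝ → ℝ, ContDiff ℝ ∞ ψ → HasCompactSupport ψ → tsupport ψ ⊆ Ioo 0 T →
      ∫ t in Ioo 0 T, ((deriv ψ t : ℝ) : ℂ) * h t = 0) :
    ∃ c : ℂ, ∀ᵐ t, t ∈ Ioo 0 T → h t = c := by
  obtain ⟨ψ₀, hψ₀c, hψ₀s, hψ₀d, hψ₀i⟩ : ∃ ψ₀ : ℝ → ℝ, HasCompactSupport ψ₀ ∧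
      tsupport ψ₀ ⊆ Ioo 0 T ∧ ContDiff ℝ ∞ ψ₀ ∧ ∫ x, ψ₀ x = 1 := by
    let f : ContDiffBump (T / 2) := ⟨T / 8, T / 4, by positivity, by linarith⟩
    refine ⟨f.normed volume, f.hasCompactSupport_normed, ?_, f.contDiff_normed,
      f.integral_normed⟩
    rw [f.tsupport_normed_eq]
    intro x hx
    rw [Metric.mem_closedBall, Real.dist_eq, abs_le] at hx
    change -(T / 4) ≤ _ ∧ _ ≤ T / 4 at hx
    constructor <;> linarith [hx.1, hx.2]
  have key : ∀ φ : ℝ → ℝ, ContDiff ℝ ∞ φ → HasCompactSupport φ → tsupport φ ⊆ Ioo 0 T →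
      IntegrableOn (fun t => ((φ t : ℝ) : ℂ) * h t) (Ioo 0 T) := by
    intro φ hφ hφc hφs
    have h1 : IntegrableOn h (tsupport φ) := hh.integrableOn_compact_subset hφs hφc
    have h2 : IntegrableOn (fun t => ((φ t : ℝ) : ℂ) * h t) (tsupport φ) :=
      h1.continuousOn_mul (Complex.continuous_ofReal.comp hφ.continuous).continuousOn hφc
    refine IntegrableOn.mono_set (t := univ) ?_ (subset_univ _)
    rw [integrableOn_univ]
    refine (integrableOn_iff_integrable_of_support_subset ?_).1 h2
    intro t ht
    refine subset_tsupport φ ?_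
    rw [Function.mem_support] at ht ⊢
    rintro h0
    exact ht (by rw [h0]; simp)
  set c : ℂ := ∫ t in Ioo 0 T, ((ψ₀ t : ℝ) : ℂ) * h t
  refine ⟨c, ?_⟩
  have hsub : LocallyIntegrableOn (fun t => h t - c) (Ioo 0 T) :=
    hh.sub ((locallyIntegrable_const c).locallyIntegrableOn _)
  have := isOpen_Ioo.ae_eq_zero_of_integral_contDiff_smul_eq_zero (U := Ioo 0 T) hsub ?_
  · filter_upwards [this] with t ht hmem
    exact sub_eq_zero.1 (ht hmem)
  intro φ hφ hφc hφs
  set I : ℝ := ∫ x, φ x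
  set χ : ℝ → ℝ := fun x => φ x - I * ψ₀ x with hχ
  have hχd : ContDiff ℝ ∞ χ := hφ.sub (contDiff_const.mul hψ₀d)
  have hχs : Function.support χ ⊆ tsupport φ ∪ tsupport ψ₀ := by
    intro x hx
    by_contra hcon
    rw [mem_union, not_or] at hcon
    refine hx ?_
    simp only [hχ]
    rw [image_eq_zero_of_notMem_tsupport hcon.1, image_eq_zero_of_notMem_tsupport hcon.2]
    ring
  have hK : IsCompact (tsupport φ ∪ tsupport ψ₀) := hφc.union hψ₀c
  have hKs : tsupport φ ∪ tsupport ψ₀ ⊆ Ioo 0 T := union_subset hφs hψ₀s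
  have hφi : Integrable φ := hφ.continuous.integrable_of_hasCompactSupport hφc
  have hψi : Integrable ψ₀ := hψ₀d.continuous.integrable_of_hasCompactSupport hψ₀c
  have hχi : ∫ x, χ x = 0 := by
    simp only [hχ]
    rw [integral_sub hφi (hψi.const_mul I), integral_const_mul, hψ₀i]
    simp [I]
  obtain ⟨p, q, hp0, hpq, hqT, hp'⟩ := exists_subset_Ioo_of_isCompact hT hK hKs
  have hp := hp'.trans Ioo_subset_Icc_self
  have hq : Icc p q ⊆ Ioo 0 T := fun x hx => ⟨hp0.trans_le hx.1, hx.2.trans_lt hqT⟩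
  have hχ0 : ∀ x, x ∉ Icc p q → χ x = 0 := fun x hx => by
    by_contra h0
    exact hx (hp (hχs h0))
  set ψ : ℝ → ℝ := fun x => ∫ y in p..x, χ y with hψ
  have hψderiv : ∀ x, HasDerivAt ψ (χ x) x := fun x =>
    hχd.continuous.integral_hasStrictDerivAt p x |>.hasDerivAt
  have hψd : ContDiff ℝ ∞ ψ := by
    rw [contDiff_infty_iff_deriv]
    refine ⟨fun x => (hψderiv x).differentiableAt, ?_⟩
    rw [show deriv ψ = χ from funext fun x => (hψderiv x).deriv]
    exact hχd
  have hψ0 : ∀ x, x ∉ Icc p q → ψ x = 0 := by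
    intro x hx
    simp only [hψ]
    rcases lt_or_ge x p with hxp | hxp
    · rw [intervalIntegral.integral_symm, intervalIntegral.integral_of_le hxp.le,
        setIntegral_eq_zero_of_ae_eq_zero, neg_zero]
      filter_upwards [compl_mem_ae_iff.2 (measure_singleton (μ := volume) p)] with y hy1 hy2
      refine hχ0 y fun hy => hy1 ?_
      exact le_antisymm hy2.2 hy.1
    · have hxq : q < x := by
        by_contra hcon
        exact hx ⟨hxp, not_lt.1 hcon⟩
      rw [intervalIntegral.integral_of_le hxp, ← integral_Icc_eq_integral_Ioc,
        setIntegral_eq_integral_of_forall_compl_eq_zero, hχi]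
      intro y hy
      exact hχ0 y fun hy' => hy ⟨hy'.1, hy'.2.trans hxq.le⟩
  have hψt : tsupport ψ ⊆ Icc p q := by
    refine closure_minimal (fun x hx => ?_) isClosed_Icc
    by_contra hcon
    exact hx (hψ0 x hcon)
  have h0 := hw ψ hψd (HasCompactSupport.of_support_subset_isCompact isCompact_Icc
    (subset_closure.trans hψt)) (hψt.trans hq)
  rw [show deriv ψ = χ from funext fun x => (hψderiv x).deriv] at h0
  have h1 : ∫ t in Ioo 0 T, ((χ t : ℝ) : ℂ) * h t =
      (∫ t in Ioo 0 T, ((φ t : ℝ) : ℂ) * h t) - I * c := by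
    rw [← integral_const_mul, ← integral_sub (key φ hφ hφc hφs)
      ((key ψ₀ hψ₀d hψ₀c hψ₀s).const_mul _)]
    congr 1
    funext t
    simp only [hχ]
    push_cast
    ring
  have h2 : ∫ t in Ioo 0 T, ((φ t : ℝ) : ℂ) * h t = ∫ t, ((φ t : ℝ) : ℂ) * h t := by
    refine setIntegral_eq_integral_of_forall_compl_eq_zero fun t ht => ?_
    rw [image_eq_zero_of_notMem_tsupport fun hmem => ht (hφs hmem)]
    simp
  have h3 : Integrable fun t => ((φ t : ℝ) : ℂ) * h t := by
    refine (integrableOn_iff_integrable_of_support_subset (s := Ioo 0 T) ?_).1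
      (key φ hφ hφc hφs)
    intro t ht
    refine hφs (subset_tsupport φ ?_)
    rw [Function.mem_support] at ht ⊢
    rintro h0
    exact ht (by rw [h0]; simp)
  have h4 : ∫ t, φ t • (h t - c) = (∫ t, ((φ t : ℝ) : ℂ) * h t) - I * c := by
    have : ∀ t, φ t • (h t - c) = ((φ t : ℝ) : ℂ) * h t - ((φ t : ℝ) : ℂ) * c := fun t => by
      rw [Complex.real_smul]
      ring
    have hi : Integrable fun t => ((φ t : ℝ) : ℂ) := hφi.ofReal
    simp only [this]
    rw [integral_sub h3 (hi.mul_const c), integral_mul_const, integral_complex_ofReal]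
  rw [h4, ← h2, ← h1, h0]

/-- A function whose weak derivative on `(0, T)` is the locally integrable function `g` is a
primitive of `g`. -/
theorem sub_eq_integral_of_weakDeriv {T : ℝ} (hT : 0 < T) {F g : ℝ → ℂ}
    (hF : ContinuousOn F (Ioo 0 T)) (hg : LocallyIntegrableOn g (Ioo 0 T))
    (hw : ∀ ψ : ℝ → ℝ, ContDiff ℝ ∞ ψ → HasCompactSupport ψ → tsupport ψ ⊆ Ioo 0 T →
      ∫ t in Ioo 0 T, ((deriv ψ t : ℝ) : ℂ) * F t = - ∫ t in Ioo 0 T, ((ψ t : ℝ) : ℂ) * g t) :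
    ∀ s ∈ Ioo 0 T, ∀ t ∈ Ioo 0 T, F t - F s = ∫ τ in s..t, g τ := by
  have hint : ∀ s ∈ Ioo 0 T, ∀ t ∈ Ioo 0 T, IntervalIntegrable g volume s t := by
    intro s hs t ht
    refine (hg.integrableOn_compact_subset ?_ isCompact_uIcc).intervalIntegrable
    exact (ordConnected_Ioo.uIcc_subset hs ht)
  have hmid : T / 2 ∈ Ioo 0 T := ⟨by linarith, by linarith⟩
  set G : ℝ → ℂ := fun t => ∫ τ in (T / 2)..t, g τ with hG
  have hGsub : ∀ s ∈ Ioo 0 T, ∀ t ∈ Ioo 0 T, G t - G s = ∫ τ in s..t, g τ := by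
    intro s hs t ht
    simp only [hG]
    rw [intervalIntegral.integral_interval_sub_left (hint _ hmid _ ht) (hint _ hmid _ hs)]
  have hGc : ContinuousOn G (Ioo 0 T) := by
    intro x hx
    obtain ⟨p, q, hp, -, hq, hx'⟩ := exists_subset_Ioo_of_isCompact hT
      (isCompact_uIcc (a := T / 2) (b := x)) (ordConnected_Ioo.uIcc_subset hmid hx)
    have hpm : p ∈ Ioo 0 T := ⟨hp, (hx' left_mem_uIcc).1.trans hmid.2⟩
    have hqm : q ∈ Ioo 0 T := ⟨hmid.1.trans (hx' left_mem_uIcc).2, hq⟩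
    have h1 := intervalIntegral.continuousOn_primitive_interval' (hint p hpm q hqm) (a := T / 2)
      (by
        have := hx' left_mem_uIcc
        rw [uIcc_of_le (this.1.trans this.2).le]
        exact Ioo_subset_Icc_self this)
    refine (h1.continuousAt ?_).continuousWithinAt
    have := hx' right_mem_uIcc
    rw [uIcc_of_le (this.1.trans this.2).le]
    exact Icc_mem_nhds this.1 this.2
  have hFl : LocallyIntegrableOn F (Ioo 0 T) :=
    hF.locallyIntegrableOn measurableSet_Ioo
  have hGl : LocallyIntegrableOn G (Ioo 0 T) :=
    hGc.locallyIntegrableOn measurableSet_Ioo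
  obtain ⟨c, hc⟩ := ae_eq_const_of_weakDeriv_eq_zero hT (hFl.sub hGl) (fun ψ hψ hψc hψs => by
    obtain ⟨p, q, hp, hpq, hq, hK⟩ := exists_subset_Ioo_of_isCompact hT hψc hψs
    have hsub : Icc p q ⊆ Ioo 0 T := fun x hx => ⟨hp.trans_le hx.1, hx.2.trans_lt hq⟩
    have hψ0 : ∀ x, x ∉ Ioo p q → ψ x = 0 := fun x hx =>
      image_eq_zero_of_notMem_tsupport fun h => hx (hK h)
    have hd0 : ∀ x, x ∉ Ioo p q → deriv ψ x = 0 := fun x hx =>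
      image_eq_zero_of_notMem_tsupport fun h => hx (hK (tsupport_deriv_subset h))
    have hred : ∀ X : ℝ → ℂ, (∀ x, x ∉ Ioo p q → X x = 0) →
        ∫ t in Ioo 0 T, X t = ∫ t in p..q, X t := by
      intro X hX
      rw [intervalIntegral.integral_of_le hpq, ← integral_Icc_eq_integral_Ioc]
      refine (setIntegral_eq_of_subset_of_forall_sdiff_eq_zero measurableSet_Ioo hsub ?_)
      exact fun x hx => hX x fun h => hx.2 (Ioo_subset_Icc_self h)
    have hdc : Continuous (deriv ψ) := hψ.continuous_deriv (by simp)
    have hpm := hsub (left_mem_Icc.2 hpq)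
    have hqm := hsub (right_mem_Icc.2 hpq)
    obtain ⟨-, hprod⟩ := integral_mul_primitive (f := fun t => ((deriv ψ t : ℝ) : ℂ)) (g := g)
      (F := fun t => (ψ t : ℂ)) (G := G) hpq
      ((Complex.continuous_ofReal.comp hdc).intervalIntegrable _ _)
      (hint p hpm q hqm)
      (fun x hx => by
        rw [intervalIntegral.integral_ofReal, intervalIntegral.integral_deriv_eq_sub
          (fun y _ => (hψ.differentiable (by simp)) y) (hdc.intervalIntegrable _ _)]
        push_cast
        rfl)
      (fun x hx => hGsub p hpm x (hsub hx))
    have hw' := hw ψ hψ hψc hψs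
    rw [hred _ (fun x hx => by rw [hd0 x hx]; simp), hred _ (fun x hx => by rw [hψ0 x hx]; simp)]
      at hw'
    rw [hred _ (fun x hx => by rw [hd0 x hx]; simp)]
    have hdcc : Continuous fun t => ((deriv ψ t : ℝ) : ℂ) := Complex.continuous_ofReal.comp hdc
    have hψcc : Continuous fun t => ((ψ t : ℝ) : ℂ) := Complex.continuous_ofReal.comp hψ.continuous
    have i1 : IntervalIntegrable (fun t => ((deriv ψ t : ℝ) : ℂ) * F t) volume p q := by
      refine ContinuousOn.intervalIntegrable (hdcc.continuousOn.mul (hF.mono ?_))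
      rwa [uIcc_of_le hpq]
    have i2 : IntervalIntegrable (fun t => ((deriv ψ t : ℝ) : ℂ) * G t) volume p q := by
      refine ContinuousOn.intervalIntegrable (hdcc.continuousOn.mul (hGc.mono ?_))
      rwa [uIcc_of_le hpq]
    have i3 : IntervalIntegrable (fun t => ((ψ t : ℝ) : ℂ) * g t) volume p q :=
      (hint p hpm q hqm).continuousOn_mul hψcc.continuousOn
    rw [intervalIntegral.integral_add i2 i3, hψ0 p (by simp), hψ0 q (by simp)] at hprod
    have e : ∀ t, ((deriv ψ t : ℝ) : ℂ) * (F - G) t =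
        ((deriv ψ t : ℝ) : ℂ) * F t - ((deriv ψ t : ℝ) : ℂ) * G t := fun t => mul_sub _ _ _
    simp only [e]
    rw [intervalIntegral.integral_sub i1 i2, hw']
    simp only [Complex.ofReal_zero, zero_mul, sub_zero] at hprod
    linear_combination -hprod)
  have heq : EqOn (F - G) (fun _ => c) (Ioo 0 T) := by
    refine Measure.eqOn_open_of_ae_eq (μ := volume) ?_ isOpen_Ioo (hF.sub hGc) continuousOn_const
    exact (ae_restrict_iff' measurableSet_Ioo).2 hc
  intro s hs t ht
  rw [← hGsub s hs t ht]
  have h1 := heq hs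
  have h2 := heq ht
  simp only [Pi.sub_apply] at h1 h2
  linear_combination h2 - h1

/-- Gronwall's inequality with an integrable kernel and zero data. -/
theorem eq_zero_of_le_integral_mul {T : ℝ} (hT : 0 < T) {φ k : ℝ → ℝ}
    (hφ0 : ∀ t ∈ Icc 0 T, 0 ≤ φ t) {M : ℝ} (hφM : ∀ t ∈ Icc 0 T, φ t ≤ M)
    (hk0 : ∀ t, 0 ≤ k t) (hk : IntegrableOn k (Ioo 0 T))
    (hkφ : IntegrableOn (fun t => k t * φ t) (Ioo 0 T))
    (h : ∀ t ∈ Icc 0 T, φ t ≤ ∫ τ in (0 : ℝ)..t, k τ * φ τ) : ∀ t ∈ Icc 0 T, φ t = 0 := by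
  have hki : ∀ a ∈ Icc 0 T, ∀ b ∈ Icc 0 T, IntervalIntegrable k volume a b := fun a ha b hb =>
    (((integrableOn_Icc_iff_integrableOn_Ioo (μ := volume)).2 hk).mono_set
      (ordConnected_Icc.uIcc_subset ha hb)).intervalIntegrable
  have hkφi : ∀ a ∈ Icc 0 T, ∀ b ∈ Icc 0 T,
      IntervalIntegrable (fun t => k t * φ t) volume a b := fun a ha b hb =>
    (((integrableOn_Icc_iff_integrableOn_Ioo (μ := volume)).2 hkφ).mono_set
      (ordConnected_Icc.uIcc_subset ha hb)).intervalIntegrable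
  have h0T : (0 : ℝ) ∈ Icc 0 T := ⟨le_rfl, hT.le⟩
  have hM : 0 ≤ M := (hφ0 0 h0T).trans (hφM 0 h0T)
  have hcont : ContinuousOn (fun t => ∫ τ in (0 : ℝ)..t, k τ) (Icc 0 T) := by
    have := intervalIntegral.continuousOn_primitive_interval' (hki 0 h0T T ⟨hT.le, le_rfl⟩)
      (a := 0) (by simp)
    rwa [uIcc_of_le hT.le] at this
  have huc := isCompact_Icc.uniformContinuousOn_of_continuous hcont
  rw [Metric.uniformContinuousOn_iff] at huc
  obtain ⟨δ, hδ, hδ'⟩ := huc (1 / 2) (by norm_num)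
  have step : ∀ a b : ℝ, a ∈ Icc 0 T → b ∈ Icc 0 T → a ≤ b → b - a < δ →
      (∀ t ∈ Icc 0 a, φ t = 0) → ∀ t ∈ Icc 0 b, φ t = 0 := by
    intro a b ha hb hab hd hz
    have hK : ∫ τ in a..b, k τ ≤ 1 / 2 := by
      have := hδ' b hb a ha (by rwa [Real.dist_eq, abs_of_nonneg (by linarith)])
      rw [Real.dist_eq, intervalIntegral.integral_interval_sub_left (hki 0 h0T b hb)
        (hki 0 h0T a ha)] at this
      exact (le_abs_self _).trans this.le
    have hm : ∀ m : ℕ, ∀ t ∈ Icc a b, φ t ≤ M * (1 / 2) ^ m := by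
      intro m
      induction m with
      | zero => exact fun t ht => by simpa using hφM t ⟨ha.1.trans ht.1, ht.2.trans hb.2⟩
      | succ m ih =>
        intro t ht
        have htT : t ∈ Icc 0 T := ⟨ha.1.trans ht.1, ht.2.trans hb.2⟩
        have h1 : ∫ τ in (0 : ℝ)..a, k τ * φ τ = 0 := by
          refine (intervalIntegral.integral_congr (g := fun _ => (0 : ℝ)) fun x hx => ?_).trans
            intervalIntegral.integral_zero
          rw [uIcc_of_le ha.1] at hx
          simp [hz x hx]
        calc φ t ≤ ∫ τ in (0 : ℝ)..t, k τ * φ τ := h t htT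
          _ = ∫ τ in a..t, k τ * φ τ := by
            rw [← intervalIntegral.integral_add_adjacent_intervals (hkφi 0 h0T a ha)
              (hkφi a ha t htT), h1, zero_add]
          _ ≤ ∫ τ in a..t, k τ * (M * (1 / 2) ^ m) := by
            refine intervalIntegral.integral_mono_on ht.1 (hkφi a ha t htT)
              ((hki a ha t htT).mul_const _) fun x hx => ?_
            exact mul_le_mul_of_nonneg_left (ih x ⟨hx.1, hx.2.trans ht.2⟩) (hk0 x)
          _ = (∫ τ in a..t, k τ) * (M * (1 / 2) ^ m) := intervalIntegral.integral_mul_const _ _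
          _ ≤ (∫ τ in a..b, k τ) * (M * (1 / 2) ^ m) := by
            refine mul_le_mul_of_nonneg_right ?_ (by positivity)
            exact intervalIntegral.integral_mono_interval le_rfl ht.1 ht.2
              (ae_of_all _ fun x => hk0 x) (hki a ha b hb)
          _ ≤ (1 / 2) * (M * (1 / 2) ^ m) := by gcongr
          _ = _ := by ring
    intro t ht
    rcases le_total t a with hta | hta
    · exact hz t ⟨ht.1, hta⟩
    · refine le_antisymm ?_ (hφ0 t ⟨ht.1, ht.2.trans hb.2⟩)
      have hlim : Tendsto (fun m : ℕ => M * (1 / 2 : ℝ) ^ m) atTop (𝓝 (M * 0)) :=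
        (tendsto_pow_atTop_nhds_zero_of_lt_one (by norm_num) (by norm_num)).const_mul M
      rw [mul_zero] at hlim
      exact ge_of_tendsto' hlim fun m => hm m t ⟨hta, ht.2⟩
  obtain ⟨N, hN⟩ := exists_nat_gt (T / δ)
  have hN0 : (0 : ℝ) < N := (div_pos hT hδ).trans hN
  have hind : ∀ i : ℕ, i ≤ N → ∀ t ∈ Icc 0 (i * (T / N)), φ t = 0 := by
    intro i
    induction i with
    | zero =>
      intro _ t ht
      have : t = 0 := by
        rw [Nat.cast_zero, zero_mul, Icc_self] at ht
        exact ht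
      subst this
      refine le_antisymm ?_ (hφ0 0 h0T)
      simpa using h 0 h0T
    | succ i ih =>
      intro hi
      have hmem : ∀ j : ℕ, j ≤ N → (j : ℝ) * (T / N) ∈ Icc 0 T := by
        intro j hj
        refine ⟨by positivity, ?_⟩
        have hj' : (j : ℝ) ≤ N := by exact_mod_cast hj
        calc (j : ℝ) * (T / N) ≤ N * (T / N) := by gcongr
          _ = T := by field_simp
      refine step (i * (T / N)) _ (hmem i (by omega)) (hmem (i + 1) hi) ?_ ?_ (ih (by omega))
      · push_cast
        gcongr
        linarith
      · push_cast
        rw [div_lt_iff₀ hδ] at hN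
        have : T / N < δ := by
          rw [div_lt_iff₀ hN0]
          linarith
        linarith
  intro t ht
  refine hind N le_rfl t ⟨ht.1, ht.2.trans (le_of_eq ?_)⟩
  field_simp

/-! ### Sobolev norms of coefficient families -/

/-- The square of the `H^s` norm as a real number. -/
def sobSq (s : ℝ) (c : Coeffs n) : ℝ := (sobolevNormSq s c).toReal

theorem sobSq_nonneg (s : ℝ) (c : Coeffs n) : 0 ≤ sobSq s c := ENNReal.toReal_nonneg

theorem sobolevTerm_eq (s : ℝ) (c : Coeffs n) (ξ : Fin n → ℤ) :
    ENNReal.ofReal (rho ξ ^ (2 * s)) * ∑ k, ‖c ξ k‖ₑ ^ 2 =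
      ENNReal.ofReal (rho ξ ^ (2 * s) * ∑ k, ‖c ξ k‖ ^ 2) := by
  rw [ENNReal.ofReal_mul (Real.rpow_nonneg (rho_pos ξ).le _),
    ENNReal.ofReal_sum_of_nonneg fun _ _ => sq_nonneg _]
  congr 1
  refine Finset.sum_congr rfl fun k _ => ?_
  rw [ENNReal.ofReal_pow (norm_nonneg _), ofReal_norm]

theorem sobolevTerm_nonneg (s : ℝ) (c : Coeffs n) (ξ : Fin n → ℤ) :
    0 ≤ rho ξ ^ (2 * s) * ∑ k, ‖c ξ k‖ ^ 2 :=
  mul_nonneg (Real.rpow_nonneg (rho_pos ξ).le _) (Finset.sum_nonneg fun _ _ => sq_nonneg _)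

theorem hasSum_sobSq {s : ℝ} {c : Coeffs n} (h : sobolevNormSq s c < ⊤) :
    HasSum (fun ξ => rho ξ ^ (2 * s) * ∑ k, ‖c ξ k‖ ^ 2) (sobSq s c) := by
  have := ENNReal.hasSum_toReal h.ne
  rw [← ENNReal.tsum_toReal_eq (ENNReal.ne_top_of_tsum_ne_top h.ne)] at this
  simp only [sobolevTerm_eq, ENNReal.toReal_ofReal (sobolevTerm_nonneg s c _)] at this
  simpa only [sobSq, sobolevNormSq, sobolevTerm_eq] using this

theorem sobolevNormSq_lt_top_of_summable {s : ℝ} {c : Coeffs n}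
    (h : Summable fun ξ => rho ξ ^ (2 * s) * ∑ k, ‖c ξ k‖ ^ 2) : sobolevNormSq s c < ⊤ := by
  rw [sobolevNormSq]
  simp only [sobolevTerm_eq]
  rw [← ENNReal.ofReal_tsum_of_nonneg (sobolevTerm_nonneg s c) h]
  exact ENNReal.ofReal_lt_top

theorem hasSum_sobSq_zero {c : Coeffs n} (h : sobolevNormSq 0 c < ⊤) :
    HasSum (fun ξ => ∑ k, ‖c ξ k‖ ^ 2) (sobSq 0 c) := by
  simpa using hasSum_sobSq h

theorem hasSum_sobSq_one {c : Coeffs n} (h : sobolevNormSq 1 c < ⊤) :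
    HasSum (fun ξ => rho ξ ^ 2 * ∑ k, ‖c ξ k‖ ^ 2) (sobSq 1 c) := by
  have := hasSum_sobSq h
  simpa only [mul_one, Real.rpow_two] using this

theorem sobolevNormSq_mono {s : ℝ} {c d : Coeffs n} (h : ∀ ξ k, ‖c ξ k‖ ≤ ‖d ξ k‖) :
    sobolevNormSq s c ≤ sobolevNormSq s d := by
  refine ENNReal.tsum_le_tsum fun ξ => ?_
  gcongr with k
  exact enorm_le_iff_norm_le.2 (h ξ k)

theorem sobolevNormSq_mono_exponent {s s' : ℝ} (hs : s ≤ s') (c : Coeffs n) :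
    sobolevNormSq s c ≤ sobolevNormSq s' c := by
  refine ENNReal.tsum_le_tsum fun ξ => ?_
  gcongr
  exact one_le_rho ξ

theorem sobolevNormSq_sub_le (s : ℝ) (c d : Coeffs n) :
    sobolevNormSq s (c - d) ≤ 2 * sobolevNormSq s c + 2 * sobolevNormSq s d := by
  rw [sobolevNormSq, sobolevNormSq, sobolevNormSq, ← ENNReal.tsum_mul_left,
    ← ENNReal.tsum_mul_left, ← ENNReal.tsum_add]
  refine ENNReal.tsum_le_tsum fun ξ => ?_
  rw [sobolevTerm_eq, sobolevTerm_eq, sobolevTerm_eq, ← ENNReal.ofReal_ofNat 2,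
    ← ENNReal.ofReal_mul (by norm_num), ← ENNReal.ofReal_mul (by norm_num),
    ← ENNReal.ofReal_add (mul_nonneg (by norm_num) (sobolevTerm_nonneg s c ξ))
      (mul_nonneg (by norm_num) (sobolevTerm_nonneg s d ξ))]
  refine ENNReal.ofReal_le_ofReal ?_
  have h : ∑ k, ‖(c - d) ξ k‖ ^ 2 ≤ 2 * ∑ k, ‖c ξ k‖ ^ 2 + 2 * ∑ k, ‖d ξ k‖ ^ 2 := by
    rw [Finset.mul_sum, Finset.mul_sum, ← Finset.sum_add_distrib]
    refine Finset.sum_le_sum fun k _ => ?_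
    have h1 : ‖(c - d) ξ k‖ ≤ ‖c ξ k‖ + ‖d ξ k‖ := norm_sub_le _ _
    have h2 := norm_nonneg ((c - d) ξ k)
    nlinarith [sq_nonneg (‖c ξ k‖ - ‖d ξ k‖)]
  have h3 := mul_le_mul_of_nonneg_left h (Real.rpow_nonneg (rho_pos ξ).le (2 * s))
  linarith

theorem sobolevNormSq_sub_lt_top {s : ℝ} {c d : Coeffs n} (hc : sobolevNormSq s c < ⊤)
    (hd : sobolevNormSq s d < ⊤) : sobolevNormSq s (c - d) < ⊤ :=
  (sobolevNormSq_sub_le s c d).trans_lt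
    (ENNReal.add_lt_top.2 ⟨ENNReal.mul_lt_top (by simp) hc, ENNReal.mul_lt_top (by simp) hd⟩)

/-! ### Truncation to finitely many frequencies -/

/-- Restriction of a family of coefficients to the cube `|ξ_i| ≤ N`. -/
def trunc (N : ℕ) (c : Coeffs n) : Coeffs n := fun ξ k => if ξ ∈ cube n N then c ξ k else 0

theorem norm_trunc_le (N : ℕ) (c : Coeffs n) (ξ : Fin n → ℤ) (k : Fin n) :
    ‖trunc N c ξ k‖ ≤ ‖c ξ k‖ := by
  rw [trunc]
  split_ifs <;> simp

theorem sobolevNormSq_trunc_le (N : ℕ) (s : ℝ) (c : Coeffs n) :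
    sobolevNormSq s (trunc N c) ≤ sobolevNormSq s c := sobolevNormSq_mono (norm_trunc_le N c)

theorem sobolevNormSq_trunc_lt_top (N : ℕ) (s : ℝ) (c : Coeffs n) :
    sobolevNormSq s (trunc N c) < ⊤ := by
  refine sobolevNormSq_lt_top_of_summable (summable_of_ne_finset_zero (s := cube n N) ?_)
  intro ξ hξ
  simp [trunc, hξ]

theorem sobSq_trunc_le (N : ℕ) {s : ℝ} {c : Coeffs n} (h : sobolevNormSq s c < ⊤) :
    sobSq s (trunc N c) ≤ sobSq s c :=
  ENNReal.toReal_mono h.ne (sobolevNormSq_trunc_le N s c)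

theorem tendsto_sobSq_sub_trunc {s : ℝ} {c : Coeffs n} (h : sobolevNormSq s c < ⊤) :
    Tendsto (fun N => sobSq s (c - trunc N c)) atTop (𝓝 0) := by
  have h1 := (tendsto_tsum_compl_atTop_zero
    fun ξ => rho ξ ^ (2 * s) * ∑ k, ‖c ξ k‖ ^ 2).comp (tendsto_cube_atTop (n := n))
  refine h1.congr fun N => ?_
  have hlt : sobolevNormSq s (c - trunc N c) < ⊤ :=
    sobolevNormSq_sub_lt_top h (sobolevNormSq_trunc_lt_top N s c)
  rw [← (hasSum_sobSq hlt).tsum_eq]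
  simp only [Function.comp_apply]
  refine (tsum_subtype {ξ | ξ ∉ cube n N} fun ξ => rho ξ ^ (2 * s) * ∑ k, ‖c ξ k‖ ^ 2).trans ?_
  refine tsum_congr fun ξ => ?_
  by_cases hξ : ξ ∈ cube n N
  · simp [hξ, trunc]
  · simp [hξ, trunc]

/-! ### Coefficients of vector fields -/

theorem fieldCoeffs_neg_apply (w : VelocityField n) (ξ : Fin n → ℤ) (k : Fin n) :
    fieldCoeffs w (-ξ) k = conj (fieldCoeffs w ξ k) := mFourierCoeff_ofReal_neg _ ξ

theorem fieldCoeffs_congr_ae {w w' : VelocityField n} (h : w =ᵐ[torusMeasure n] w') :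
    fieldCoeffs w = fieldCoeffs w' := by
  funext ξ k
  refine congrFun (mFourierCoeff_congr_ae ?_) ξ
  filter_upwards [h] with x hx
  rw [hx]

theorem ae_eq_of_fieldCoeffs_eq {w w' : VelocityField n} (hw : IsL2 w) (hw' : IsL2 w')
    (h : fieldCoeffs w = fieldCoeffs w') : w =ᵐ[torusMeasure n] w' := by
  have : ∀ k, ∀ᵐ x ∂torusMeasure n, w x k = w' x k := fun k =>
    ae_eq_of_mFourierCoeff_ofReal_eq (hw k) (hw' k) (funext fun ξ => congrFun (congrFun h ξ) k)
  filter_upwards [ae_all_iff.2 this] with x hx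
  exact funext hx

theorem fieldCoeffs_sub {w w' : VelocityField n} (hw : IsL2 w) (hw' : IsL2 w') :
    fieldCoeffs (fun x k => w x k - w' x k) = fieldCoeffs w - fieldCoeffs w' := by
  have hi : ∀ {g : Torus n → ℝ} (ξ : Fin n → ℤ), MemLp g 2 (torusMeasure n) →
      Integrable (fun x => mFourier ξ x * (g x : ℂ)) (torusMeasure n) := fun ξ hg =>
    (memLp_mFourier_mul (memLp_ofReal hg) ξ).integrable (by norm_num)
  funext ξ k
  simp only [fieldCoeffs, Pi.sub_apply, mFourierCoeff_def]
  rw [← integral_sub (hi _ (hw k)) (hi _ (hw' k))]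
  congr 1
  funext x
  push_cast
  ring

theorem IsL2.sub {w w' : VelocityField n} (hw : IsL2 w) (hw' : IsL2 w') :
    IsL2 fun x k => w x k - w' x k := fun k => (hw k).sub (hw' k)

theorem MemHsigma.sub {s : ℝ} {w w' : VelocityField n} (hw : MemHsigma s w)
    (hw' : MemHsigma s w') : MemHsigma s fun x k => w x k - w' x k where
  isL2 := hw.isL2.sub hw'.isL2
  finite_norm := by
    rw [fieldCoeffs_sub hw.isL2 hw'.isL2]
    exact sobolevNormSq_sub_lt_top hw.finite_norm hw'.finite_norm
  mean_zero := by
    rw [fieldCoeffs_sub hw.isL2 hw'.isL2, Pi.sub_apply, hw.mean_zero, hw'.mean_zero, sub_zero]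
  div_zero ξ := by
    rw [fieldCoeffs_sub hw.isL2 hw'.isL2]
    simp only [Pi.sub_apply, mul_sub, Finset.sum_sub_distrib]
    rw [hw.div_zero, hw'.div_zero, sub_zero]

theorem MemHsigma.sum_mul_eq_zero {s : ℝ} {w : VelocityField n} (hw : MemHsigma s w)
    (ξ : Fin n → ℤ) : ∑ j, (ξ j : ℂ) * fieldCoeffs w ξ j = 0 := by
  have h := hw.div_zero ξ
  simp only [mul_assoc] at h
  rw [← Finset.mul_sum, ← Finset.mul_sum, ← Finset.mul_sum] at h
  simpa [Real.pi_ne_zero] using h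

theorem hasSum_innerL2 {v w : VelocityField n} (hv : IsL2 v) (hw : IsL2 w) :
    HasSum (fun ξ => ∑ k, fieldCoeffs v (-ξ) k * fieldCoeffs w ξ k) (innerL2 v w : ℂ) := by
  have h : HasSum (fun ξ => ∑ k, fieldCoeffs v (-ξ) k * fieldCoeffs w ξ k)
      (∑ k, ∫ x, (v x k : ℂ) * (w x k : ℂ) ∂torusMeasure n) :=
    hasSum_sum fun k _ => hasSum_mFourierCoeff_mul (memLp_ofReal (hv k)) (memLp_ofReal (hw k))
  convert h using 1
  have hi : ∀ k, Integrable (fun x => v x k * w x k) (torusMeasure n) := fun k =>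
    (hv k).integrable_mul (hw k)
  rw [innerL2, integral_finsetSum _ fun k _ => hi k]
  push_cast
  refine Finset.sum_congr rfl fun k _ => ?_
  rw [← integral_complex_ofReal]
  simp

theorem innerL2_self_eq {w : VelocityField n} (hw : IsL2 w)
    (hf : sobolevNormSq 0 (fieldCoeffs w) < ⊤) : innerL2 w w = sobSq 0 (fieldCoeffs w) := by
  have h1 := hasSum_innerL2 hw hw
  have h2 : HasSum (fun ξ => ((∑ k, ‖fieldCoeffs w ξ k‖ ^ 2 : ℝ) : ℂ))
      (sobSq 0 (fieldCoeffs w) : ℂ) := Complex.hasSum_ofReal.2 (hasSum_sobSq_zero hf)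
  have h3 : (fun ξ => ∑ k, fieldCoeffs w (-ξ) k * fieldCoeffs w ξ k) =
      fun ξ => ((∑ k, ‖fieldCoeffs w ξ k‖ ^ 2 : ℝ) : ℂ) := by
    funext ξ
    push_cast
    refine Finset.sum_congr rfl fun k _ => ?_
    rw [fieldCoeffs_neg_apply, ← Complex.conj_mul']
  rw [h3] at h1
  exact_mod_cast h1.unique h2

/-- The truncated Fourier series of a real field, a real trigonometric polynomial. -/
def truncField (N : ℕ) (w : VelocityField n) : VelocityField n := fun x k =>
  (∑ ξ ∈ cube n N, fieldCoeffs w ξ k * mFourier ξ x).re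

theorem ofReal_truncField (N : ℕ) (w : VelocityField n) (x : Torus n) (k : Fin n) :
    (truncField N w x k : ℂ) = ∑ ξ ∈ cube n N, fieldCoeffs w ξ k * mFourier ξ x := by
  rw [truncField]
  refine Complex.conj_eq_iff_re.1 ?_
  rw [map_sum]
  refine Finset.sum_nbij' (fun ξ => -ξ) (fun ξ => -ξ) (fun ξ h => neg_mem_cube.2 h)
    (fun ξ h => neg_mem_cube.2 h) (fun ξ _ => neg_neg ξ) (fun ξ _ => neg_neg ξ) fun ξ _ => ?_
  rw [map_mul, ← fieldCoeffs_neg_apply, mFourier_neg]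

theorem isL2_truncField (N : ℕ) (w : VelocityField n) : IsL2 (truncField N w) := by
  intro k
  have hc : Continuous fun x => ∑ ξ ∈ cube n N, fieldCoeffs w ξ k * mFourier ξ x :=
    continuous_finsetSum _ fun ξ _ => continuous_const.mul (mFourier ξ).continuous
  exact (Complex.continuous_re.comp hc).memLp_of_hasCompactSupport
    (HasCompactSupport.of_compactSpace _)

theorem fieldCoeffs_truncField (N : ℕ) (w : VelocityField n) :
    fieldCoeffs (truncField N w) = trunc N (fieldCoeffs w) := by
  funext ξ k
  rw [fieldCoeffs]
  simp only [ofReal_truncField]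
  rw [mFourierCoeff_def]
  simp only [Finset.mul_sum]
  have hcont : ∀ ζ : Fin n → ℤ,
      Continuous fun x => mFourier (-ξ) x * (fieldCoeffs w ζ k * mFourier ζ x) := fun ζ =>
    (mFourier (-ξ)).continuous.mul (continuous_const.mul (mFourier ζ).continuous)
  rw [integral_finsetSum _ fun ζ _ => (hcont ζ).integrable_of_hasCompactSupport
    (HasCompactSupport.of_compactSpace _)]
  have : ∀ ζ, ∫ x, mFourier (-ξ) x * (fieldCoeffs w ζ k * mFourier ζ x) ∂torusMeasure n =
      if ξ = ζ then fieldCoeffs w ζ k else 0 := by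
    intro ζ
    have h := mFourierCoeff_mFourier ζ ξ
    rw [mFourierCoeff_def] at h
    simp only [mul_left_comm _ (fieldCoeffs w ζ k)]
    rw [integral_const_mul, h]
    simp
  simp only [this, Finset.sum_ite_eq, trunc]

theorem MemHsigma.truncField {s : ℝ} {w : VelocityField n} (hw : MemHsigma s w) (N : ℕ) (s' : ℝ) :
    MemHsigma s' (truncField N w) where
  isL2 := isL2_truncField N w
  finite_norm := by
    rw [fieldCoeffs_truncField]
    exact sobolevNormSq_trunc_lt_top N s' _
  mean_zero := by
    funext k
    rw [fieldCoeffs_truncField, trunc, hw.mean_zero]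
    simp
  div_zero ξ := by
    rw [fieldCoeffs_truncField]
    by_cases h : ξ ∈ cube n N
    · simp only [trunc, if_pos h]
      exact hw.div_zero ξ
    · simp [trunc, h]

/-! ### Weak derivatives and strain -/

theorem pderiv_congr {j : Fin n} {g g' : Torus n → ℝ}
    (h : mFourierCoeff (fun x => (g x : ℂ)) = mFourierCoeff (fun x => (g' x : ℂ))) :
    pderiv j g = pderiv j g' := by
  have : IsWeakPartial j g = IsWeakPartial j g' := by
    funext p
    rw [IsWeakPartial, IsWeakPartial, h]
  unfold pderiv
  rw [this]

theorem norm_two_pi_I_mul (ξ : Fin n → ℤ) (j : Fin n) :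
    ‖2 * Real.pi * Complex.I * (ξ j : ℂ)‖ = 2 * Real.pi * |(ξ j : ℝ)| := by
  rw [norm_mul, norm_mul, norm_mul, Complex.norm_I, Complex.norm_real, Complex.norm_intCast]
  simp [abs_of_pos Real.pi_pos]

theorem isWeakPartial_pderiv {w : VelocityField n}
    (hw : sobolevNormSq 1 (fieldCoeffs w) < ⊤) (j k : Fin n) :
    IsWeakPartial j (fun y => w y k) (pderiv j fun y => w y k) := by
  have hex : ∃ h, IsWeakPartial j (fun y => w y k) h := by
    have hs : Summable fun ξ =>
        ‖2 * Real.pi * Complex.I * (ξ j : ℂ) * fieldCoeffs w ξ k‖ ^ 2 := by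
      refine (hasSum_sobSq_one hw).summable.of_nonneg_of_le (fun ξ => sq_nonneg _) fun ξ => ?_
      rw [norm_mul, mul_pow, norm_two_pi_I_mul]
      have := two_pi_abs_le_rho ξ j
      have hpi := Real.pi_pos
      gcongr
      exact Finset.single_le_sum (f := fun k => ‖fieldCoeffs w ξ k‖ ^ 2)
        (fun _ _ => sq_nonneg _) (Finset.mem_univ k)
    obtain ⟨g, hg, hgc⟩ := exists_real_mFourierCoeff_eq hs (by
      intro ξ
      rw [fieldCoeffs_neg_apply, map_mul, map_mul, map_mul, map_mul, Complex.conj_I,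
        Complex.conj_ofReal, Complex.conj_ofNat]
      simp)
    exact ⟨g, hg, fun ξ => congrFun hgc ξ⟩
  unfold pderiv
  rw [dif_pos hex]
  exact hex.choose_spec

/-- Fourier coefficients of the strain. -/
def strainCoeff (c : Coeffs n) (j b : Fin n) (ξ : Fin n → ℤ) : ℂ :=
  Real.pi * Complex.I * ((ξ j : ℂ) * c ξ b + (ξ b : ℂ) * c ξ j)

theorem memLp_strain {w : VelocityField n} (hw : sobolevNormSq 1 (fieldCoeffs w) < ⊤)
    (j b : Fin n) : MemLp (strain w j b) 2 (torusMeasure n) := by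
  have h1 := (isWeakPartial_pderiv hw j b).1
  have h2 := (isWeakPartial_pderiv hw b j).1
  have := (h1.add h2).const_mul (1 / 2)
  refine this.congr_norm ?_ (ae_of_all _ fun x => ?_) |>.mono_exponent le_rfl
  · have h3 := this.1
    refine h3.congr (ae_of_all _ fun x => ?_)
    simp only [strain, Pi.add_apply]
    ring
  · simp only [strain, Pi.add_apply]
    congr 1
    ring

theorem mFourierCoeff_strain {w : VelocityField n} (hw : sobolevNormSq 1 (fieldCoeffs w) < ⊤)
    (j b : Fin n) : mFourierCoeff (fun x => (strain w j b x : ℂ)) =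
      strainCoeff (fieldCoeffs w) j b := by
  obtain ⟨m1, h1⟩ := isWeakPartial_pderiv hw j b
  obtain ⟨m2, h2⟩ := isWeakPartial_pderiv hw b j
  have hi : ∀ {g : Torus n → ℝ} (ξ : Fin n → ℤ), MemLp g 2 (torusMeasure n) →
      Integrable (fun x => mFourier ξ x * (g x : ℂ)) (torusMeasure n) := fun ξ hg =>
    (memLp_mFourier_mul (memLp_ofReal hg) ξ).integrable (by norm_num)
  funext ξ
  have e : mFourierCoeff (fun x => (strain w j b x : ℂ)) ξ =
      (1 / 2) * (mFourierCoeff (fun x => ((pderiv j fun y => w y b) x : ℂ)) ξ +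
        mFourierCoeff (fun x => ((pderiv b fun y => w y j) x : ℂ)) ξ) := by
    rw [mFourierCoeff_def, mFourierCoeff_def, mFourierCoeff_def, ← integral_add (hi _ m1) (hi _ m2),
      ← integral_const_mul]
    congr 1
    funext x
    simp only [strain]
    push_cast
    ring
  rw [e, h1, h2]
  simp only [strainCoeff, fieldCoeffs]
  ring

theorem strain_sub_ae {v w : VelocityField n} (hv : MemHsigma 1 v) (hw : MemHsigma 1 w)
    (j b : Fin n) : strain (fun x k => v x k - w x k) j b =ᵐ[torusMeasure n]
      fun x => strain v j b x - strain w j b x := by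
  have mv := memLp_strain hv.finite_norm j b
  have mw := memLp_strain hw.finite_norm j b
  have hz := (hv.sub hw).finite_norm
  refine ae_eq_of_mFourierCoeff_ofReal_eq (memLp_strain hz j b) (mv.sub mw) ?_
  have hi : ∀ {g : Torus n → ℝ} (ξ : Fin n → ℤ), MemLp g 2 (torusMeasure n) →
      Integrable (fun x => mFourier ξ x * (g x : ℂ)) (torusMeasure n) := fun ξ hg =>
    (memLp_mFourier_mul (memLp_ofReal hg) ξ).integrable (by norm_num)
  funext ξ
  have e : mFourierCoeff (fun x => ((strain v j b x - strain w j b x : ℝ) : ℂ)) ξ =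
      mFourierCoeff (fun x => (strain v j b x : ℂ)) ξ -
        mFourierCoeff (fun x => (strain w j b x : ℂ)) ξ := by
    rw [mFourierCoeff_def, mFourierCoeff_def, mFourierCoeff_def, ← integral_sub (hi _ mv) (hi _ mw)]
    congr 1
    funext x
    push_cast
    ring
  refine Eq.trans ?_ e.symm
  rw [mFourierCoeff_strain hz, mFourierCoeff_strain hv.finite_norm,
    mFourierCoeff_strain hw.finite_norm, fieldCoeffs_sub hv.isL2 hw.isL2]
  simp only [strainCoeff, Pi.sub_apply]
  ring

theorem hasSum_integral_strain_sq {w : VelocityField n}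
    (hw : sobolevNormSq 1 (fieldCoeffs w) < ⊤) (j b : Fin n) :
    HasSum (fun ξ => ‖strainCoeff (fieldCoeffs w) j b ξ‖ ^ 2)
      (∫ x, strain w j b x ^ 2 ∂torusMeasure n) := by
  have h := hasSum_norm_sq_mFourierCoeff (memLp_ofReal (memLp_strain hw j b))
  rw [mFourierCoeff_strain hw] at h
  simpa using h

theorem norm_strainCoeff_sq_le (c : Coeffs n) (j b : Fin n) (ξ : Fin n → ℤ) :
    ‖strainCoeff c j b ξ‖ ^ 2 ≤ rho ξ ^ 2 * ∑ k, ‖c ξ k‖ ^ 2 := by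
  have hj := two_pi_abs_le_rho ξ j
  have hb := two_pi_abs_le_rho ξ b
  have hcj : ‖c ξ j‖ ^ 2 ≤ ∑ k, ‖c ξ k‖ ^ 2 :=
    Finset.single_le_sum (f := fun k => ‖c ξ k‖ ^ 2) (fun _ _ => sq_nonneg _) (Finset.mem_univ j)
  have hcb : ‖c ξ b‖ ^ 2 ≤ ∑ k, ‖c ξ k‖ ^ 2 :=
    Finset.single_le_sum (f := fun k => ‖c ξ k‖ ^ 2) (fun _ _ => sq_nonneg _) (Finset.mem_univ b)
  have hpi := Real.pi_pos
  have hρ := rho_pos ξ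
  have h1 : ‖strainCoeff c j b ξ‖ ≤ rho ξ * ((‖c ξ b‖ + ‖c ξ j‖) / 2) := by
    rw [strainCoeff, norm_mul, norm_mul, Complex.norm_I, Complex.norm_real, mul_one,
      Real.norm_of_nonneg hpi.le]
    calc Real.pi * ‖(ξ j : ℂ) * c ξ b + (ξ b : ℂ) * c ξ j‖
        ≤ Real.pi * (|(ξ j : ℝ)| * ‖c ξ b‖ + |(ξ b : ℝ)| * ‖c ξ j‖) := by
          gcongr
          refine (norm_add_le _ _).trans (le_of_eq ?_)
          rw [norm_mul, norm_mul, Complex.norm_intCast, Complex.norm_intCast]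
      _ = ((2 * Real.pi * |(ξ j : ℝ)|) * ‖c ξ b‖ + (2 * Real.pi * |(ξ b : ℝ)|) * ‖c ξ j‖) / 2 := by
          ring
      _ ≤ (rho ξ * ‖c ξ b‖ + rho ξ * ‖c ξ j‖) / 2 := by gcongr
      _ = _ := by ring
  calc ‖strainCoeff c j b ξ‖ ^ 2 ≤ (rho ξ * ((‖c ξ b‖ + ‖c ξ j‖) / 2)) ^ 2 := by gcongr
    _ = rho ξ ^ 2 * ((‖c ξ b‖ + ‖c ξ j‖) / 2) ^ 2 := by ring
    _ ≤ _ := by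
      gcongr
      nlinarith [sq_nonneg (‖c ξ b‖ - ‖c ξ j‖)]

theorem integral_strain_sq_le {w : VelocityField n}
    (hw : sobolevNormSq 1 (fieldCoeffs w) < ⊤) (j b : Fin n) :
    ∫ x, strain w j b x ^ 2 ∂torusMeasure n ≤ sobSq 1 (fieldCoeffs w) :=
  hasSum_le (fun ξ => norm_strainCoeff_sq_le _ j b ξ) (hasSum_integral_strain_sq hw j b)
    (hasSum_sobSq_one hw)

theorem sum_norm_strainCoeff_sq_ge {c : Coeffs n} (h0 : c 0 = 0) (ξ : Fin n → ℤ)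
    (hdiv : ∑ j, (ξ j : ℂ) * c ξ j = 0) :
    1 / 4 * (rho ξ ^ 2 * ∑ k, ‖c ξ k‖ ^ 2) ≤ ∑ j, ∑ b, ‖strainCoeff c j b ξ‖ ^ 2 := by
  have key : ((∑ j, ∑ b, ‖strainCoeff c j b ξ‖ ^ 2 : ℝ) : ℂ) =
      ((2 * Real.pi ^ 2 * ((∑ j, (ξ j : ℝ) ^ 2) * ∑ k, ‖c ξ k‖ ^ 2) : ℝ) : ℂ) := by
    have hdiv' : ∑ j, (ξ j : ℂ) * conj (c ξ j) = 0 := by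
      have := congrArg conj hdiv
      simpa using this
    have e1 : ∀ j b, ((‖strainCoeff c j b ξ‖ ^ 2 : ℝ) : ℂ) = (Real.pi : ℂ) ^ 2 *
        ((ξ j : ℂ) ^ 2 * ((‖c ξ b‖ ^ 2 : ℝ) : ℂ) + (ξ b : ℂ) ^ 2 * ((‖c ξ j‖ ^ 2 : ℝ) : ℂ) +
          ((ξ j : ℂ) * conj (c ξ j)) * ((ξ b : ℂ) * c ξ b) +
          ((ξ j : ℂ) * c ξ j) * ((ξ b : ℂ) * conj (c ξ b))) := by
      intro j b
      push_cast
      rw [← Complex.conj_mul', ← Complex.conj_mul', ← Complex.conj_mul', strainCoeff]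
      simp only [map_mul, map_add, Complex.conj_ofReal, Complex.conj_I, map_intCast]
      linear_combination (-(Real.pi : ℂ) ^ 2 * ((ξ j : ℂ) * conj (c ξ b) +
        (ξ b : ℂ) * conj (c ξ j)) * ((ξ j : ℂ) * c ξ b + (ξ b : ℂ) * c ξ j)) * Complex.I_sq
    simp only [Complex.ofReal_sum, e1]
    simp only [← Finset.mul_sum, Finset.sum_add_distrib, hdiv, hdiv', ← Finset.sum_mul]
    push_cast
    ring
  have key' : ∑ j, ∑ b, ‖strainCoeff c j b ξ‖ ^ 2 =
      2 * Real.pi ^ 2 * ((∑ j, (ξ j : ℝ) ^ 2) * ∑ k, ‖c ξ k‖ ^ 2) := by exact_mod_cast key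
  rw [key', rho_sq]
  by_cases hξ : ξ = 0
  · subst hξ
    simp [h0]
  · have h1 : 1 ≤ ∑ j, (ξ j : ℝ) ^ 2 := by
      obtain ⟨i, hi⟩ := Function.ne_iff.1 hξ
      have h2 : (1 : ℝ) ≤ (ξ i : ℝ) ^ 2 := by
        have : 1 ≤ ξ i ^ 2 := by
          have := sq_pos_of_ne_zero (a := ξ i) hi
          omega
        exact_mod_cast this
      exact h2.trans (Finset.single_le_sum (f := fun j => (ξ j : ℝ) ^ 2)
        (fun _ _ => sq_nonneg _) (Finset.mem_univ i))
    have h3 : 0 ≤ ∑ k, ‖c ξ k‖ ^ 2 := Finset.sum_nonneg fun _ _ => sq_nonneg _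
    have h4 : 0 ≤ Real.pi ^ 2 * (∑ k, ‖c ξ k‖ ^ 2) := by positivity
    nlinarith [mul_le_mul_of_nonneg_right h1 h4]

/-- Korn's inequality for solenoidal fields of zero mean. -/
theorem korn {w : VelocityField n} (hw : MemHsigma 1 w) :
    1 / 4 * sobSq 1 (fieldCoeffs w) ≤ ∑ j, ∑ b, ∫ x, strain w j b x ^ 2 ∂torusMeasure n :=
  hasSum_le (fun ξ => sum_norm_strainCoeff_sq_ge hw.mean_zero ξ (hw.sum_mul_eq_zero ξ))
    ((hasSum_sobSq_one hw.finite_norm).mul_left _)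
    (hasSum_sum fun j _ => hasSum_sum fun b _ => hasSum_integral_strain_sq hw.finite_norm j b)

theorem strain_symm (w : VelocityField n) (j b : Fin n) (x : Torus n) :
    strain w j b x = strain w b j x := by
  rw [strain, strain, add_comm]

theorem trace_strain_ae {w : VelocityField n} (hw : MemHsigma 1 w) :
    ∀ᵐ x ∂torusMeasure n, ∑ j, strain w j j x = 0 := by
  have hm : MemLp (fun x => ∑ j, strain w j j x) 2 (torusMeasure n) :=
    memLp_finsetSum _ fun j _ => memLp_strain hw.finite_norm j j
  refine ae_eq_of_mFourierCoeff_ofReal_eq (h := fun _ => (0 : ℝ)) hm MemLp.zero ?_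
  funext ξ
  have e : mFourierCoeff (fun x => ((∑ j, strain w j j x : ℝ) : ℂ)) ξ =
      ∑ j, mFourierCoeff (fun x => (strain w j j x : ℂ)) ξ := by
    simp only [mFourierCoeff_def]
    rw [← integral_finsetSum _ fun j _ => (memLp_mFourier_mul
      (memLp_ofReal (memLp_strain hw.finite_norm j j)) _).integrable (by norm_num)]
    congr 1
    funext x
    push_cast
    rw [Finset.mul_sum]
  refine e.trans ?_
  simp only [mFourierCoeff_strain hw.finite_norm, strainCoeff]
  rw [← Finset.mul_sum, Finset.sum_add_distrib, hw.sum_mul_eq_zero ξ, mFourierCoeff_def]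
  simp

/-! ### The viscous form at a fixed time -/

/-- At time `t` the viscosity is measurable and bounded by `M`. -/
def Viscosity.BoundedAt (a : Viscosity n) (t M : ℝ) : Prop :=
  ∀ i j α β, AEStronglyMeasurable (a i j α β t) (torusMeasure n) ∧
    ∀ᵐ x ∂torusMeasure n, |a i j α β t x| ≤ M

/-- Relaxed ellipticity with constant `C` at time `t`. -/
def Viscosity.EllipticAt (a : Viscosity n) (t C : ℝ) : Prop :=
  ∀ᵐ x ∂torusMeasure n, ∀ ζ : Matrix (Fin n) (Fin n) ℝ, ζ.transpose = ζ → ζ.trace = 0 →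
    ∑ k, ∑ α, ζ k α ^ 2 ≤ C * ∑ k, ∑ j, ∑ α, ∑ β, a k j α β t x * ζ k α * ζ j β

theorem Viscosity.Bounded.exists_boundedAt {T : ℝ} {a : Viscosity n} (ha : a.Bounded T) :
    ∃ M, 0 ≤ M ∧ ∀ᵐ t ∂timeMeasure T, a.BoundedAt t M := by
  set m : Fin n → Fin n → Fin n → Fin n → ℝ := fun i j α β =>
    (eLpNorm (fun p : ℝ × Torus n => a i j α β p.1 p.2) ⊤
      ((timeMeasure T).prod (torusMeasure n))).toReal with hm
  have hm0 : ∀ i j α β, 0 ≤ m i j α β := fun _ _ _ _ => ENNReal.toReal_nonneg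
  refine ⟨∑ i, ∑ j, ∑ α, ∑ β, m i j α β, Finset.sum_nonneg fun i _ => Finset.sum_nonneg fun j _ =>
    Finset.sum_nonneg fun α _ => Finset.sum_nonneg fun β _ => hm0 i j α β, ?_⟩
  unfold Viscosity.BoundedAt
  simp only [ae_all_iff]
  intro i j α β
  have h1 := (ha i j α β).1.prodMk_left
  have h2 : ∀ᵐ p ∂(timeMeasure T).prod (torusMeasure n), |a i j α β p.1 p.2| ≤ m i j α β := by
    have h3 := ae_le_eLpNormEssSup (f := fun p : ℝ × Torus n => a i j α β p.1 p.2)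
      (μ := (timeMeasure T).prod (torusMeasure n))
    filter_upwards [h3] with p hp
    rw [← Real.norm_eq_abs, hm]
    simp only [eLpNorm_exponent_top]
    rw [← toReal_enorm]
    refine ENNReal.toReal_mono ?_ hp
    have := (ha i j α β).2.ne
    rwa [eLpNorm_exponent_top] at this
  have hle : m i j α β ≤ ∑ i, ∑ j, ∑ α, ∑ β, m i j α β := by
    refine le_trans ?_ (Finset.single_le_sum (f := fun i => ∑ j, ∑ α, ∑ β, m i j α β)
      (fun i _ => Finset.sum_nonneg fun j _ => Finset.sum_nonneg fun α _ =>
        Finset.sum_nonneg fun β _ => hm0 i j α β) (Finset.mem_univ i))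
    refine le_trans ?_ (Finset.single_le_sum (f := fun j => ∑ α, ∑ β, m i j α β)
      (fun j _ => Finset.sum_nonneg fun α _ =>
        Finset.sum_nonneg fun β _ => hm0 i j α β) (Finset.mem_univ j))
    refine le_trans ?_ (Finset.single_le_sum (f := fun α => ∑ β, m i j α β)
      (fun α _ => Finset.sum_nonneg fun β _ => hm0 i j α β) (Finset.mem_univ α))
    exact Finset.single_le_sum (f := fun β => m i j α β)
      (fun β _ => hm0 i j α β) (Finset.mem_univ β)
  filter_upwards [h1, Measure.ae_ae_of_ae_prod h2] with t ht1 ht2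
  refine ⟨ht1, ?_⟩
  filter_upwards [ht2] with x hx
  exact hx.trans hle

theorem Viscosity.RelaxedElliptic.exists_ellipticAt {T : ℝ} {a : Viscosity n}
    (ha : a.RelaxedElliptic T) :
    ∃ C, 0 < C ∧ ∀ᵐ t ∂timeMeasure T, a.EllipticAt t C := by
  obtain ⟨C, hC, h⟩ := ha
  exact ⟨C, hC, Measure.ae_ae_of_ae_prod h⟩

theorem integrable_viscous_term {a : Viscosity n} {t M : ℝ} (ha : a.BoundedAt t M)
    {e e' : Torus n → ℝ} (he : MemLp e 2 (torusMeasure n)) (he' : MemLp e' 2 (torusMeasure n))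
    (i j α β : Fin n) : Integrable (fun x => a i j α β t x * e x * e' x) (torusMeasure n) := by
  have h := (he.integrable_mul he').bdd_mul (ha i j α β).1
    ((ha i j α β).2.mono fun x hx => by rwa [Real.norm_eq_abs])
  refine h.congr (ae_of_all _ fun x => ?_)
  simp only [Pi.mul_apply]
  ring

theorem viscousForm_eq_sum {a : Viscosity n} {t M : ℝ} (ha : a.BoundedAt t M)
    {u w : VelocityField n} (hu : sobolevNormSq 1 (fieldCoeffs u) < ⊤)
    (hw : sobolevNormSq 1 (fieldCoeffs w) < ⊤) :
    viscousForm a t u w = ∑ i, ∑ j, ∑ α, ∑ β,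
      ∫ x, a i j α β t x * strain u j β x * strain w i α x ∂torusMeasure n := by
  have hi := fun i j α β =>
    integrable_viscous_term ha (memLp_strain hu j β) (memLp_strain hw i α) i j α β
  rw [viscousForm, integral_finsetSum _ fun i _ => integrable_finsetSum _ fun j _ =>
    integrable_finsetSum _ fun α _ => integrable_finsetSum _ fun β _ => hi i j α β]
  refine Finset.sum_congr rfl fun i _ => ?_
  rw [integral_finsetSum _ fun j _ =>
    integrable_finsetSum _ fun α _ => integrable_finsetSum _ fun β _ => hi i j α β]
  refine Finset.sum_congr rfl fun j _ => ?_
  rw [integral_finsetSum _ fun α _ => integrable_finsetSum _ fun β _ => hi i j α β]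
  refine Finset.sum_congr rfl fun α _ => ?_
  rw [integral_finsetSum _ fun β _ => hi i j α β]

theorem viscousForm_sub_right {a : Viscosity n} {t M : ℝ} (ha : a.BoundedAt t M)
    {u w w' : VelocityField n} (hu : sobolevNormSq 1 (fieldCoeffs u) < ⊤)
    (hw : MemHsigma 1 w) (hw' : MemHsigma 1 w') :
    viscousForm a t u (fun x k => w x k - w' x k) = viscousForm a t u w - viscousForm a t u w' := by
  rw [viscousForm_eq_sum ha hu (hw.sub hw').finite_norm, viscousForm_eq_sum ha hu hw.finite_norm,
    viscousForm_eq_sum ha hu hw'.finite_norm]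
  simp only [← Finset.sum_sub_distrib]
  refine Finset.sum_congr rfl fun i _ => Finset.sum_congr rfl fun j _ =>
    Finset.sum_congr rfl fun α _ => Finset.sum_congr rfl fun β _ => ?_
  rw [← integral_sub
    (integrable_viscous_term ha (memLp_strain hu j β) (memLp_strain hw.finite_norm i α) i j α β)
    (integrable_viscous_term ha (memLp_strain hu j β) (memLp_strain hw'.finite_norm i α) i j α β)]
  refine integral_congr_ae ?_
  filter_upwards [strain_sub_ae hw hw' i α] with x hx
  rw [hx]
  ring

theorem viscousForm_sub_left {a : Viscosity n} {t M : ℝ} (ha : a.BoundedAt t M)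
    {u w w' : VelocityField n} (hu : sobolevNormSq 1 (fieldCoeffs u) < ⊤)
    (hw : MemHsigma 1 w) (hw' : MemHsigma 1 w') :
    viscousForm a t (fun x k => w x k - w' x k) u = viscousForm a t w u - viscousForm a t w' u := by
  rw [viscousForm_eq_sum ha (hw.sub hw').finite_norm hu, viscousForm_eq_sum ha hw.finite_norm hu,
    viscousForm_eq_sum ha hw'.finite_norm hu]
  simp only [← Finset.sum_sub_distrib]
  refine Finset.sum_congr rfl fun i _ => Finset.sum_congr rfl fun j _ =>
    Finset.sum_congr rfl fun α _ => Finset.sum_congr rfl fun β _ => ?_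
  rw [← integral_sub
    (integrable_viscous_term ha (memLp_strain hw.finite_norm j β) (memLp_strain hu i α) i j α β)
    (integrable_viscous_term ha (memLp_strain hw'.finite_norm j β) (memLp_strain hu i α) i j α β)]
  refine integral_congr_ae ?_
  filter_upwards [strain_sub_ae hw hw' j β] with x hx
  rw [hx]
  ring

theorem integral_norm_mul_le_sqrt {e e' : Torus n → ℝ} (he : MemLp e 2 (torusMeasure n))
    (he' : MemLp e' 2 (torusMeasure n)) : ∫ x, ‖e x‖ * ‖e' x‖ ∂torusMeasure n ≤
      Real.sqrt (∫ x, e x ^ 2 ∂torusMeasure n) * Real.sqrt (∫ x, e' x ^ 2 ∂torusMeasure n) := by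
  have h := integral_mul_norm_le_Lp_mul_Lq (μ := torusMeasure n) (f := e) (g := e')
    Real.HolderConjugate.two_two (by simpa using he) (by simpa using he')
  simpa [Real.sqrt_eq_rpow] using h

theorem abs_viscousForm_le {a : Viscosity n} {t M : ℝ} (hM : 0 ≤ M) (ha : a.BoundedAt t M)
    {u w : VelocityField n} (hu : sobolevNormSq 1 (fieldCoeffs u) < ⊤)
    (hw : sobolevNormSq 1 (fieldCoeffs w) < ⊤) :
    |viscousForm a t u w| ≤ (n : ℝ) ^ 4 * M *
      (Real.sqrt (sobSq 1 (fieldCoeffs u)) * Real.sqrt (sobSq 1 (fieldCoeffs w))) := by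
  set X := Real.sqrt (sobSq 1 (fieldCoeffs u)) * Real.sqrt (sobSq 1 (fieldCoeffs w))
  have hb : ∀ i j α β, |∫ x, a i j α β t x * strain u j β x * strain w i α x ∂torusMeasure n| ≤
      M * X := by
    intro i j α β
    have me := memLp_strain hu j β
    have me' := memLp_strain hw i α
    calc _ ≤ ∫ x, M * (‖strain u j β x‖ * ‖strain w i α x‖) ∂torusMeasure n := by
          rw [← Real.norm_eq_abs]
          refine norm_integral_le_of_norm_le ?_ ?_
          · exact (me.norm.integrable_mul me'.norm).const_mul M
          · filter_upwards [(ha i j α β).2] with x hx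
            rw [norm_mul, norm_mul, Real.norm_eq_abs (a i j α β t x), mul_assoc]
            gcongr
      _ = M * ∫ x, ‖strain u j β x‖ * ‖strain w i α x‖ ∂torusMeasure n := integral_const_mul _ _
      _ ≤ M * X := by
          gcongr
          refine (integral_norm_mul_le_sqrt me me').trans ?_
          exact mul_le_mul (Real.sqrt_le_sqrt (integral_strain_sq_le hu j β))
            (Real.sqrt_le_sqrt (integral_strain_sq_le hw i α)) (Real.sqrt_nonneg _)
            (Real.sqrt_nonneg _)
  rw [viscousForm_eq_sum ha hu hw]
  calc _ ≤ ∑ i : Fin n, ∑ j : Fin n, ∑ α : Fin n, ∑ β : Fin n, M * X := by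
        refine (Finset.abs_sum_le_sum_abs _ _).trans (Finset.sum_le_sum fun i _ => ?_)
        refine (Finset.abs_sum_le_sum_abs _ _).trans (Finset.sum_le_sum fun j _ => ?_)
        refine (Finset.abs_sum_le_sum_abs _ _).trans (Finset.sum_le_sum fun α _ => ?_)
        exact (Finset.abs_sum_le_sum_abs _ _).trans (Finset.sum_le_sum fun β _ => hb i j α β)
    _ = _ := by
        simp only [Finset.sum_const, Finset.card_univ, Fintype.card_fin, nsmul_eq_mul]
        ring

theorem tendsto_viscousForm_truncField {a : Viscosity n} {t M : ℝ} (hM : 0 ≤ M)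
    (ha : a.BoundedAt t M) {u w : VelocityField n} (hu : sobolevNormSq 1 (fieldCoeffs u) < ⊤)
    (hw : MemHsigma 1 w) :
    Tendsto (fun N => viscousForm a t u (truncField N w)) atTop (𝓝 (viscousForm a t u w)) := by
  have hb : ∀ N, ‖viscousForm a t u (truncField N w) - viscousForm a t u w‖ ≤ (n : ℝ) ^ 4 * M *
      (Real.sqrt (sobSq 1 (fieldCoeffs u)) *
        Real.sqrt (sobSq 1 (fieldCoeffs w - trunc N (fieldCoeffs w)))) := by
    intro N
    have hN := hw.truncField N 1
    rw [norm_sub_rev, ← viscousForm_sub_right ha hu hw hN, ← fieldCoeffs_truncField,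
      ← fieldCoeffs_sub hw.isL2 hN.isL2]
    exact abs_viscousForm_le hM ha hu (hw.sub hN).finite_norm
  rw [tendsto_iff_norm_sub_tendsto_zero]
  refine squeeze_zero (fun _ => norm_nonneg _) hb ?_
  have h1 := (tendsto_sobSq_sub_trunc hw.finite_norm).sqrt
  rw [Real.sqrt_zero] at h1
  have := (h1.const_mul (Real.sqrt (sobSq 1 (fieldCoeffs u)))).const_mul ((n : ℝ) ^ 4 * M)
  simpa using this

theorem sobSq_one_le_viscousForm {a : Viscosity n} {t M C : ℝ} (ha : a.BoundedAt t M)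
    (hell : a.EllipticAt t C) {w : VelocityField n} (hw : MemHsigma 1 w) :
    1 / 4 * sobSq 1 (fieldCoeffs w) ≤ C * viscousForm a t w w := by
  refine (korn hw).trans ?_
  have hsq : ∀ j b, Integrable (fun x => strain w j b x ^ 2) (torusMeasure n) := fun j b =>
    (memLp_strain hw.finite_norm j b).integrable_sq
  have e : ∑ j, ∑ b, ∫ x, strain w j b x ^ 2 ∂torusMeasure n =
      ∫ x, ∑ j, ∑ b, strain w j b x ^ 2 ∂torusMeasure n := by
    rw [integral_finsetSum _ fun j _ => integrable_finsetSum _ fun b _ => hsq j b]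
    refine Finset.sum_congr rfl fun j _ => ?_
    rw [integral_finsetSum _ fun b _ => hsq j b]
  rw [e, viscousForm, ← integral_const_mul]
  refine integral_mono_ae (integrable_finsetSum _ fun j _ => integrable_finsetSum _ fun b _ =>
    hsq j b) ((integrable_finsetSum _ fun i _ => integrable_finsetSum _ fun j _ =>
      integrable_finsetSum _ fun α _ => integrable_finsetSum _ fun β _ =>
      integrable_viscous_term ha (memLp_strain hw.finite_norm j β)
        (memLp_strain hw.finite_norm i α) i j α β).const_mul C) ?_
  filter_upwards [hell, trace_strain_ae hw] with x hx htr
  have := hx (Matrix.of fun k α => strain w k α x) (by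
    ext i j
    simp [strain_symm w j i]) (by simpa [Matrix.trace] using htr)
  refine this.trans (le_of_eq ?_)
  congr 1
  refine Finset.sum_congr rfl fun i _ => Finset.sum_congr rfl fun j _ =>
    Finset.sum_congr rfl fun α _ => Finset.sum_congr rfl fun β _ => ?_
  simp only [Matrix.of_apply]
  ring

/-! ### The dual product -/

theorem enorm_sum_mul_sq_le (c d : Fin n → ℂ) :
    (∑ k, ‖c k * d k‖ₑ) ^ 2 ≤ (∑ k, ‖c k‖ₑ ^ 2) * ∑ k, ‖d k‖ₑ ^ 2 := by
  have := tsum_sq_le_of_sq_le_mul (F := fun k => ‖c k * d k‖ₑ) (p := fun k => ‖c k‖ₑ ^ 2)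
    (q := fun k => ‖d k‖ₑ ^ 2) fun k => by rw [enorm_mul, mul_pow]
  simpa only [tsum_fintype] using this

theorem sobolevNormSq_reflect (s : ℝ) (c : Coeffs n) :
    sobolevNormSq s (fun ξ => c (-ξ)) = sobolevNormSq s c := by
  rw [sobolevNormSq, sobolevNormSq, ← (Equiv.neg (Fin n → ℤ)).tsum_eq]
  simp only [Equiv.neg_apply, neg_neg, rho_neg]

theorem tsum_enorm_dualPair_sq_le (s : ℝ) (c d : Coeffs n) :
    (∑' ξ, ‖∑ k, c ξ k * d (-ξ) k‖ₑ) ^ 2 ≤ sobolevNormSq (-s) c * sobolevNormSq s d := by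
  rw [← sobolevNormSq_reflect s d]
  refine tsum_sq_le_of_sq_le_mul fun ξ => ?_
  have e : ENNReal.ofReal (rho ξ ^ (2 * -s)) * ENNReal.ofReal (rho ξ ^ (2 * s)) = 1 := by
    rw [← ENNReal.ofReal_mul (Real.rpow_nonneg (rho_pos ξ).le _), ← Real.rpow_add (rho_pos ξ)]
    simp
  calc ‖∑ k, c ξ k * d (-ξ) k‖ₑ ^ 2 ≤ (∑ k, ‖c ξ k * d (-ξ) k‖ₑ) ^ 2 := by
        gcongr
        exact enorm_sum_le _ _
    _ ≤ 1 * ((∑ k, ‖c ξ k‖ₑ ^ 2) * ∑ k, ‖d (-ξ) k‖ₑ ^ 2) := by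
        rw [one_mul]
        exact enorm_sum_mul_sq_le _ _
    _ = _ := by
        rw [← e]
        ring

theorem summable_of_tsum_enorm_lt_top {ι : Type*} {F : ι → ℂ} (h : ∑' i, ‖F i‖ₑ < ⊤) :
    Summable fun i => ‖F i‖ := by
  have := ENNReal.summable_toReal h.ne
  simpa using this

theorem lt_top_of_sq_le {x y : ENNReal} (h : x ^ 2 ≤ y) (hy : y < ⊤) : x < ⊤ := by
  by_contra hx
  rw [not_lt, top_le_iff] at hx
  rw [hx] at h
  simp at h
  exact hy.ne h

theorem norm_tsum_sq_le {ι : Type*} {F : ι → ℂ} {y : ENNReal} (h : (∑' i, ‖F i‖ₑ) ^ 2 ≤ y)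
    (hy : y < ⊤) : ‖∑' i, F i‖ ^ 2 ≤ y.toReal := by
  have hlt := lt_top_of_sq_le h hy
  have h1 := norm_tsum_le_tsum_norm (summable_of_tsum_enorm_lt_top hlt)
  have h2 : ∑' i, ‖F i‖ = (∑' i, ‖F i‖ₑ).toReal := by
    rw [ENNReal.tsum_toReal_eq (ENNReal.ne_top_of_tsum_ne_top hlt.ne)]
    simp
  calc ‖∑' i, F i‖ ^ 2 ≤ (∑' i, ‖F i‖) ^ 2 := by gcongr
    _ = ((∑' i, ‖F i‖ₑ) ^ 2).toReal := by rw [h2, ENNReal.toReal_pow]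
    _ ≤ _ := ENNReal.toReal_mono hy.ne h

theorem summable_norm_dualPair {s : ℝ} {c d : Coeffs n} (hc : sobolevNormSq (-s) c < ⊤)
    (hd : sobolevNormSq s d < ⊤) : Summable fun ξ => ‖∑ k, c ξ k * d (-ξ) k‖ :=
  summable_of_tsum_enorm_lt_top
    (lt_top_of_sq_le (tsum_enorm_dualPair_sq_le s c d) (ENNReal.mul_lt_top hc hd))

theorem norm_dualPair_sq_le {s : ℝ} {c d : Coeffs n} (hc : sobolevNormSq (-s) c < ⊤)
    (hd : sobolevNormSq s d < ⊤) : ‖dualPair c d‖ ^ 2 ≤ sobSq (-s) c * sobSq s d := by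
  rw [sobSq, sobSq, ← ENNReal.toReal_mul]
  exact norm_tsum_sq_le (tsum_enorm_dualPair_sq_le s c d) (ENNReal.mul_lt_top hc hd)

theorem dualPair_trunc (N : ℕ) (c d : Coeffs n) :
    dualPair c (trunc N d) = ∑ ξ ∈ cube n N, ∑ k, c ξ k * d (-ξ) k := by
  rw [dualPair, tsum_eq_sum (s := cube n N)]
  · refine Finset.sum_congr rfl fun ξ hξ => Finset.sum_congr rfl fun k _ => ?_
    rw [trunc, if_pos (neg_mem_cube.2 hξ)]
  · intro ξ hξ
    refine Finset.sum_eq_zero fun k _ => ?_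
    rw [trunc, if_neg (fun h => hξ (neg_mem_cube.1 h)), mul_zero]

theorem tendsto_dualPair_trunc {s : ℝ} {c d : Coeffs n} (hc : sobolevNormSq (-s) c < ⊤)
    (hd : sobolevNormSq s d < ⊤) :
    Tendsto (fun N => dualPair c (trunc N d)) atTop (𝓝 (dualPair c d)) := by
  simp only [dualPair_trunc]
  exact (summable_norm_dualPair hc hd).of_norm.hasSum.comp tendsto_cube_atTop

/-! ### The trilinear form of the advection term -/

/-- The terms, indexed by `(η, ζ)`, of the Fourier series of `∫ (a · ∇) b · c`. -/
def triTerm (a b c : Coeffs n) (p : (Fin n → ℤ) × (Fin n → ℤ)) : ℂ :=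
  ∑ k, ∑ j, a (-p.2 - p.1) j * (2 * Real.pi * Complex.I * (p.1 j : ℂ) * b p.1 k) * c p.2 k

/-- The trilinear form `∫ (a · ∇) b · c` in terms of Fourier coefficients. -/
def tri (a b c : Coeffs n) : ℂ := ∑' p, triTerm a b c p

theorem enorm_triTerm_le (a b c : Coeffs n) (p : (Fin n → ℤ) × (Fin n → ℤ)) :
    ‖triTerm a b c p‖ₑ ≤ (∑ j, ‖a (-p.2 - p.1) j‖ₑ) * (erho p.1 * ∑ k, ‖b p.1 k‖ₑ) *
      ∑ k, ‖c p.2 k‖ₑ := by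
  have h : ∀ k j, ‖a (-p.2 - p.1) j * (2 * Real.pi * Complex.I * (p.1 j : ℂ) * b p.1 k) *
      c p.2 k‖ₑ ≤ ‖a (-p.2 - p.1) j‖ₑ * (erho p.1 * ‖b p.1 k‖ₑ) * ‖c p.2 k‖ₑ := by
    intro k j
    rw [enorm_mul, enorm_mul, enorm_mul]
    gcongr
    rw [← ofReal_norm, norm_two_pi_I_mul]
    exact ENNReal.ofReal_le_ofReal (two_pi_abs_le_rho _ _)
  calc ‖triTerm a b c p‖ₑ
      ≤ ∑ k, ∑ j, ‖a (-p.2 - p.1) j‖ₑ * (erho p.1 * ‖b p.1 k‖ₑ) * ‖c p.2 k‖ₑ :=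
        (enorm_sum_le _ _).trans (Finset.sum_le_sum fun k _ =>
          (enorm_sum_le _ _).trans (Finset.sum_le_sum fun j _ => h k j))
    _ = ∑ k, (∑ j, ‖a (-p.2 - p.1) j‖ₑ) * (erho p.1 * ‖b p.1 k‖ₑ) * ‖c p.2 k‖ₑ := by
        simp only [Finset.sum_mul]
    _ ≤ ∑ k, (∑ j, ‖a (-p.2 - p.1) j‖ₑ) * (erho p.1 * ∑ k, ‖b p.1 k‖ₑ) * ‖c p.2 k‖ₑ := by
        gcongr with k hk
        exact Finset.single_le_sum (f := fun k => ‖b p.1 k‖ₑ) (fun _ _ => zero_le) hk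
    _ = _ := (Finset.mul_sum _ _ _).symm

theorem sum_enorm_sq_le (c : Fin n → ℂ) : (∑ k, ‖c k‖ₑ) ^ 2 ≤ n * ∑ k, ‖c k‖ₑ ^ 2 := by
  have := tsum_sq_le_of_sq_le_mul (F := fun k => ‖c k‖ₑ) (p := fun _ => 1)
    (q := fun k => ‖c k‖ₑ ^ 2) fun k => by rw [one_mul]
  simpa only [tsum_fintype, Finset.sum_const, Finset.card_univ, Fintype.card_fin, nsmul_eq_mul,
    mul_one] using this

theorem tsum_weight_le {s : ℝ} {m : ℕ} (hs : 2 * s = m) (c : Coeffs n) :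
    ∑' ξ, erho ξ ^ m * (∑ k, ‖c ξ k‖ₑ) ^ 2 ≤ n * sobolevNormSq s c := by
  rw [sobolevNormSq, ← ENNReal.tsum_mul_left]
  refine ENNReal.tsum_le_tsum fun ξ => ?_
  rw [hs, Real.rpow_natCast, ENNReal.ofReal_pow (rho_pos ξ).le, mul_left_comm, erho]
  gcongr
  exact sum_enorm_sq_le _

theorem tsum_enorm_triTerm_sq_le (hn : 2 ≤ n) : ∃ C : ENNReal, C < ⊤ ∧ ∀ a b c : Coeffs n,
    (∑' p, ‖triTerm a b c p‖ₑ) ^ 2 ≤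
      C * (sobolevNormSq (1 / 2) a * sobolevNormSq (1 / 2) c * sobolevNormSq (n / 2) b) := by
  obtain ⟨C, hC, h⟩ := tsum_trilinear_le hn
  refine ⟨C * (n : ENNReal) ^ 3, ENNReal.mul_lt_top hC.lt_top (ENNReal.pow_lt_top (by simp)),
    fun a b c => ?_⟩
  have ha := tsum_weight_le (s := 1 / 2) (m := 1) (by norm_num) a
  have hc := tsum_weight_le (s := 1 / 2) (m := 1) (by norm_num) c
  have hb := tsum_weight_le (s := n / 2) (m := n) (by ring) b
  simp only [pow_one] at ha hc
  calc (∑' p, ‖triTerm a b c p‖ₑ) ^ 2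
      ≤ (∑' η, ∑' ζ, (∑ j, ‖a (-ζ - η) j‖ₑ) * (erho η * ∑ k, ‖b η k‖ₑ) * ∑ k, ‖c ζ k‖ₑ) ^ 2 := by
        rw [ENNReal.tsum_prod']
        exact pow_le_pow_left' (ENNReal.tsum_le_tsum fun η => ENNReal.tsum_le_tsum fun ζ =>
          enorm_triTerm_le a b c (η, ζ)) 2
    _ ≤ _ := h (fun ξ => ∑ k, ‖a ξ k‖ₑ) (fun ξ => ∑ k, ‖b ξ k‖ₑ) (fun ξ => ∑ k, ‖c ξ k‖ₑ)
    _ ≤ C * (n * sobolevNormSq (1 / 2) a) * (n * sobolevNormSq (1 / 2) c) *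
        (n * sobolevNormSq (n / 2) b) :=
        mul_le_mul' (mul_le_mul' (mul_le_mul' le_rfl ha) hc) hb
    _ = _ := by ring

theorem sobolevNormSq_half_sq_le (c : Coeffs n) :
    sobolevNormSq (1 / 2) c ^ 2 ≤ sobolevNormSq 0 c * sobolevNormSq 1 c := by
  refine tsum_sq_le_of_sq_le_mul fun ξ => le_of_eq ?_
  have e : ENNReal.ofReal (rho ξ ^ (2 * (1 / 2) : ℝ)) ^ 2 =
      ENNReal.ofReal (rho ξ ^ (2 * 0 : ℝ)) * ENNReal.ofReal (rho ξ ^ (2 * 1 : ℝ)) := by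
    rw [← ENNReal.ofReal_pow (Real.rpow_nonneg (rho_pos ξ).le _),
      ← ENNReal.ofReal_mul (Real.rpow_nonneg (rho_pos ξ).le _), ← Real.rpow_natCast,
      ← Real.rpow_mul (rho_pos ξ).le]
    norm_num
  rw [mul_pow, e]
  ring

theorem sobSq_half_sq_le {c : Coeffs n} (hc : sobolevNormSq 1 c < ⊤) :
    sobSq (1 / 2) c ^ 2 ≤ sobSq 0 c * sobSq 1 c := by
  have h0 : sobolevNormSq 0 c < ⊤ := (sobolevNormSq_mono_exponent zero_le_one c).trans_lt hc
  rw [sobSq, sobSq, sobSq, ← ENNReal.toReal_pow, ← ENNReal.toReal_mul]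
  exact ENNReal.toReal_mono (ENNReal.mul_lt_top h0 hc).ne (sobolevNormSq_half_sq_le c)

theorem sobolevNormSq_half_lt_top {c : Coeffs n} (hc : sobolevNormSq 1 c < ⊤) :
    sobolevNormSq (1 / 2) c < ⊤ :=
  (sobolevNormSq_mono_exponent (by norm_num) c).trans_lt hc

theorem summable_norm_triTerm (hn : 2 ≤ n) {a b c : Coeffs n} (ha : sobolevNormSq 1 a < ⊤)
    (hb : sobolevNormSq (n / 2) b < ⊤) (hc : sobolevNormSq 1 c < ⊤) :
    Summable fun p => ‖triTerm a b c p‖ := by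
  obtain ⟨C, hC, h⟩ := tsum_enorm_triTerm_sq_le hn
  exact summable_of_tsum_enorm_lt_top (lt_top_of_sq_le (h a b c) (ENNReal.mul_lt_top hC
    (ENNReal.mul_lt_top (ENNReal.mul_lt_top (sobolevNormSq_half_lt_top ha)
      (sobolevNormSq_half_lt_top hc)) hb)))

theorem exists_norm_tri_sq_le (hn : 2 ≤ n) : ∃ C : ℝ, 0 ≤ C ∧ ∀ a b c : Coeffs n,
    sobolevNormSq 1 a < ⊤ → sobolevNormSq (n / 2) b < ⊤ → sobolevNormSq 1 c < ⊤ →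
    ‖tri a b c‖ ^ 2 ≤ C * (sobSq (1 / 2) a * sobSq (1 / 2) c * sobSq (n / 2) b) := by
  obtain ⟨C, hC, h⟩ := tsum_enorm_triTerm_sq_le hn
  refine ⟨C.toReal, ENNReal.toReal_nonneg, fun a b c ha hb hc => ?_⟩
  rw [sobSq, sobSq, sobSq, ← ENNReal.toReal_mul, ← ENNReal.toReal_mul, ← ENNReal.toReal_mul]
  exact norm_tsum_sq_le (h a b c) (ENNReal.mul_lt_top hC
    (ENNReal.mul_lt_top (ENNReal.mul_lt_top (sobolevNormSq_half_lt_top ha)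
      (sobolevNormSq_half_lt_top hc)) hb))

/-- Antisymmetry of the advection form for a solenoidal advecting field. -/
theorem triTerm_swap {a : Coeffs n} (ha : ∀ ξ, ∑ j, (ξ j : ℂ) * a ξ j = 0) (b c : Coeffs n)
    (p : (Fin n → ℤ) × (Fin n → ℤ)) : triTerm a b c p.swap = - triTerm a c b p := by
  obtain ⟨η, ζ⟩ := p
  simp only [triTerm, Prod.swap]
  rw [← Finset.sum_neg_distrib]
  refine Finset.sum_congr rfl fun k _ => ?_
  have h := ha (-ζ - η)
  have e : -η - ζ = -ζ - η := by abel
  rw [e]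
  have h1 : ∑ j, (a (-ζ - η) j * (2 * Real.pi * Complex.I * (ζ j : ℂ) * b ζ k) * c η k +
      a (-ζ - η) j * (2 * Real.pi * Complex.I * (η j : ℂ) * c η k) * b ζ k) =
      (-(2 * Real.pi * Complex.I) * b ζ k * c η k) * ∑ j, ((-ζ - η) j : ℂ) * a (-ζ - η) j := by
    rw [Finset.mul_sum]
    refine Finset.sum_congr rfl fun j _ => ?_
    simp only [Pi.sub_apply, Pi.neg_apply]
    push_cast
    ring
  rw [h, mul_zero, Finset.sum_add_distrib] at h1
  exact eq_neg_of_add_eq_zero_left h1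

theorem tri_antisymm {a : Coeffs n} (ha : ∀ ξ, ∑ j, (ξ j : ℂ) * a ξ j = 0) (b c : Coeffs n) :
    tri a b c = - tri a c b := by
  rw [tri, tri, ← (Equiv.prodComm (Fin n → ℤ) (Fin n → ℤ)).tsum_eq, ← tsum_neg]
  exact tsum_congr fun p => triTerm_swap ha b c p

theorem tri_self {a : Coeffs n} (ha : ∀ ξ, ∑ j, (ξ j : ℂ) * a ξ j = 0) (b : Coeffs n) :
    tri a b b = 0 := self_eq_neg.1 (tri_antisymm ha b b)

theorem tri_sub_left (hn : 2 ≤ n) {a a' b c : Coeffs n} (ha : sobolevNormSq 1 a < ⊤)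
    (ha' : sobolevNormSq 1 a' < ⊤) (hb : sobolevNormSq (n / 2) b < ⊤)
    (hc : sobolevNormSq 1 c < ⊤) : tri (a - a') b c = tri a b c - tri a' b c := by
  rw [tri, tri, tri, ← (summable_norm_triTerm hn ha hb hc).of_norm.tsum_sub
    (summable_norm_triTerm hn ha' hb hc).of_norm]
  refine tsum_congr fun p => ?_
  simp only [triTerm, Pi.sub_apply, ← Finset.sum_sub_distrib]
  refine Finset.sum_congr rfl fun k _ => Finset.sum_congr rfl fun j _ => ?_
  ring

theorem tri_sub_right (hn : 2 ≤ n) {a b c c' : Coeffs n} (ha : sobolevNormSq 1 a < ⊤)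
    (hb : sobolevNormSq (n / 2) b < ⊤) (hc : sobolevNormSq 1 c < ⊤)
    (hc' : sobolevNormSq 1 c' < ⊤) : tri a b (c - c') = tri a b c - tri a b c' := by
  rw [tri, tri, tri, ← (summable_norm_triTerm hn ha hb hc).of_norm.tsum_sub
    (summable_norm_triTerm hn ha hb hc').of_norm]
  refine tsum_congr fun p => ?_
  simp only [triTerm, Pi.sub_apply, ← Finset.sum_sub_distrib]
  refine Finset.sum_congr rfl fun k _ => Finset.sum_congr rfl fun j _ => ?_
  ring

theorem triTerm_trunc_right (N : ℕ) (a b c : Coeffs n) (p : (Fin n → ℤ) × (Fin n → ℤ)) :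
    triTerm a b (trunc N c) p = if p.2 ∈ cube n N then triTerm a b c p else 0 := by
  by_cases h : p.2 ∈ cube n N <;> simp [triTerm, trunc, h]

theorem triTerm_trunc_mid (N : ℕ) (a b c : Coeffs n) (p : (Fin n → ℤ) × (Fin n → ℤ)) :
    triTerm a (trunc N b) c p = if p.1 ∈ cube n N then triTerm a b c p else 0 := by
  by_cases h : p.1 ∈ cube n N <;> simp [triTerm, trunc, h]

theorem eventually_mem_cube (ξ : Fin n → ℤ) : ∀ᶠ N in atTop, ξ ∈ cube n N := by
  filter_upwards [tendsto_cube_atTop.eventually (eventually_ge_atTop {ξ})] with N hN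
  exact hN (Finset.mem_singleton_self ξ)

theorem tendsto_tri_trunc_right (hn : 2 ≤ n) {a b c : Coeffs n} (ha : sobolevNormSq 1 a < ⊤)
    (hb : sobolevNormSq (n / 2) b < ⊤) (hc : sobolevNormSq 1 c < ⊤) :
    Tendsto (fun N => tri a b (trunc N c)) atTop (𝓝 (tri a b c)) := by
  refine tendsto_tsum_of_dominated_convergence (summable_norm_triTerm hn ha hb hc) (fun p => ?_)
    (Eventually.of_forall fun N p => ?_)
  · refine tendsto_const_nhds.congr' ?_
    filter_upwards [eventually_mem_cube p.2] with N hN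
    rw [triTerm_trunc_right, if_pos hN]
  · rw [triTerm_trunc_right]
    split_ifs <;> simp

theorem tendsto_tri_trunc_mid (hn : 2 ≤ n) {a b c : Coeffs n} (ha : sobolevNormSq 1 a < ⊤)
    (hb : sobolevNormSq (n / 2) b < ⊤) (hc : sobolevNormSq 1 c < ⊤) :
    Tendsto (fun N => tri a (trunc N b) c) atTop (𝓝 (tri a b c)) := by
  refine tendsto_tsum_of_dominated_convergence (summable_norm_triTerm hn ha hb hc) (fun p => ?_)
    (Eventually.of_forall fun N p => ?_)
  · refine tendsto_const_nhds.congr' ?_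
    filter_upwards [eventually_mem_cube p.1] with N hN
    rw [triTerm_trunc_mid, if_pos hN]
  · rw [triTerm_trunc_mid]
    split_ifs <;> simp

/-! ### The advection term -/

theorem hasSum_fieldCoeffs_advection {u : VelocityField n} (hu : IsL2 u)
    (hu1 : sobolevNormSq 1 (fieldCoeffs u) < ⊤) (ξ : Fin n → ℤ) (k : Fin n) :
    HasSum (fun η => ∑ j, fieldCoeffs u (ξ - η) j *
      (2 * Real.pi * Complex.I * (η j : ℂ) * fieldCoeffs u η k))
      (fieldCoeffs (advection u) ξ k) := by
  have hp := fun j => isWeakPartial_pderiv hu1 j k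
  have h : HasSum (fun η => ∑ j, fieldCoeffs u (ξ - η) j *
      (2 * Real.pi * Complex.I * (η j : ℂ) * fieldCoeffs u η k))
      (∑ j, mFourierCoeff (fun x => (u x j : ℂ) * ((pderiv j fun y => u y k) x : ℂ)) ξ) := by
    refine hasSum_sum fun j _ => ?_
    have := hasSum_mFourierCoeff_convolution (memLp_ofReal (hu j)) (memLp_ofReal (hp j).1) ξ
    simp only [(hp j).2] at this
    exact this
  convert h using 1
  simp only [fieldCoeffs, advection, mFourierCoeff_def]
  have hint : ∀ j, Integrable (fun x => mFourier (-ξ) x *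
      ((u x j : ℂ) * ((pderiv j fun y => u y k) x : ℂ))) (torusMeasure n) := fun j => by
    have := (memLp_mFourier_mul (memLp_ofReal (hu j)) (-ξ)).integrable_mul
      (memLp_ofReal (hp j).1)
    refine this.congr (ae_of_all _ fun x => ?_)
    simp only [Pi.mul_apply]
    ring
  rw [← integral_finsetSum _ fun j _ => hint j]
  congr 1
  funext x
  push_cast
  rw [Finset.mul_sum]

theorem tri_trunc_eq_sum_advection {u : VelocityField n} (hu : IsL2 u)
    (hu1 : sobolevNormSq 1 (fieldCoeffs u) < ⊤) (N : ℕ) (c : Coeffs n) :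
    tri (fieldCoeffs u) (fieldCoeffs u) (trunc N c) =
      ∑ ξ ∈ cube n N, ∑ k, fieldCoeffs (advection u) ξ k * c (-ξ) k := by
  set û := fieldCoeffs u
  have h1 : ∀ ζ : Fin n → ℤ, HasSum
      (fun p : (Fin n → ℤ) × (Fin n → ℤ) => if p.2 = ζ then triTerm û û c p else 0)
      (∑ k, fieldCoeffs (advection u) (-ζ) k * c ζ k) := by
    intro ζ
    have hinj : Function.Injective fun η : Fin n → ℤ => (η, ζ) := fun η η' h =>
      (Prod.mk.inj h).1
    rw [← hinj.hasSum_iff]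
    · have : HasSum (fun η => ∑ k, (∑ j, û (-ζ - η) j *
          (2 * Real.pi * Complex.I * (η j : ℂ) * û η k)) * c ζ k)
          (∑ k, fieldCoeffs (advection u) (-ζ) k * c ζ k) :=
        hasSum_sum fun k _ => (hasSum_fieldCoeffs_advection hu hu1 (-ζ) k).mul_right _
      refine this.congr_fun fun η => ?_
      simp only [Function.comp_apply, if_true, triTerm, Finset.sum_mul]
    · intro p hp
      refine if_neg fun h => hp ⟨p.1, ?_⟩
      rw [← h]
  have h2 := hasSum_sum (s := cube n N) fun ζ _ => h1 ζ
  have h3 : tri û û (trunc N c) =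
      ∑ ζ ∈ cube n N, ∑ k, fieldCoeffs (advection u) (-ζ) k * c ζ k := by
    rw [tri, ← h2.tsum_eq]
    refine tsum_congr fun p => ?_
    rw [triTerm_trunc_right, Finset.sum_ite_eq]
  rw [h3]
  refine Finset.sum_nbij' (fun ξ => -ξ) (fun ξ => -ξ) (fun ξ h => neg_mem_cube.2 h)
    (fun ξ h => neg_mem_cube.2 h) (fun ξ _ => neg_neg ξ) (fun ξ _ => neg_neg ξ) fun ξ _ => ?_
  rw [neg_neg]

theorem sum_leray_mul {d : Coeffs n} (h0 : d 0 = 0)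
    (hd : ∀ ξ, ∑ j, (ξ j : ℂ) * d ξ j = 0) (c : Coeffs n) (ξ : Fin n → ℤ) :
    ∑ k, leray c ξ k * d (-ξ) k = ∑ k, c ξ k * d (-ξ) k := by
  by_cases hξ : ξ = 0
  · subst hξ
    simp [h0]
  · have h := hd (-ξ)
    have h' : ∑ k, (ξ k : ℂ) * d (-ξ) k = 0 := by
      simpa using h
    simp only [leray, if_neg hξ, sub_mul, Finset.sum_sub_distrib]
    have : ∑ k, (ξ k : ℂ) * (∑ j, (ξ j : ℂ) * c ξ j) / (∑ j, (ξ j : ℂ) ^ 2) * d (-ξ) k =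
        (∑ j, (ξ j : ℂ) * c ξ j) / (∑ j, (ξ j : ℂ) ^ 2) * ∑ k, (ξ k : ℂ) * d (-ξ) k := by
      rw [Finset.mul_sum]
      refine Finset.sum_congr rfl fun k _ => ?_
      ring
    rw [this, h', mul_zero, sub_zero]

/-! ### Time-dependent coefficients -/

theorem timeMeasure_eq_Ioc (T : ℝ) : timeMeasure T = volume.restrict (Ioc 0 T) :=
  Measure.restrict_congr_set Ioo_ae_eq_Ioc

theorem ae_restrict_Ioc_of_ae_timeMeasure {T t : ℝ} (ht : t ≤ T) {p : ℝ → Prop}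
    (h : ∀ᵐ τ ∂timeMeasure T, p τ) : ∀ᵐ τ ∂volume.restrict (Ioc 0 t), p τ := by
  rw [timeMeasure_eq_Ioc] at h
  exact ae_restrict_of_ae_restrict_of_subset (Ioc_subset_Ioc_right ht) h

theorem intervalIntegrable_of_integrable_timeMeasure {T s t : ℝ} (hs : s ∈ Icc 0 T)
    (ht : t ∈ Icc 0 T) {E : Type*} [NormedAddCommGroup E] {F : ℝ → E}
    (hF : Integrable F (timeMeasure T)) : IntervalIntegrable F volume s t :=
  (((integrableOn_Icc_iff_integrableOn_Ioo (μ := volume)).2 hF).mono_set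
    (ordConnected_Icc.uIcc_subset hs ht)).intervalIntegrable

theorem aemeasurable_sobolevNormSq {T s : ℝ} {c : ℝ → Coeffs n} (hc : TimeMeasurable T c) :
    AEMeasurable (fun t => sobolevNormSq s (c t)) (timeMeasure T) := by
  refine AEMeasurable.tsum fun ξ => AEMeasurable.const_mul ?_ _
  exact Finset.aemeasurable_fun_sum _ fun k _ => (hc ξ k).enorm.pow_const 2

theorem integrable_sobSq {T s : ℝ} {c : ℝ → Coeffs n} (hc : TimeMeasurable T c)
    (h : ∫⁻ t, sobolevNormSq s (c t) ∂timeMeasure T < ⊤) :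
    Integrable (fun t => sobSq s (c t)) (timeMeasure T) :=
  integrable_toReal_of_lintegral_ne_top (aemeasurable_sobolevNormSq hc) h.ne

theorem ae_sobolevNormSq_lt_top {T s : ℝ} {c : ℝ → Coeffs n} (hc : TimeMeasurable T c)
    (h : ∫⁻ t, sobolevNormSq s (c t) ∂timeMeasure T < ⊤) :
    ∀ᵐ t ∂timeMeasure T, sobolevNormSq s (c t) < ⊤ :=
  ae_lt_top' (aemeasurable_sobolevNormSq hc) h.ne

/-- Continuous coefficients `c` of a field `u`, with locally integrable time derivative `g`,
satisfying the Galerkin-truncated momentum equation. -/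
structure GalerkinEquation (T : ℝ) (a : Viscosity n) (f : ℝ → VecDistribution n)
    (u : ℝ → VelocityField n) (c g : ℝ → Coeffs n) : Prop where
  continuousOn : ∀ ξ k, ContinuousOn (fun t => c t ξ k) (Icc 0 T)
  ae_mem : ∀ᵐ t ∂timeMeasure T, MemHsigma 1 (u t)
  ae_eq : ∀ᵐ t ∂timeMeasure T, c t = fieldCoeffs (u t)
  locallyIntegrable : ∀ ξ k, LocallyIntegrableOn (fun t => g t ξ k) (Ioo 0 T)
  primitive : ∀ ξ k, ∀ s ∈ Ioo 0 T, ∀ t ∈ Ioo 0 T, c t ξ k - c s ξ k = ∫ τ in s..t, g τ ξ k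
  equation : ∀ᵐ t ∂timeMeasure T, ∀ w : VelocityField n, MemHsigma 1 w → ∀ N,
    (∑ ξ ∈ cube n N, ∑ k, g t ξ k * fieldCoeffs w (-ξ) k) +
      tri (c t) (c t) (trunc N (fieldCoeffs w)) + (viscousForm a t (u t) (truncField N w) : ℂ) =
    dualPair (distCoeffs (f t)) (trunc N (fieldCoeffs w))

theorem continuousOn_fieldCoeffs {T : ℝ} {u ũ : ℝ → VelocityField n}
    (h : IsWeaklyContinuousVersion T u ũ) (ξ : Fin n → ℤ) (k : Fin n) :
    ContinuousOn (fun t => fieldCoeffs (ũ t) ξ k) (Icc 0 T) := by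
  have hl2 : ∀ p : Torus n → ℝ, Continuous p →
      IsL2 (fun x l => if l = k then p x else 0 : VelocityField n) := by
    intro p hp l
    by_cases hl : l = k
    · simp only [hl, if_true]
      exact hp.memLp_of_hasCompactSupport (HasCompactSupport.of_compactSpace _)
    · simp [hl]
  have hre : Continuous fun x : Torus n => (mFourier (-ξ) x).re :=
    Complex.continuous_re.comp (mFourier (-ξ)).continuous
  have him : Continuous fun x : Torus n => (mFourier (-ξ) x).im :=
    Complex.continuous_im.comp (mFourier (-ξ)).continuous
  have h1 := h.continuous _ (hl2 _ hre)
  have h2 := h.continuous _ (hl2 _ him)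
  have h3 : ContinuousOn (fun t => ((innerL2 (ũ t)
      (fun x l => if l = k then (mFourier (-ξ) x).re else 0) : ℝ) : ℂ) +
      ((innerL2 (ũ t) (fun x l => if l = k then (mFourier (-ξ) x).im else 0) : ℝ) : ℂ) * Complex.I)
      (Icc 0 T) :=
    (Complex.continuous_ofReal.comp_continuousOn h1).add
      ((Complex.continuous_ofReal.comp_continuousOn h2).mul continuousOn_const)
  refine h3.congr fun t ht => ?_
  have hu := (h.mem t ht).isL2 k
  have hi := (memLp_mFourier_mul (memLp_ofReal hu) (-ξ)).integrable (by norm_num)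
  simp only [innerL2, mul_ite, mul_zero, Finset.sum_ite_eq', Finset.mem_univ, if_true]
  rw [fieldCoeffs, mFourierCoeff_def]
  apply Complex.ext
  · rw [← RCLike.re_eq_complex_re, ← integral_re hi]
    simp [mul_comm]
  · rw [← RCLike.im_eq_complex_im, ← integral_im hi]
    simp [mul_comm]

theorem IsWeakSolution.exists_galerkinEquation {T : ℝ} (hT : 0 < T) {a : Viscosity n}
    {f : ℝ → VecDistribution n} {u₀ : VelocityField n} {u ũ : ℝ → VelocityField n}
    (hu : IsWeakSolution T a f u₀ u) (hũ : IsWeaklyContinuousVersion T u ũ) :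
    ∃ g, GalerkinEquation T a f u (fun t => fieldCoeffs (ũ t)) g := by
  obtain ⟨u', hd, heq⟩ := hu.equation
  have hae : ∀ᵐ t ∂timeMeasure T, fieldCoeffs (ũ t) = fieldCoeffs (u t) :=
    hũ.ae_eq.mono fun t ht => fieldCoeffs_congr_ae ht
  refine ⟨fun t => distCoeffs (u' t), continuousOn_fieldCoeffs hũ, hu.mem_L2.mem, hae,
    fun ξ k => (hd k (character (-ξ))).1, fun ξ k => ?_, ?_⟩
  · refine sub_eq_integral_of_weakDeriv hT
      ((continuousOn_fieldCoeffs hũ ξ k).mono Ioo_subset_Icc_self)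
      (hd k (character (-ξ))).1 fun ψ h1 h2 h3 => ?_
    have h4 := (hd k (character (-ξ))).2 ψ h1 h2 h3
    refine Eq.trans ?_ h4
    refine integral_congr_ae ?_
    filter_upwards [hae] with t ht
    rw [ht, fieldCoeffs, mFourierCoeff_def]
    congr 2
    funext x
    exact mul_comm _ _
  · filter_upwards [heq, hae, hu.mem_L2.mem] with t h1 h2 h3 w hw N
    have h4 := h1 (truncField N w) (hw.truncField N 1)
    rw [fieldCoeffs_truncField, dualPair_trunc] at h4
    rw [← h4, h2, tri_trunc_eq_sum_advection h3.isL2 h3.finite_norm, ← Finset.sum_add_distrib]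
    congr 1
    refine Finset.sum_congr rfl fun ξ _ => ?_
    rw [← sum_leray_mul hw.mean_zero hw.sum_mul_eq_zero (fieldCoeffs (advection (u t))), ← Finset.sum_add_distrib]
    refine Finset.sum_congr rfl fun k _ => ?_
    simp only [Pi.add_apply]
    ring

theorem eqOn_Icc_of_ae_eq {T : ℝ} (hT : 0 < T) {F G : ℝ → ℂ} (hF : ContinuousOn F (Icc 0 T))
    (hG : ContinuousOn G (Icc 0 T)) (h : ∀ᵐ t ∂timeMeasure T, F t = G t) :
    EqOn F G (Icc 0 T) := by
  have h1 : EqOn F G (Ioo 0 T) := Measure.eqOn_open_of_ae_eq (μ := volume) h isOpen_Ioo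
    (hF.mono Ioo_subset_Icc_self) (hG.mono Ioo_subset_Icc_self)
  refine h1.of_subset_closure hF hG Ioo_subset_Icc_self ?_
  rw [closure_Ioo hT.ne]

/-- Weakly continuous versions of fields that agree for almost every time agree for every time. -/
theorem IsWeaklyContinuousVersion.fieldCoeffs_eq {T : ℝ} (hT : 0 < T)
    {u v ũ w : ℝ → VelocityField n} (hu : IsWeaklyContinuousVersion T u ũ)
    (hv : IsWeaklyContinuousVersion T v w)
    (h : ∀ᵐ t ∂timeMeasure T, fieldCoeffs (u t) = fieldCoeffs (v t)) :
    ∀ t ∈ Icc 0 T, fieldCoeffs (ũ t) = fieldCoeffs (w t) := by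
  intro t ht
  funext ξ k
  refine eqOn_Icc_of_ae_eq hT (continuousOn_fieldCoeffs hu ξ k) (continuousOn_fieldCoeffs hv ξ k)
    ?_ ht
  filter_upwards [hu.ae_eq, hv.ae_eq, h] with τ h1 h2 h3
  rw [fieldCoeffs_congr_ae h1, fieldCoeffs_congr_ae h2, h3]

theorem IsWeakSolution.fieldCoeffs_zero {T : ℝ} (hT : 0 < T) {a : Viscosity n}
    {f : ℝ → VecDistribution n} {u₀ : VelocityField n} (hu₀ : MemHsigma 0 u₀)
    {u ũ : ℝ → VelocityField n} (hu : IsWeakSolution T a f u₀ u)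
    (hũ : IsWeaklyContinuousVersion T u ũ) : fieldCoeffs (ũ 0) = fieldCoeffs u₀ := by
  obtain ⟨w, hw, hw0⟩ := hu.initial
  have h0 : (0 : ℝ) ∈ Icc 0 T := ⟨le_rfl, hT.le⟩
  rw [hũ.fieldCoeffs_eq hT hw (ae_of_all _ fun _ => rfl) 0 h0]
  have hm := hw.mem 0 h0
  have hz := hm.sub hu₀
  set z : VelocityField n := fun x k => w 0 x k - u₀ x k
  have h1 : innerL2 z z = 0 := by
    have h2 := hw0 z hz
    have hi : ∀ {p : VelocityField n}, IsL2 p →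
        Integrable (fun x => ∑ k, p x k * z x k) (torusMeasure n) := fun hp =>
      integrable_finsetSum _ fun k _ => (hp k).integrable_mul (hz.isL2 k)
    have h3 : innerL2 z z = innerL2 (w 0) z - innerL2 u₀ z := by
      rw [innerL2, innerL2, innerL2, ← integral_sub (hi hm.isL2) (hi hu₀.isL2)]
      congr 1
      funext x
      rw [← Finset.sum_sub_distrib]
      refine Finset.sum_congr rfl fun k _ => ?_
      simp only [z]
      ring
    rw [h3, h2, sub_self]
  rw [innerL2_self_eq hz.isL2 hz.finite_norm] at h1
  have h4 := hasSum_sobSq_zero hz.finite_norm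
  rw [h1, hasSum_zero_iff_of_nonneg fun ξ => Finset.sum_nonneg fun k _ => sq_nonneg _] at h4
  rw [← sub_eq_zero, ← fieldCoeffs_sub hm.isL2 hu₀.isL2]
  funext ξ k
  have h5 := congrFun h4 ξ
  simp only [Pi.zero_apply] at h5
  rw [Finset.sum_eq_zero_iff_of_nonneg fun k _ => sq_nonneg _] at h5
  simpa using h5 k (Finset.mem_univ k)

theorem sub_eq_integral_Icc {T : ℝ} (hT : 0 < T) {P h : ℝ → ℂ} (hP : ContinuousOn P (Icc 0 T))
    (hh : Integrable h (timeMeasure T))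
    (heq : ∀ s ∈ Ioo 0 T, ∀ t ∈ Ioo 0 T, s ≤ t → P t - P s = ∫ τ in s..t, h τ) :
    ∀ t ∈ Icc 0 T, P t - P 0 = ∫ τ in (0 : ℝ)..t, h τ := by
  have h0 : (0 : ℝ) ∈ Icc 0 T := ⟨le_rfl, hT.le⟩
  have hi := fun s hs t ht => intervalIntegrable_of_integrable_timeMeasure (T := T) (s := s)
    (t := t) hs ht hh
  have hIc : ContinuousOn (fun t => ∫ τ in (0 : ℝ)..t, h τ) (Icc 0 T) := by
    have := intervalIntegral.continuousOn_primitive_interval' (hi 0 h0 T ⟨hT.le, le_rfl⟩)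
      (a := 0) (by simp)
    rwa [uIcc_of_le hT.le] at this
  have hmid : T / 2 ∈ Ioo 0 T := ⟨by linarith, by linarith⟩
  have hconst : ∀ s ∈ Ioo 0 T, ∀ t ∈ Ioo 0 T, s ≤ t →
      P t - ∫ τ in (0 : ℝ)..t, h τ = P s - ∫ τ in (0 : ℝ)..s, h τ := by
    intro s hs t ht hst
    have h1 := heq s hs t ht hst
    rw [← intervalIntegral.integral_interval_sub_left
      (hi 0 h0 t (Ioo_subset_Icc_self ht)) (hi 0 h0 s (Ioo_subset_Icc_self hs))] at h1
    linear_combination h1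
  have heqOn : EqOn (fun t => P t - ∫ τ in (0 : ℝ)..t, h τ)
      (fun _ => P (T / 2) - ∫ τ in (0 : ℝ)..(T / 2), h τ) (Icc 0 T) := by
    refine EqOn.of_subset_closure (s := Ioo 0 T) (fun t ht => ?_) (hP.sub hIc) continuousOn_const
      Ioo_subset_Icc_self (by rw [closure_Ioo hT.ne])
    rcases le_total (T / 2) t with h1 | h1
    · exact hconst _ hmid _ ht h1
    · exact (hconst _ ht _ hmid h1).symm
  intro t ht
  have h1 := heqOn ht
  have h2 := heqOn h0
  simp only [intervalIntegral.integral_same, sub_zero] at h1 h2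
  linear_combination h1 - h2

/-- The truncated `L²` product of two time-dependent families of coefficients. -/
def truncProd (N : ℕ) (c d : Coeffs n) : ℂ := ∑ ξ ∈ cube n N, ∑ k, c ξ k * d (-ξ) k

theorem truncProd_comm (N : ℕ) (c d : Coeffs n) : truncProd N c d = truncProd N d c := by
  refine Finset.sum_nbij' (fun ξ => -ξ) (fun ξ => -ξ) (fun ξ h => neg_mem_cube.2 h)
    (fun ξ h => neg_mem_cube.2 h) (fun ξ _ => neg_neg ξ) (fun ξ _ => neg_neg ξ) fun ξ _ => ?_
  refine Finset.sum_congr rfl fun k _ => ?_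
  rw [neg_neg, mul_comm]

theorem GalerkinEquation.truncProd_sub {T : ℝ} {a : Viscosity n}
    {f : ℝ → VecDistribution n} {u v : ℝ → VelocityField n} {c d g h : ℝ → Coeffs n}
    (hu : GalerkinEquation T a f u c g) (hv : GalerkinEquation T a f v d h) (N : ℕ) :
    ∀ s ∈ Ioo 0 T, ∀ t ∈ Ioo 0 T, s ≤ t →
      truncProd N (c t) (d t) - truncProd N (c s) (d s) =
        ∫ τ in s..t, (truncProd N (g τ) (d τ) + truncProd N (c τ) (h τ)) := by
  intro s hs t ht hst
  have hsub : Icc s t ⊆ Ioo 0 T := fun x hx => ⟨hs.1.trans_le hx.1, hx.2.trans_lt ht.2⟩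
  have hint : ∀ {F : ℝ → ℂ}, LocallyIntegrableOn F (Ioo 0 T) → IntervalIntegrable F volume s t :=
    fun hF => (hF.integrableOn_compact_subset (by rwa [uIcc_of_le hst])
      isCompact_uIcc).intervalIntegrable
  have hp := fun ξ k => integral_mul_primitive hst (hint (hu.locallyIntegrable ξ k))
    (hint (hv.locallyIntegrable (-ξ) k)) (F := fun t => c t ξ k) (G := fun t => d t (-ξ) k)
    (fun x hx => hu.primitive ξ k s hs x (hsub hx))
    (fun x hx => hv.primitive (-ξ) k s hs x (hsub hx))
  simp only [truncProd, ← Finset.sum_add_distrib, ← Finset.sum_sub_distrib]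
  have hi : ∀ ξ, IntervalIntegrable (fun τ => ∑ k,
      (g τ ξ k * d τ (-ξ) k + c τ ξ k * h τ (-ξ) k)) volume s t := fun ξ => by
    have := IntervalIntegrable.sum Finset.univ fun k _ => (hp ξ k).1
    rwa [Finset.sum_fn] at this
  rw [intervalIntegral.integral_finsetSum fun ξ _ => hi ξ]
  refine Finset.sum_congr rfl fun ξ _ => ?_
  rw [intervalIntegral.integral_finsetSum fun k _ => (hp ξ k).1]
  refine Finset.sum_congr rfl fun k _ => ?_
  rw [(hp ξ k).2]

theorem GalerkinEquation.aestronglyMeasurable {T : ℝ} {a : Viscosity n}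
    {f : ℝ → VecDistribution n} {u v : ℝ → VelocityField n} {c d g h : ℝ → Coeffs n}
    (hu : GalerkinEquation T a f u c g) (hv : GalerkinEquation T a f v d h) (N : ℕ) :
    AEStronglyMeasurable (fun τ => truncProd N (g τ) (d τ)) (timeMeasure T) := by
  unfold truncProd
  refine Finset.aestronglyMeasurable_fun_sum _ fun ξ _ =>
    Finset.aestronglyMeasurable_fun_sum _ fun k _ => ?_
  exact (hu.locallyIntegrable ξ k).aestronglyMeasurable.mul
    (((hv.continuousOn (-ξ) k).mono Ioo_subset_Icc_self).aestronglyMeasurable measurableSet_Ioo)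

theorem GalerkinEquation.timeMeasurable {T : ℝ} {a : Viscosity n}
    {f : ℝ → VecDistribution n} {u : ℝ → VelocityField n} {c g : ℝ → Coeffs n}
    (hu : GalerkinEquation T a f u c g) : TimeMeasurable T c := fun ξ k =>
  ((hu.continuousOn ξ k).mono Ioo_subset_Icc_self).aemeasurable measurableSet_Ioo

/-! ### The identity for the product of two solutions -/

/-- The rate of change of the truncated product of `u` and `v`, for the force coefficients `φ`. -/
def galerkinRate (N : ℕ) (a : Viscosity n) (t : ℝ) (φ : Coeffs n) (u v : VelocityField n) : ℂ :=
  dualPair φ (trunc N (fieldCoeffs v)) + dualPair φ (trunc N (fieldCoeffs u))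
    - tri (fieldCoeffs u) (fieldCoeffs u) (trunc N (fieldCoeffs v))
    + tri (fieldCoeffs v) (trunc N (fieldCoeffs u)) (fieldCoeffs v)
    - (viscousForm a t u (truncField N v) : ℂ) - (viscousForm a t v (truncField N u) : ℂ)

/-- The rate of change of the product of `u` and `v`. -/
def productRate (a : Viscosity n) (t : ℝ) (φ : Coeffs n) (u v : VelocityField n) : ℂ :=
  dualPair φ (fieldCoeffs v) + dualPair φ (fieldCoeffs u)
    + tri (fieldCoeffs v - fieldCoeffs u) (fieldCoeffs u) (fieldCoeffs v - fieldCoeffs u)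
    - (viscousForm a t u v : ℂ) - (viscousForm a t v u : ℂ)

theorem tri_sub_self (hn : 2 ≤ n) {c d : Coeffs n} (hc : sobolevNormSq 1 c < ⊤)
    (hcn : sobolevNormSq (n / 2) c < ⊤) (hd : sobolevNormSq 1 d < ⊤)
    (hdiv : ∀ ξ, ∑ j, (ξ j : ℂ) * (d - c) ξ j = 0) :
    tri (d - c) c (d - c) = tri d c d - tri c c d := by
  rw [tri_sub_right hn (sobolevNormSq_sub_lt_top hd hc) hcn hd hc, tri_self hdiv, sub_zero,
    tri_sub_left hn hd hc hcn hd]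

theorem tendsto_galerkinRate (hn : 2 ≤ n) {a : Viscosity n} {t M : ℝ} (hM : 0 ≤ M)
    (ha : a.BoundedAt t M) {φ : Coeffs n} (hφ : sobolevNormSq (-1) φ < ⊤) {u v : VelocityField n}
    (hu : MemHsigma 1 u) (hun : sobolevNormSq (n / 2) (fieldCoeffs u) < ⊤) (hv : MemHsigma 1 v) :
    Tendsto (fun N => galerkinRate N a t φ u v) atTop (𝓝 (productRate a t φ u v)) := by
  have hdiv := (hv.sub hu).sum_mul_eq_zero
  rw [fieldCoeffs_sub hv.isL2 hu.isL2] at hdiv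
  have e : productRate a t φ u v = dualPair φ (fieldCoeffs v) + dualPair φ (fieldCoeffs u)
      - tri (fieldCoeffs u) (fieldCoeffs u) (fieldCoeffs v)
      + tri (fieldCoeffs v) (fieldCoeffs u) (fieldCoeffs v)
      - (viscousForm a t u v : ℂ) - (viscousForm a t v u : ℂ) := by
    rw [productRate, tri_sub_self hn hu.finite_norm hun hv.finite_norm hdiv]
    ring
  rw [e]
  have hvis : ∀ {u v : VelocityField n}, MemHsigma 1 u → MemHsigma 1 v →
      Tendsto (fun N => (viscousForm a t u (truncField N v) : ℂ)) atTop
        (𝓝 (viscousForm a t u v : ℂ)) := fun hu hv =>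
    (Complex.continuous_ofReal.tendsto _).comp
      (tendsto_viscousForm_truncField hM ha hu.finite_norm hv)
  exact ((((tendsto_dualPair_trunc hφ hv.finite_norm).add
    (tendsto_dualPair_trunc hφ hu.finite_norm)).sub
    (tendsto_tri_trunc_right hn hu.finite_norm hun hv.finite_norm)).add
    (tendsto_tri_trunc_mid hn hv.finite_norm hun hv.finite_norm)).sub (hvis hu hv) |>.sub
    (hvis hv hu)

theorem le_add_of_sq_le_mul {x y z : ℝ} (hy : 0 ≤ y) (hz : 0 ≤ z) (h : x ^ 2 ≤ y * z) :
    x ≤ y + z := by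
  refine abs_le_of_sq_le_sq' ?_ (by positivity) |>.2
  nlinarith

theorem norm_galerkinRate_le {C K : ℝ} (hC : 0 ≤ C)
    (htri : ∀ a b c : Coeffs n, sobolevNormSq 1 a < ⊤ → sobolevNormSq (n / 2) b < ⊤ →
      sobolevNormSq 1 c < ⊤ →
      ‖tri a b c‖ ^ 2 ≤ C * (sobSq (1 / 2) a * sobSq (1 / 2) c * sobSq (n / 2) b))
    {a : Viscosity n} {t M : ℝ} (hM : 0 ≤ M)
    (ha : a.BoundedAt t M) {φ : Coeffs n} (hφ : sobolevNormSq (-1) φ < ⊤) {u v : VelocityField n}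
    (hu : MemHsigma 1 u) (hun : sobolevNormSq (n / 2) (fieldCoeffs u) < ⊤) (hv : MemHsigma 1 v)
    (huK : sobSq 0 (fieldCoeffs u) ≤ K) (hvK : sobSq 0 (fieldCoeffs v) ≤ K) (N : ℕ) :
    ‖galerkinRate N a t φ u v‖ ≤ 2 * sobSq (-1) φ +
      (1 + 2 * C * K + 2 * ((n : ℝ) ^ 4 * M)) *
        (sobSq 1 (fieldCoeffs u) + sobSq 1 (fieldCoeffs v)) + 2 * sobSq (n / 2) (fieldCoeffs u) := by
  set c := fieldCoeffs u with hc
  set d := fieldCoeffs v with hd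
  have hK : 0 ≤ K := (sobSq_nonneg 0 c).trans huK
  have hc1 : sobolevNormSq 1 c < ⊤ := hu.finite_norm
  have hd1 : sobolevNormSq 1 d < ⊤ := hv.finite_norm
  have p0 := sobSq_nonneg (-1) φ
  have p1 := sobSq_nonneg 1 c
  have p2 := sobSq_nonneg 1 d
  have p3 := sobSq_nonneg (n / 2) c
  have hF : ∀ e : Coeffs n, sobolevNormSq 1 e < ⊤ →
      ‖dualPair φ (trunc N e)‖ ≤ sobSq (-1) φ + sobSq 1 e := by
    intro e he
    refine le_add_of_sq_le_mul p0 (sobSq_nonneg 1 e) ?_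
    refine (norm_dualPair_sq_le hφ (sobolevNormSq_trunc_lt_top N 1 e)).trans ?_
    exact mul_le_mul_of_nonneg_left (sobSq_trunc_le N he) p0
  have hhalf : ∀ e : Coeffs n, sobolevNormSq 1 e < ⊤ → sobSq 0 e ≤ K →
      sobSq (1 / 2) e ^ 2 ≤ K * sobSq 1 e := fun e he heK =>
    (sobSq_half_sq_le he).trans (mul_le_mul_of_nonneg_right heK (sobSq_nonneg 1 e))
  have hq1 := hhalf c hc1 huK
  have hq2 := hhalf d hd1 hvK
  have h1 : ‖tri c c (trunc N d)‖ ≤ C * (K * (sobSq 1 c + sobSq 1 d)) + sobSq (n / 2) c := by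
    refine le_add_of_sq_le_mul (by positivity) p3 ?_
    refine (htri c c (trunc N d) hc1 hun (sobolevNormSq_trunc_lt_top N 1 d)).trans ?_
    have h2 : sobSq (1 / 2) c * sobSq (1 / 2) (trunc N d) ≤ K * (sobSq 1 c + sobSq 1 d) := by
      have h3 := sobSq_trunc_le N (sobolevNormSq_half_lt_top hd1)
      have h4 := mul_le_mul_of_nonneg_left h3 (sobSq_nonneg (1 / 2) c)
      nlinarith [sq_nonneg (sobSq (1 / 2) c - sobSq (1 / 2) d), sq_nonneg (sobSq (1 / 2) c),
        sq_nonneg (sobSq (1 / 2) d)]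
    calc _ ≤ C * (K * (sobSq 1 c + sobSq 1 d) * sobSq (n / 2) c) := by gcongr
      _ = _ := by ring
  have h2 : ‖tri d (trunc N c) d‖ ≤ C * (K * (sobSq 1 c + sobSq 1 d)) + sobSq (n / 2) c := by
    refine le_add_of_sq_le_mul (by positivity) p3 ?_
    refine (htri d (trunc N c) d hd1 (sobolevNormSq_trunc_lt_top N _ c) hd1).trans ?_
    have h3 : sobSq (1 / 2) d * sobSq (1 / 2) d ≤ K * (sobSq 1 c + sobSq 1 d) := by
      have := mul_nonneg hK p1
      nlinarith
    have h4 := sobSq_trunc_le N hun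
    have h5 := sobSq_nonneg (n / 2) (trunc N c)
    calc _ ≤ C * (K * (sobSq 1 c + sobSq 1 d) * sobSq (n / 2) c) := by gcongr
      _ = _ := by ring
  have hv' : ∀ {u v : VelocityField n}, MemHsigma 1 u → MemHsigma 1 v →
      ‖(viscousForm a t u (truncField N v) : ℂ)‖ ≤
        (n : ℝ) ^ 4 * M * (sobSq 1 (fieldCoeffs u) + sobSq 1 (fieldCoeffs v)) := by
    intro u v hu hv
    rw [Complex.norm_real, Real.norm_eq_abs]
    have h3 := sobSq_trunc_le N hv.finite_norm
    refine (abs_viscousForm_le hM ha hu.finite_norm (hv.truncField N 1).finite_norm).trans ?_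
    rw [fieldCoeffs_truncField]
    gcongr
    refine le_add_of_sq_le_mul (sobSq_nonneg _ _) (sobSq_nonneg _ _) ?_
    rw [mul_pow, Real.sq_sqrt (sobSq_nonneg _ _), Real.sq_sqrt (sobSq_nonneg _ _)]
    exact mul_le_mul_of_nonneg_left h3 (sobSq_nonneg _ _)
  have e1 := hF c hc1
  have e2 := hF d hd1
  have e3 := hv' hu hv
  have e4 := hv' hv hu
  rw [galerkinRate]
  refine (norm_sub_le _ _).trans ?_
  refine (add_le_add_left (norm_sub_le _ _) _).trans ?_
  refine (add_le_add_left (add_le_add_left (norm_add_le _ _) _) _).trans ?_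
  refine (add_le_add_left (add_le_add_left (add_le_add_left (norm_sub_le _ _) _) _) _).trans ?_
  refine (add_le_add_left (add_le_add_left (add_le_add_left (add_le_add_left
    (norm_add_le _ _) _) _) _) _).trans ?_
  rw [← hc, ← hd] at *
  linarith

theorem GalerkinEquation.ae_rate_eq {T : ℝ} {a : Viscosity n}
    {f : ℝ → VecDistribution n} {u v : ℝ → VelocityField n} {c d g h : ℝ → Coeffs n}
    (hu : GalerkinEquation T a f u c g) (hv : GalerkinEquation T a f v d h) :
    ∀ᵐ t ∂timeMeasure T, ∀ N, truncProd N (g t) (d t) + truncProd N (c t) (h t) =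
      galerkinRate N a t (distCoeffs (f t)) (u t) (v t) := by
  filter_upwards [hu.equation, hv.equation, hu.ae_eq, hv.ae_eq, hu.ae_mem, hv.ae_mem]
    with t h1 h2 h3 h4 h5 h6 N
  have e1 := h1 (v t) h6 N
  have e2 := h2 (u t) h5 N
  rw [truncProd_comm N (c t), galerkinRate, tri_antisymm h6.sum_mul_eq_zero _ (fieldCoeffs (v t)),
    h3, h4]
  rw [h3] at e1
  rw [h4] at e2
  simp only [truncProd]
  linear_combination e1 + e2

theorem tendsto_truncProd {c d : Coeffs n} (hc : sobolevNormSq 0 c < ⊤)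
    (hd : sobolevNormSq 0 d < ⊤) :
    Tendsto (fun N => truncProd N c d) atTop (𝓝 (dualPair c d)) := by
  have := tendsto_dualPair_trunc (s := 0) (by simpa using hc) hd
  simp only [dualPair_trunc] at this
  exact this

/-- The product of a Serrin-type solution and a weak solution is the integral of its rate. -/
theorem GalerkinEquation.dualPair_sub (hn : 2 ≤ n) {T : ℝ} (hT : 0 < T) {a : Viscosity n}
    {M K : ℝ} (hM : 0 ≤ M) (ha : ∀ᵐ t ∂timeMeasure T, a.BoundedAt t M)
    {f : ℝ → VecDistribution n} {u v : ℝ → VelocityField n} {c d g h : ℝ → Coeffs n}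
    (hu : GalerkinEquation T a f u c g) (hv : GalerkinEquation T a f v d h)
    (hf : ∀ᵐ t ∂timeMeasure T, sobolevNormSq (-1) (distCoeffs (f t)) < ⊤)
    (hfi : Integrable (fun t => sobSq (-1) (distCoeffs (f t))) (timeMeasure T))
    (hun : ∀ᵐ t ∂timeMeasure T, sobolevNormSq (n / 2) (c t) < ⊤)
    (huni : Integrable (fun t => sobSq (n / 2) (c t)) (timeMeasure T))
    (hu1i : Integrable (fun t => sobSq 1 (c t)) (timeMeasure T))
    (hv1i : Integrable (fun t => sobSq 1 (d t)) (timeMeasure T))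
    (huK : ∀ᵐ t ∂timeMeasure T, sobSq 0 (c t) ≤ K) (hvK : ∀ᵐ t ∂timeMeasure T, sobSq 0 (d t) ≤ K)
    (hc0 : ∀ t ∈ Icc 0 T, sobolevNormSq 0 (c t) < ⊤)
    (hd0 : ∀ t ∈ Icc 0 T, sobolevNormSq 0 (d t) < ⊤) :
    Integrable (fun t => productRate a t (distCoeffs (f t)) (u t) (v t)) (timeMeasure T) ∧
    ∀ t ∈ Icc 0 T, dualPair (c t) (d t) - dualPair (c 0) (d 0) =
      ∫ τ in (0 : ℝ)..t, productRate a τ (distCoeffs (f τ)) (u τ) (v τ) := by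
  obtain ⟨C, hC, htri⟩ := exists_norm_tri_sq_le hn
  set G : ℝ → ℝ := fun t => 2 * sobSq (-1) (distCoeffs (f t)) +
      (1 + 2 * C * K + 2 * ((n : ℝ) ^ 4 * M)) * (sobSq 1 (c t) + sobSq 1 (d t)) +
      2 * sobSq (n / 2) (c t) with hG
  have hGi : Integrable G (timeMeasure T) :=
    ((hfi.const_mul 2).add ((hu1i.add hv1i).const_mul _)).add (huni.const_mul 2)
  set r : ℕ → ℝ → ℂ := fun N t => truncProd N (g t) (d t) + truncProd N (c t) (h t) with hr
  have hrm : ∀ N, AEStronglyMeasurable (r N) (timeMeasure T) := fun N =>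
    (hu.aestronglyMeasurable hv N).add (by
      simp only [truncProd_comm N (c _)]
      exact hv.aestronglyMeasurable hu N)
  have hrG : ∀ᵐ t ∂timeMeasure T, ∀ N, ‖r N t‖ ≤ G t := by
    filter_upwards [hu.ae_rate_eq hv, hu.ae_eq, hv.ae_eq, hu.ae_mem, hv.ae_mem, ha, hf, hun, huK,
      hvK] with t h1 h2 h3 h4 h5 h6 h7 h8 h9 h10 N
    simp only [hr, hG]
    rw [h1 N]
    rw [h2] at h8 h9 ⊢
    rw [h3] at h10 ⊢
    exact norm_galerkinRate_le hC htri hM h6 h7 h4 h8 h5 h9 h10 N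
  have hrlim : ∀ᵐ t ∂timeMeasure T, Tendsto (fun N => r N t) atTop
      (𝓝 (productRate a t (distCoeffs (f t)) (u t) (v t))) := by
    filter_upwards [hu.ae_rate_eq hv, hu.ae_eq, hu.ae_mem, hv.ae_mem, ha, hf, hun]
      with t h1 h2 h4 h5 h6 h7 h8
    simp only [hr, h1]
    rw [h2] at h8
    exact tendsto_galerkinRate hn hM h6 h7 h4 h8 h5
  have hri : ∀ N, Integrable (r N) (timeMeasure T) := fun N =>
    hGi.mono' (hrm N) (hrG.mono fun t ht => ht N)
  have hprm : AEStronglyMeasurable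
      (fun t => productRate a t (distCoeffs (f t)) (u t) (v t)) (timeMeasure T) :=
    aestronglyMeasurable_of_tendsto_ae atTop hrm hrlim
  refine ⟨hGi.mono' hprm ?_, fun t ht => ?_⟩
  · filter_upwards [hrG, hrlim] with t h1 h2
    exact le_of_tendsto' h2.norm fun N => h1 N
  · have hN : ∀ N, truncProd N (c t) (d t) - truncProd N (c 0) (d 0) =
        ∫ τ in (0 : ℝ)..t, r N τ := by
      intro N
      refine sub_eq_integral_Icc hT ?_ (hri N) (hu.truncProd_sub hv N) t ht
      unfold truncProd
      exact continuousOn_finsetSum _ fun ξ _ => continuousOn_finsetSum _ fun k _ =>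
        (hu.continuousOn ξ k).mul (hv.continuousOn (-ξ) k)
    have h0 : (0 : ℝ) ∈ Icc 0 T := ⟨le_rfl, hT.le⟩
    have hl1 := (tendsto_truncProd (hc0 t ht) (hd0 t ht)).sub
      (tendsto_truncProd (hc0 0 h0) (hd0 0 h0))
    simp only [hN] at hl1
    refine tendsto_nhds_unique hl1 ?_
    simp only [intervalIntegral.integral_of_le ht.1]
    have hle : volume.restrict (Ioc 0 t) ≤ timeMeasure T := by
      rw [timeMeasure_eq_Ioc]
      exact Measure.restrict_mono (Ioc_subset_Ioc_right ht.2) le_rfl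
    refine tendsto_integral_of_dominated_convergence G (fun N => (hrm N).mono_measure hle)
      (hGi.mono_measure hle) (fun N => ?_) (ae_restrict_Ioc_of_ae_timeMeasure ht.2 hrlim)
    exact ae_restrict_Ioc_of_ae_timeMeasure ht.2 (hrG.mono fun t ht => ht N)

/-! ### Measurability in time of the terms of the energy balance -/

theorem aemeasurable_fieldCoeffs_advection {T : ℝ} {u : ℝ → VelocityField n}
    (hm : TimeMeasurable T fun t => fieldCoeffs (u t))
    (hu : ∀ᵐ t ∂timeMeasure T, MemHsigma 1 (u t)) (ξ : Fin n → ℤ) (k : Fin n) :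
    AEMeasurable (fun t => fieldCoeffs (advection (u t)) ξ k) (timeMeasure T) := by
  refine aemeasurable_of_tendsto_metrizable_ae atTop (f := fun N t => ∑ η ∈ cube n N, ∑ j,
    fieldCoeffs (u t) (ξ - η) j * (2 * Real.pi * Complex.I * (η j : ℂ) * fieldCoeffs (u t) η k))
    (fun N => ?_) ?_
  · exact Finset.aemeasurable_fun_sum _ fun η _ => Finset.aemeasurable_fun_sum _ fun j _ =>
      (hm _ _).mul ((hm _ _).const_mul _)
  · filter_upwards [hu] with t ht
    exact (hasSum_fieldCoeffs_advection ht.isL2 ht.finite_norm ξ k).comp tendsto_cube_atTop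

theorem aemeasurable_truncProd {T : ℝ} {c d : ℝ → Coeffs n} (hc : TimeMeasurable T c)
    (hd : TimeMeasurable T d) (N : ℕ) :
    AEMeasurable (fun t => truncProd N (c t) (d t)) (timeMeasure T) :=
  Finset.aemeasurable_fun_sum _ fun ξ _ => Finset.aemeasurable_fun_sum _ fun k _ =>
    (hc ξ k).mul (hd (-ξ) k)

theorem aemeasurable_dualPair {T s : ℝ} {c d : ℝ → Coeffs n} (hc : TimeMeasurable T c)
    (hd : TimeMeasurable T d) (hcf : ∀ᵐ t ∂timeMeasure T, sobolevNormSq (-s) (c t) < ⊤)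
    (hdf : ∀ᵐ t ∂timeMeasure T, sobolevNormSq s (d t) < ⊤) :
    AEMeasurable (fun t => dualPair (c t) (d t)) (timeMeasure T) := by
  refine aemeasurable_of_tendsto_metrizable_ae atTop (aemeasurable_truncProd hc hd) ?_
  filter_upwards [hcf, hdf] with t h1 h2
  have := tendsto_dualPair_trunc h1 h2
  simp only [dualPair_trunc] at this
  exact this

theorem integrable_dualPair {T s : ℝ} {c d : ℝ → Coeffs n} (hc : TimeMeasurable T c)
    (hd : TimeMeasurable T d) (hcf : ∀ᵐ t ∂timeMeasure T, sobolevNormSq (-s) (c t) < ⊤)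
    (hdf : ∀ᵐ t ∂timeMeasure T, sobolevNormSq s (d t) < ⊤)
    (hci : Integrable (fun t => sobSq (-s) (c t)) (timeMeasure T))
    (hdi : Integrable (fun t => sobSq s (d t)) (timeMeasure T)) :
    Integrable (fun t => dualPair (c t) (d t)) (timeMeasure T) := by
  refine (hci.add hdi).mono' (aemeasurable_dualPair hc hd hcf hdf).aestronglyMeasurable ?_
  filter_upwards [hcf, hdf] with t h1 h2
  exact le_add_of_sq_le_mul (sobSq_nonneg _ _) (sobSq_nonneg _ _) (norm_dualPair_sq_le h1 h2)

theorem GalerkinEquation.integrable_viscousForm_self {T : ℝ} {a : Viscosity n} {M : ℝ}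
    (hM : 0 ≤ M) (ha : ∀ᵐ t ∂timeMeasure T, a.BoundedAt t M)
    {f : ℝ → VecDistribution n} {v : ℝ → VelocityField n} {d h : ℝ → Coeffs n}
    (hv : GalerkinEquation T a f v d h) (hf : TimeMeasurable T fun t => distCoeffs (f t))
    (hvi : Integrable (fun t => sobSq 1 (d t)) (timeMeasure T)) :
    Integrable (fun t => viscousForm a t (v t) (v t)) (timeMeasure T) := by
  have hvm : TimeMeasurable T fun t => fieldCoeffs (v t) := fun ξ k =>
    (hv.timeMeasurable ξ k).congr (hv.ae_eq.mono fun t ht => by simp only [ht])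
  have hmN : ∀ N, AEMeasurable (fun t => truncProd N (distCoeffs (f t)) (d t)
      - truncProd N (h t) (d t) - truncProd N (fieldCoeffs (advection (v t))) (d t))
      (timeMeasure T) := fun N =>
    ((aemeasurable_truncProd hf hv.timeMeasurable N).sub
      (hv.aestronglyMeasurable hv N).aemeasurable).sub
      (aemeasurable_truncProd (fun ξ k => aemeasurable_fieldCoeffs_advection hvm hv.ae_mem ξ k)
        hv.timeMeasurable N)
  have hlim : AEMeasurable (fun t => (viscousForm a t (v t) (v t) : ℂ)) (timeMeasure T) := by
    refine aemeasurable_of_tendsto_metrizable_ae atTop hmN ?_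
    filter_upwards [hv.equation, hv.ae_mem, hv.ae_eq, ha] with t h1 h2 h3 h4
    have h5 := (Complex.continuous_ofReal.tendsto _).comp
      (tendsto_viscousForm_truncField hM h4 h2.finite_norm h2)
    refine h5.congr fun N => ?_
    have h6 := h1 (v t) h2 N
    rw [h3, tri_trunc_eq_sum_advection h2.isL2 h2.finite_norm, dualPair_trunc] at h6
    simp only [truncProd, Function.comp_apply, h3]
    linear_combination h6
  have hm : AEMeasurable (fun t => viscousForm a t (v t) (v t)) (timeMeasure T) := by
    simpa using hlim.re
  refine (hvi.const_mul ((n : ℝ) ^ 4 * M)).mono' hm.aestronglyMeasurable ?_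
  filter_upwards [hv.ae_mem, hv.ae_eq, ha] with t h1 h2 h3
  rw [Real.norm_eq_abs, h2]
  have := abs_viscousForm_le hM h3 h1.finite_norm h1.finite_norm
  rwa [Real.mul_self_sqrt (sobSq_nonneg _ _)] at this

/-! ### Pointwise-in-time estimate of the difference -/

theorem viscousForm_congr {a : Viscosity n} {t : ℝ} {u u' : VelocityField n}
    (h : fieldCoeffs u = fieldCoeffs u') : viscousForm a t u u = viscousForm a t u' u' := by
  have hp : ∀ j k, pderiv j (fun y => u y k) = pderiv j fun y => u' y k := fun j k =>
    pderiv_congr (funext fun ξ => congrFun (congrFun h ξ) k)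
  have hs : strain u = strain u' := by
    funext j b x
    simp only [strain, hp]
  rw [viscousForm, viscousForm, hs]

/-- The dissipation of the difference of two fields controls the advection term. -/
theorem re_productRate_le {C₁ : ℝ} (hC₁ : 0 ≤ C₁)
    (htri : ∀ a b c : Coeffs n, sobolevNormSq 1 a < ⊤ → sobolevNormSq (n / 2) b < ⊤ →
      sobolevNormSq 1 c < ⊤ →
      ‖tri a b c‖ ^ 2 ≤ C₁ * (sobSq (1 / 2) a * sobSq (1 / 2) c * sobSq (n / 2) b))
    {a : Viscosity n} {t M C : ℝ} (hC : 0 < C) (ha : a.BoundedAt t M) (hell : a.EllipticAt t C)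
    {φ : Coeffs n} {u v : VelocityField n} (hu : MemHsigma 1 u)
    (hun : sobolevNormSq (n / 2) (fieldCoeffs u) < ⊤) (hv : MemHsigma 1 v) :
    (dualPair φ (fieldCoeffs v)).re - viscousForm a t v v + 1 / 2 * (productRate a t φ u u).re
      - (productRate a t φ u v).re ≤
    4 * C * C₁ * sobSq (n / 2) (fieldCoeffs u) * sobSq 0 (fieldCoeffs v - fieldCoeffs u) := by
  have hz := hv.sub hu
  have hzc := fieldCoeffs_sub hv.isL2 hu.isL2
  have hdiv := hz.sum_mul_eq_zero
  have hz1 := hz.finite_norm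
  have hvis := sobSq_one_le_viscousForm ha hell hz
  rw [viscousForm_sub_left ha hz.finite_norm hv hu, viscousForm_sub_right ha hv.finite_norm hv hu,
    viscousForm_sub_right ha hu.finite_norm hv hu] at hvis
  rw [hzc] at hvis hdiv hz1
  set z := fieldCoeffs v - fieldCoeffs u with hzdef
  have h1 := sobSq_half_sq_le hz1
  have p0 := sobSq_nonneg 0 z
  have p1 := sobSq_nonneg 1 z
  have pn := sobSq_nonneg (n / 2) (fieldCoeffs u)
  have hb : ‖tri z (fieldCoeffs u) z‖ ≤ sobSq 1 z / (4 * C) +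
      4 * C * C₁ * sobSq (n / 2) (fieldCoeffs u) * sobSq 0 z := by
    refine le_add_of_sq_le_mul (by positivity) (by positivity) ?_
    have hz2 : sobolevNormSq 1 z < ⊤ := hz1
    calc _ ≤ C₁ * (sobSq (1 / 2) z * sobSq (1 / 2) z * sobSq (n / 2) (fieldCoeffs u)) :=
          htri z (fieldCoeffs u) z hz2 hun hz2
      _ = C₁ * (sobSq (1 / 2) z ^ 2 * sobSq (n / 2) (fieldCoeffs u)) := by ring
      _ ≤ C₁ * (sobSq 0 z * sobSq 1 z * sobSq (n / 2) (fieldCoeffs u)) := by gcongr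
      _ = _ := by field_simp
  have hself : tri (fieldCoeffs u - fieldCoeffs u) (fieldCoeffs u)
      (fieldCoeffs u - fieldCoeffs u) = 0 := by
    rw [sub_self]
    simp [tri, triTerm]
  have h2 := (Complex.abs_re_le_norm (tri z (fieldCoeffs u) z)).trans hb
  have h3 := (abs_le.1 h2).1
  simp only [productRate, hself, ← hzdef, Complex.add_re, Complex.sub_re, Complex.ofReal_re,
    Complex.zero_re]
  have h4 : sobSq 1 z / (4 * C) ≤ viscousForm a t v v - viscousForm a t v u -
      (viscousForm a t u v - viscousForm a t u u) := by
    rw [div_le_iff₀ (by positivity)]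
    linarith
  linarith

theorem dualPair_fieldCoeffs {v w : VelocityField n} (hv : IsL2 v) (hw : IsL2 w) :
    dualPair (fieldCoeffs v) (fieldCoeffs w) = innerL2 v w := by
  rw [← (hasSum_innerL2 hv hw).tsum_eq, dualPair, ← (Equiv.neg (Fin n → ℤ)).tsum_eq]
  simp only [Equiv.neg_apply, neg_neg]

theorem innerL2_sub_sub {v w : VelocityField n} (hv : IsL2 v) (hw : IsL2 w) :
    innerL2 (fun x k => v x k - w x k) (fun x k => v x k - w x k) =
      innerL2 v v + innerL2 w w - 2 * innerL2 w v := by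
  have hi : ∀ {p q : VelocityField n}, IsL2 p → IsL2 q →
      Integrable (fun x => ∑ k, p x k * q x k) (torusMeasure n) := fun hp hq =>
    integrable_finsetSum _ fun k _ => (hp k).integrable_mul (hq k)
  have hadd : Integrable (fun x => ∑ k, v x k * v x k + ∑ k, w x k * w x k) (torusMeasure n) :=
    (hi hv hv).add (hi hw hw)
  rw [innerL2, innerL2, innerL2, innerL2, ← integral_add (hi hv hv) (hi hw hw),
    ← integral_const_mul, ← integral_sub hadd ((hi hw hv).const_mul 2)]
  congr 1
  funext x
  rw [Finset.mul_sum, ← Finset.sum_add_distrib, ← Finset.sum_sub_distrib]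
  refine Finset.sum_congr rfl fun k _ => ?_
  ring

theorem MemLinftyHsigma.exists_sobSq_le {T : ℝ} {u : ℝ → VelocityField n}
    (hu : MemLinftyHsigma T 0 u) : ∃ K, ∀ᵐ t ∂timeMeasure T, sobSq 0 (fieldCoeffs (u t)) ≤ K := by
  refine ⟨(essSup (fun t => sobolevNormSq 0 (fieldCoeffs (u t))) (timeMeasure T)).toReal, ?_⟩
  filter_upwards [ENNReal.ae_le_essSup fun t => sobolevNormSq 0 (fieldCoeffs (u t))] with t ht
  exact ENNReal.toReal_mono hu.finite_norm.ne ht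

/-- The weakly continuous versions of a Serrin-type solution and of a weak solution satisfying the
energy inequality have the same Fourier coefficients. -/
theorem fieldCoeffs_eq_of_energyInequality (hn : 2 ≤ n) {T : ℝ} (hT : 0 < T)
    {a : Viscosity n} (ha : a.Bounded T) (ha_ell : a.RelaxedElliptic T)
    {f : ℝ → VecDistribution n} (hf : MemL2Hdot T (-1) f)
    {u₀ : VelocityField n} (hu₀ : MemHsigma 0 u₀) {u v ũ w : ℝ → VelocityField n}
    (hu : IsSerrinSolution T a f u₀ u) (hv : IsWeakSolution T a f u₀ v)
    (hũ : IsWeaklyContinuousVersion T u ũ) (hw : IsWeaklyContinuousVersion T v w)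
    (henergy : ∀ t ∈ Icc 0 T,
      1 / 2 * innerL2 (w t) (w t) + ∫ τ in (0 : ℝ)..t, viscousForm a τ (w τ) (w τ) ≤
        1 / 2 * innerL2 u₀ u₀
          + ∫ τ in (0 : ℝ)..t, (dualPair (distCoeffs (f τ)) (fieldCoeffs (w τ))).re) :
    ∀ t ∈ Icc 0 T, fieldCoeffs (ũ t) = fieldCoeffs (w t) := by
  have h0T : (0 : ℝ) ∈ Icc 0 T := ⟨le_rfl, hT.le⟩
  obtain ⟨M, hM, haM⟩ := ha.exists_boundedAt
  obtain ⟨C, hC, haC⟩ := ha_ell.exists_ellipticAt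
  obtain ⟨C₁, hC₁, htri⟩ := exists_norm_tri_sq_le hn
  obtain ⟨g, hgu⟩ := hu.isWeakSolution.exists_galerkinEquation hT hũ
  obtain ⟨h, hgv⟩ := hv.exists_galerkinEquation hT hw
  obtain ⟨Ku, hKu⟩ := hu.isWeakSolution.mem_Linfty.exists_sobSq_le
  obtain ⟨Kv, hKv⟩ := hv.mem_Linfty.exists_sobSq_le
  have hcu := hgu.ae_eq
  have hcv := hgv.ae_eq
  have hufin := ae_sobolevNormSq_lt_top hu.mem_L2.measurable hu.mem_L2.finite_norm
  have hffin := ae_sobolevNormSq_lt_top hf.measurable hf.finite_norm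
  have hfi := integrable_sobSq hf.measurable hf.finite_norm
  have htrans : ∀ {s : ℝ} {c d : ℝ → Coeffs n}, (∀ᵐ t ∂timeMeasure T, c t = d t) →
      Integrable (fun t => sobSq s (d t)) (timeMeasure T) →
      Integrable (fun t => sobSq s (c t)) (timeMeasure T) := fun he hi =>
    hi.congr (he.mono fun t ht => by simp only [ht])
  have huni := htrans hcu (integrable_sobSq hu.mem_L2.measurable hu.mem_L2.finite_norm)
  have hu1i := htrans hcu (integrable_sobSq hu.isWeakSolution.mem_L2.measurable
    hu.isWeakSolution.mem_L2.finite_norm)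
  have hv1i := htrans hcv (integrable_sobSq hv.mem_L2.measurable hv.mem_L2.finite_norm)
  have hufin' : ∀ᵐ t ∂timeMeasure T, sobolevNormSq (n / 2) (fieldCoeffs (ũ t)) < ⊤ := by
    filter_upwards [hufin, hcu] with t h1 h2
    rwa [h2]
  have hKu' : ∀ᵐ t ∂timeMeasure T, sobSq 0 (fieldCoeffs (ũ t)) ≤ max Ku Kv := by
    filter_upwards [hKu, hcu] with t h1 h2
    rw [h2]
    exact h1.trans (le_max_left _ _)
  have hKv' : ∀ᵐ t ∂timeMeasure T, sobSq 0 (fieldCoeffs (w t)) ≤ max Ku Kv := by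
    filter_upwards [hKv, hcv] with t h1 h2
    rw [h2]
    exact h1.trans (le_max_right _ _)
  have hc0 : ∀ t ∈ Icc 0 T, sobolevNormSq 0 (fieldCoeffs (ũ t)) < ⊤ := fun t ht =>
    (hũ.mem t ht).finite_norm
  have hd0 : ∀ t ∈ Icc 0 T, sobolevNormSq 0 (fieldCoeffs (w t)) < ⊤ := fun t ht =>
    (hw.mem t ht).finite_norm
  obtain ⟨iuv, huv⟩ := hgu.dualPair_sub hn hT hM haM hgv hffin hfi hufin' huni hu1i hv1i hKu' hKv'
    hc0 hd0
  obtain ⟨iuu, huu⟩ := hgu.dualPair_sub hn hT hM haM hgu hffin hfi hufin' huni hu1i hu1i hKu' hKu'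
    hc0 hc0
  have ivis := hgv.integrable_viscousForm_self hM haM hf.measurable hv1i
  have hvfin : ∀ᵐ t ∂timeMeasure T, sobolevNormSq 1 (fieldCoeffs (v t)) < ⊤ :=
    hgv.ae_mem.mono fun t ht => ht.finite_norm
  have ifor : Integrable (fun t => dualPair (distCoeffs (f t)) (fieldCoeffs (v t)))
      (timeMeasure T) :=
    integrable_dualPair hf.measurable hv.mem_L2.measurable hffin hvfin hfi
      (integrable_sobSq hv.mem_L2.measurable hv.mem_L2.finite_norm)
  set φ : ℝ → ℝ := fun t => sobSq 0 (fieldCoeffs (w t) - fieldCoeffs (ũ t)) with hφ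
  set k : ℝ → ℝ := fun t => 2 * (4 * C * C₁ * sobSq (n / 2) (fieldCoeffs (ũ t))) with hk
  have hk0 : ∀ t, 0 ≤ k t := fun t => by
    have := sobSq_nonneg (n / 2) (fieldCoeffs (ũ t))
    positivity
  have hφ0 : ∀ t, 0 ≤ φ t := fun t => sobSq_nonneg _ _
  have hki : Integrable k (timeMeasure T) := (huni.const_mul _).const_mul _
  have hφm : AEMeasurable φ (timeMeasure T) := by
    refine (aemeasurable_sobolevNormSq (s := 0) (c := fun t => fieldCoeffs (w t) - fieldCoeffs (ũ t))
      fun ξ k => ?_).ennreal_toReal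
    exact (hgv.timeMeasurable ξ k).sub (hgu.timeMeasurable ξ k)
  have hφb : ∀ᵐ t ∂timeMeasure T, ‖φ t‖ ≤ 2 * max Ku Kv + 2 * max Ku Kv := by
    have hmem : ∀ᵐ t ∂timeMeasure T, t ∈ Ioo 0 T := ae_restrict_mem measurableSet_Ioo
    filter_upwards [hKu', hKv', hmem] with t h1 h2 h3
    have h4 := hc0 t (Ioo_subset_Icc_self h3)
    have h5 := hd0 t (Ioo_subset_Icc_self h3)
    rw [Real.norm_of_nonneg (hφ0 t)]
    have h6 := ENNReal.toReal_mono (by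
      exact (ENNReal.add_lt_top.2 ⟨ENNReal.mul_lt_top (by simp) h5,
        ENNReal.mul_lt_top (by simp) h4⟩).ne)
      (sobolevNormSq_sub_le 0 (fieldCoeffs (w t)) (fieldCoeffs (ũ t)))
    rw [ENNReal.toReal_add (ENNReal.mul_lt_top (by simp) h5).ne
      (ENNReal.mul_lt_top (by simp) h4).ne, ENNReal.toReal_mul, ENNReal.toReal_mul] at h6
    simp only [ENNReal.toReal_ofNat] at h6
    change φ t ≤ 2 * sobSq 0 _ + 2 * sobSq 0 _ at h6
    linarith
  have hkφ : Integrable (fun t => k t * φ t) (timeMeasure T) :=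
    hki.mul_bdd hφm.aestronglyMeasurable hφb
  have hii := fun t ht => @intervalIntegrable_of_integrable_timeMeasure T 0 t h0T ht
  have hmain : ∀ t ∈ Icc 0 T, φ t ≤ ∫ τ in (0 : ℝ)..t, k τ * φ τ := by
    intro t ht
    have e1 := henergy t ht
    have e2 := congrArg Complex.re (huv t ht)
    have e3 := congrArg Complex.re (huu t ht)
    have hu0c := hu.isWeakSolution.fieldCoeffs_zero hT hu₀ hũ
    have hv0c := hv.fieldCoeffs_zero hT hu₀ hw
    have mu := (hũ.mem t ht).isL2
    have mw := (hw.mem t ht).isL2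
    rw [hu0c, hv0c, dualPair_fieldCoeffs mu mw, dualPair_fieldCoeffs hu₀.isL2 hu₀.isL2,
      ← intervalIntegral_re (hii t ht iuv)] at e2
    rw [hu0c, dualPair_fieldCoeffs mu mu, dualPair_fieldCoeffs hu₀.isL2 hu₀.isL2,
      ← intervalIntegral_re (hii t ht iuu)] at e3
    simp only [Complex.sub_re, Complex.ofReal_re] at e2 e3
    have hφt : φ t = innerL2 (w t) (w t) + innerL2 (ũ t) (ũ t) - 2 * innerL2 (ũ t) (w t) := by
      rw [← innerL2_sub_sub mw mu, innerL2_self_eq (mw.sub mu)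
        ((hw.mem t ht).sub (hũ.mem t ht)).finite_norm, fieldCoeffs_sub mw mu]
    have e4 : ∫ τ in (0 : ℝ)..t, viscousForm a τ (w τ) (w τ) =
        ∫ τ in (0 : ℝ)..t, viscousForm a τ (v τ) (v τ) := by
      rw [intervalIntegral.integral_of_le ht.1, intervalIntegral.integral_of_le ht.1]
      exact integral_congr_ae ((ae_restrict_Ioc_of_ae_timeMeasure ht.2 hcv).mono fun τ hτ =>
        viscousForm_congr hτ)
    have e5 : ∫ τ in (0 : ℝ)..t, (dualPair (distCoeffs (f τ)) (fieldCoeffs (w τ))).re =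
        ∫ τ in (0 : ℝ)..t, (dualPair (distCoeffs (f τ)) (fieldCoeffs (v τ))).re := by
      rw [intervalIntegral.integral_of_le ht.1, intervalIntegral.integral_of_le ht.1]
      exact integral_congr_ae ((ae_restrict_Ioc_of_ae_timeMeasure ht.2 hcv).mono fun τ hτ => by
        simp only [hτ])
    have i1 := intervalIntegrable_re (hii t ht ifor)
    have i2 := hii t ht ivis
    have i3 := (intervalIntegrable_re (hii t ht iuu)).const_mul (1 / 2)
    have i4 := intervalIntegrable_re (hii t ht iuv)
    have e6 : (∫ τ in (0 : ℝ)..t, (dualPair (distCoeffs (f τ)) (fieldCoeffs (v τ))).re)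
        - (∫ τ in (0 : ℝ)..t, viscousForm a τ (v τ) (v τ))
        + 1 / 2 * (∫ τ in (0 : ℝ)..t, (productRate a τ (distCoeffs (f τ)) (u τ) (u τ)).re)
        - (∫ τ in (0 : ℝ)..t, (productRate a τ (distCoeffs (f τ)) (u τ) (v τ)).re) =
        ∫ τ in (0 : ℝ)..t, ((dualPair (distCoeffs (f τ)) (fieldCoeffs (v τ))).re
          - viscousForm a τ (v τ) (v τ)
          + 1 / 2 * (productRate a τ (distCoeffs (f τ)) (u τ) (u τ)).re
          - (productRate a τ (distCoeffs (f τ)) (u τ) (v τ)).re) := by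
      rw [intervalIntegral.integral_sub ((i1.sub i2).add i3) i4,
        intervalIntegral.integral_add (i1.sub i2) i3, intervalIntegral.integral_sub i1 i2,
        intervalIntegral.integral_const_mul]
    have e7 : ∫ τ in (0 : ℝ)..t, ((dualPair (distCoeffs (f τ)) (fieldCoeffs (v τ))).re
          - viscousForm a τ (v τ) (v τ)
          + 1 / 2 * (productRate a τ (distCoeffs (f τ)) (u τ) (u τ)).re
          - (productRate a τ (distCoeffs (f τ)) (u τ) (v τ)).re) ≤
        ∫ τ in (0 : ℝ)..t, 1 / 2 * (k τ * φ τ) := by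
      have i5 := ((i1.sub i2).add i3).sub i4
      have i6 := (hii t ht hkφ).const_mul (1 / 2)
      rw [intervalIntegral.integral_of_le ht.1, intervalIntegral.integral_of_le ht.1]
      refine integral_mono_ae i5.1 i6.1 ?_
      refine ae_restrict_Ioc_of_ae_timeMeasure ht.2 ?_
      filter_upwards [haM, haC, hgu.ae_mem, hgv.ae_mem, hcu, hcv, hufin]
        with τ h1 h2 h3 h4 h5 h6 h7
      refine (re_productRate_le hC₁ htri hC h1 h2 h3 h7 h4).trans (le_of_eq ?_)
      simp only [hk, hφ, h5, h6]
      ring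
    rw [intervalIntegral.integral_const_mul] at e7
    linarith
  have hzero := eq_zero_of_le_integral_mul hT (fun t _ => hφ0 t)
    (M := ∫ τ in (0 : ℝ)..T, k τ * φ τ) (fun t ht => (hmain t ht).trans ?_) hk0 hki hkφ hmain
  · intro t ht
    have h1 := hasSum_sobSq_zero (sobolevNormSq_sub_lt_top (hd0 t ht) (hc0 t ht))
    rw [show sobSq 0 (fieldCoeffs (w t) - fieldCoeffs (ũ t)) = 0 from hzero t ht,
      hasSum_zero_iff_of_nonneg fun ξ => Finset.sum_nonneg fun k _ => sq_nonneg _] at h1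
    funext ξ k
    have h2 := congrFun h1 ξ
    simp only [Pi.zero_apply] at h2
    rw [Finset.sum_eq_zero_iff_of_nonneg fun k _ => sq_nonneg _] at h2
    have h3 := h2 k (Finset.mem_univ k)
    simp only [Pi.sub_apply, ne_eq, OfNat.ofNat_ne_zero, not_false_eq_true, pow_eq_zero_iff,
      norm_eq_zero] at h3
    exact (sub_eq_zero.1 h3).symm
  · exact intervalIntegral.integral_mono_interval le_rfl ht.1 ht.2
      (ae_of_all _ fun x => mul_nonneg (hk0 x) (hφ0 x)) (hii T ⟨hT.le, le_rfl⟩ hkφ)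

end PeriodicNS

end

open PeriodicNS
theorem mainTheorem2 (n : ℕ) (hn : 2 ≤ n) (T : ℝ) (hT : 0 < T)
    (a : Viscosity n) (ha : a.Bounded T) (ha_symm : a.Symmetric T) (ha_ell : a.RelaxedElliptic T)
    (f : ℝ → VecDistribution n) (hf : MemL2Hdot T (-1) f)
    (u₀ : VelocityField n) (hu₀ : MemHsigma 0 u₀)
    (u v : ℝ → VelocityField n)
    (hu : IsSerrinSolution T a f u₀ u)
    (hv : IsWeakSolution T a f u₀ v) (hv_energy : EnergyInequality T a f u₀ v) :
    (∀ᵐ t ∂timeMeasure T, u t =ᵐ[torusMeasure n] v t) ∧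
      ∀ ũ w : ℝ → VelocityField n, IsWeaklyContinuousVersion T u ũ → IsWeaklyContinuousVersion T v w →
        ∀ t ∈ Icc 0 T, ũ t =ᵐ[torusMeasure n] w t := by
  obtain ⟨ũ, hũ, -⟩ := hu.isWeakSolution.initial
  obtain ⟨w, hw, henergy⟩ := hv_energy
  have key := fieldCoeffs_eq_of_energyInequality hn hT ha ha_ell hf hu₀ hu hv hũ hw henergy
  have hmem : ∀ᵐ t ∂timeMeasure T, t ∈ Ioo 0 T := ae_restrict_mem measurableSet_Ioo
  have hae : ∀ᵐ t ∂timeMeasure T, fieldCoeffs (u t) = fieldCoeffs (v t) := by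
    filter_upwards [hmem, hũ.ae_eq, hw.ae_eq] with t ht h1 h2
    rw [← fieldCoeffs_congr_ae h1, ← fieldCoeffs_congr_ae h2]
    exact key t (Ioo_subset_Icc_self ht)
  refine ⟨?_, fun ũ' w' hũ' hw' t ht => ?_⟩
  · filter_upwards [hae, hu.mem_L2.mem, hv.mem_L2.mem] with t h1 h2 h3
    exact ae_eq_of_fieldCoeffs_eq h2.isL2 h3.isL2 h1
  · exact ae_eq_of_fieldCoeffs_eq (hũ'.mem t ht).isL2 (hw'.mem t ht).isL2
      (hũ'.fieldCoeffs_eq hT hw' hae t ht)
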